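/- **Setting.** Let $(X,d)$ be a metric space (distinct points may have distance $0$) and $C\subseteq X$ such that every $x\in X$ has a closest point in $C$. For a finite $P\subseteq X$, the $(k,C)$-median problem asks for a nonempty set $C'\subseteq C$ of at most $k$ centers that minimizes $\sum_{p\in P} d(p,C')$, where $d(p,C')=\min_{c\in C'}d(p,c)$; a solution is $\rho$-approximate if its cost is at most $\rho$ times the cost of every other such set. Let $\varepsilon,\delta\in(0,1)$. The triple $(X,C,d)$ has the *weak sampling property* for $\varepsilon,\delta$ with positive integers $m=m_{\delta,\varepsilon}$, $t=t_{\delta,\varepsilon}$ and candidate map $\Gamma$ if $\Gamma$ assigns to each sample $S$ of $m$ points of $X$ a set $\Gamma(S)\subseteq C$ of at most $t$ points such that for every nonempty finite $P\subseteq X$, if $S$ consists of $m$ points drawn independently and uniformly from $P$, then $$\Pr\Big[\exists c\in\Gamma(S)\ \ \forall c'\in C:\ \sum_{p\in P} d(p,c)\le(1+\varepsilon)\sum_{p\in P} d(p,c')\Big]\ge 1-\delta .$$ **Cost model.** Algorithms are finite programs of a randomized machine that manipulates natural numbers and real numbers (addition, subtraction, comparison), pairs and lists, draws uniform random integers from $\{0,\dots,b\}$,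 and treats points of $X$ and $C$ as opaque handles. Each elementary step takes one unit of time. Computing $d(x,c)$ for $x\in X$, $c\in C$ takes time $\mathcal D(C)\ge1$, and computing a closest point of $C$ to $x\in X$ takes time $\mathcal Q(C)\ge1$. The set $\Gamma(S)$ is obtained from a procedure that uses $\mathcal G=\mathcal G(m)\ge1$ operations, where an evaluation of $d$ and a closest-point computation count as one operation each; a call to it is charged time $\mathcal G\cdot(\mathcal Q(C)+\mathcal D(C))$. **Theorem.** For every $\delta\in(0,1)$ there is a constant $A$ that depends only on $\delta$ such that for every $\varepsilon\in(0,1)$ and every positive integer $m$ there is a program with the following property. Let $(X,C,d)$ have the weak sampling property for $\varepsilon,\delta$ with $m$, $t$ and $\Gamma$, where $\Gamma(S)$ can be computed in $\mathcal G(m)$ operations. Then for every $k\ge1$ and every $P\subseteq X$ with $n\ge1$ points, the program, given $k$ and a list of the points of $P$, always halts within time $$A\cdot n\cdot 2^{A\,k\,m\log_2\left(\frac{k}{\varepsilon}m\right)}\cdot\big(t\cdot\mathcal G(m)\big)^{A k}\cdot\big(\mathcal Q(C)+\mathcal D(C)\big),$$ and with probability at least $1-\delta$ it outputs a $(1+3\varepsilon)$-approximate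 solution of the $(k,C)$-median problem for $P$. -/

import Mathlib

namespace KMedian

/-! ## Clustering notions -/

section Clustering

variable {X : Type*} [PseudoMetricSpace X]

/-- The `k`-median cost `∑_{p ∈ P} d(p, s)` of a set `s` of centers, where `d(p, s)` is the
distance from `p` to the nearest point of `s`. -/
noncomputable def cost (P : Finset X) (s : Set X) : ℝ :=
  ∑ p ∈ P, Metric.infDist p s

/-- `s` is a feasible solution of the `(k, C)`-median problem: a nonempty set of at most `k`
centers, all of them from `C`. -/
def IsCenterSet (C : Set X) (k : ℕ) (s : Set X) : Prop :=
  s ⊆ C ∧ s.Nonempty ∧ s.encard ≤ k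

/-- `s` is a `ρ`-approximate solution of the `(k, C)`-median problem for `P`. -/
def IsApproxMedian (C : Set X) (P : Finset X) (k : ℕ) (ρ : ℝ) (s : Set X) : Prop :=
  IsCenterSet C k s ∧ ∀ s' : Set X, IsCenterSet C k s' → cost P s ≤ ρ * cost P s'

/-- `(X, C, d)` satisfies the weak sampling property for `ε, δ`, with sample size `m`, number of
candidates `t` and candidate map `Γ`: for every nonempty finite `P ⊆ X`, if `S` consists of `m`
independent uniform points of `P`, then with probability at least `1 - δ` some candidate in
`Γ S ⊆ C` is a `(1 + ε)`-approximate `(1, C)`-median of `P`. The map `Γ` sees `S` only, not `P`. -/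
def WeakSampling (C : Set X) (ε δ : ℝ) (m t : ℕ) (Γ : (Fin m → X) → Finset C) : Prop :=
  (∀ S, (Γ S).card ≤ t) ∧
  ∀ (P : Finset X) [Nonempty P],
    1 - δ ≤ ((PMF.uniformOfFintype (Fin m → P)).toOuterMeasure
      {S | ∃ c ∈ Γ (fun i => (S i : X)),
        ∀ c' ∈ C, ∑ p ∈ P, dist p (c : X) ≤ (1 + ε) * ∑ p ∈ P, dist p c'}).toReal

end Clustering

/-! ## The machine model

A randomized first-order functional language with call by value over pointer-like values. A program
is a finite piece of code that does not mention `X` or `C`: points and centers are opaque handles,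
and the code can learn about them only through the three oracle operations. Every evaluated node of
the code is charged. -/

section Machine

/-- Machine values: natural numbers, real numbers, handles of points and of centers, the empty
list, and pairs. -/
inductive Val (X : Type*) (C : Type*) where
  | nat (n : ℕ)
  | real (r : ℝ)
  | pt (x : X)
  | ctr (c : C)
  | nil
  | pair (a b : Val X C)

/-- Operations with one argument. `rand` draws a uniform number, `near` asks for a closest center,
`cand` calls the procedure that produces the candidate centers. -/
inductive UnOp where
  | fst | snd | isPair | toReal | rand | near | cand

/-- Operations with two arguments. `add`, `sub`, `le` act on two natural numbers (where `sub`
truncates at `0`) or on two real numbers; `dst` asks for the distance of a point to a center. -/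
inductive BinOp where
  | pair | add | sub | le | dst

/-- Code, with variables as positions in the environment. -/
inductive Expr where
  | var (i : ℕ)
  | nil
  | nat (n : ℕ)
  | un (o : UnOp) (e : Expr)
  | bin (o : BinOp) (e₁ e₂ : Expr)
  | letIn (e₁ e₂ : Expr)
  | ite (e e₁ e₂ : Expr)
  | call (f : ℕ) (e : Expr)

/-- A program is a finite list of bodies of mutually recursive functions of one argument. -/
abbrev Program := List Expr

/-- The interpretation of the three oracle operations, with the time that each of them takes. -/
structure Oracles (X : Type*) (C : Type*) where
  dst : X → C → ℝ
  near : X → C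
  cand : List X → List C
  dstTime : ℕ
  nearTime : ℕ
  candTime : ℕ

variable {X : Type*} {C : Type*}

namespace Val

/-- A list as a machine value. -/
def ofList : List (Val X C) → Val X C
  | [] => nil
  | v :: l => pair v (ofList l)

/-- The points in a list of points. -/
def toPts : Val X C → List X
  | pair (pt x) v => x :: toPts v
  | _ => []

/-- The centers in a list of centers. -/
def toCtrs : Val X C → List C
  | pair (ctr c) v => c :: toCtrs v
  | _ => []

/-- A truth value as a machine value. -/
def ofProp (p : Prop) [Decidable p] : Val X C := nat (if p then 1 else 0)

end Val

/-- The outcome of a randomized computation: a distribution over pairs of a result and the time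
that was used, where `none` means that the allowed recursion depth was exceeded. -/
abbrev Outcome (α : Type*) := PMF (Option (α × ℕ))

namespace Outcome

/-- A deterministic result, at the given time. -/
noncomputable def ret {α : Type*} (a : α) (time : ℕ) : Outcome α := PMF.pure (some (a, time))

/-- Sequential composition: the times add up. -/
noncomputable def andThen {α β : Type*} (p : Outcome α) (f : α → Outcome β) : Outcome β :=
  PMF.bind p fun
    | none => PMF.pure none
    | some (a, τ) => PMF.map (Option.map fun r => (r.1, τ + r.2)) (f a)

end Outcome

open Outcome

/-- One operation with one argument; ill-typed arguments give `nil`. The operation `rand` maps `b`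
to a uniformly random element of `{0, …, b}`. -/
noncomputable def UnOp.sem (O : Oracles X C) : UnOp → Val X C → Outcome (Val X C)
  | .fst, .pair a _ => ret a 1
  | .snd, .pair _ b => ret b 1
  | .isPair, .pair _ _ => ret (.nat 1) 1
  | .isPair, _ => ret (.nat 0) 1
  | .toReal, .nat n => ret (.real n) 1
  | .rand, .nat b =>
      PMF.map (fun i : Fin (b + 1) => some (Val.nat i, 1)) (PMF.uniformOfFintype (Fin (b + 1)))
  | .near, .pt x => ret (.ctr (O.near x)) O.nearTime
  | .cand, v => ret (.ofList ((O.cand v.toPts).map .ctr)) O.candTime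
  | _, _ => ret .nil 1

open Classical in
/-- One operation with two arguments; ill-typed arguments give `nil`. -/
noncomputable def BinOp.sem (O : Oracles X C) : BinOp → Val X C → Val X C → Outcome (Val X C)
  | .pair, a, b => ret (.pair a b) 1
  | .add, .nat a, .nat b => ret (.nat (a + b)) 1
  | .add, .real a, .real b => ret (.real (a + b)) 1
  | .sub, .nat a, .nat b => ret (.nat (a - b)) 1
  | .sub, .real a, .real b => ret (.real (a - b)) 1
  | .le, .nat a, .nat b => ret (.ofProp (a ≤ b)) 1
  | .le, .real a, .real b => ret (.ofProp (a ≤ b)) 1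
  | .dst, .pt x, .ctr c => ret (.real (O.dst x c)) O.dstTime
  | _, _, _ => ret .nil 1

/-- Evaluation of code in an environment, given the meaning of the function calls. Each node costs
one unit of time, except that an oracle operation costs the time of that oracle. The number `0`
counts as false, every other value as true. -/
noncomputable def Expr.sem (O : Oracles X C) (calls : ℕ → Val X C → Outcome (Val X C)) :
    Expr → List (Val X C) → Outcome (Val X C)
  | .var i, env => ret (env.getD i .nil) 1
  | .nil, _ => ret .nil 1
  | .nat n, _ => ret (.nat n) 1
  | .un o e, env => andThen (e.sem O calls env) fun v => o.sem O v
  | .bin o e₁ e₂, env =>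
      andThen (e₁.sem O calls env) fun v => andThen (e₂.sem O calls env) fun w => o.sem O v w
  | .letIn e₁ e₂, env =>
      andThen (e₁.sem O calls env) fun v => andThen (ret () 1) fun _ => e₂.sem O calls (v :: env)
  | .ite e e₁ e₂, env =>
      andThen (e.sem O calls env) fun v => andThen (ret () 1) fun _ =>
        match v with
        | .nat 0 => e₂.sem O calls env
        | _ => e₁.sem O calls env
  | .call f e, env =>
      andThen (e.sem O calls env) fun v => andThen (ret () 1) fun _ => calls f v

/-- The outcome of function `f` of the program on the argument `v`, with recursion depth at
most `depth`. -/
noncomputable def Program.run (O : Oracles X C) (prog : Program) :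
    (depth : ℕ) → (f : ℕ) → (v : Val X C) → Outcome (Val X C)
  | 0, _, _ => PMF.pure none
  | depth + 1, f, v => (prog.getD f .nil).sem O (Program.run O prog depth) [v]

/-- On the input `v`, every run of the program (started at function `0`) halts within time `T`,
and with probability at least `q` the result satisfies `good`. -/
def Program.Achieves (O : Oracles X C) (prog : Program) (v : Val X C) (T : ℝ) (q : ℝ)
    (good : Val X C → Prop) : Prop :=
  ∃ depth : ℕ,
    (∀ r ∈ (prog.run O depth 0 v).support, ∃ w τ, r = some (w, τ) ∧ (τ : ℝ) ≤ T) ∧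
    q ≤ ((prog.run O depth 0 v).toOuterMeasure {r | ∃ w τ, r = some (w, τ) ∧ good w}).toReal

end Machine

section Instance

variable {X : Type*} [PseudoMetricSpace X]

/-- The oracles of an instance `(X, C, d)`. A distance computation takes time `D` and a
closest-center computation takes time `Q`. Computing `Γ S` for a sample `S` of `m` points takes `G`
operations, each of which is an elementary step, a distance or a closest-center computation; since
each of those takes time at most `Q + D`, the whole computation is charged `G * (Q + D)`. A list
that does not consist of exactly `m` points gives no candidates. -/
noncomputable def oracles (C : Set X) {m : ℕ} (Γ : (Fin m → X) → Finset C) (near : X → C)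
    (G Q D : ℕ) : Oracles X C where
  dst x c := dist x (c : X)
  near := near
  cand S := if h : S.length = m then (Γ fun i => S.get (i.cast h.symm)).toList else []
  dstTime := D
  nearTime := Q
  candTime := G * (Q + D)

/-- The input of the algorithm: the number `k` and a list of the points of `P`. -/
def input (C : Set X) (k : ℕ) (l : List X) : Val X C :=
  .pair (.nat k) (.ofList (l.map .pt))

/-- The set of centers that a machine value lists. -/
def outputSet {C : Set X} (v : Val X C) : Set X := {x | ∃ c ∈ v.toCtrs, (c : X) = x}

end Instance

end KMedian

/-! The algorithm combines superset sampling with pruning. Fix a competing solution and assign every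
point to a nearest one of its at most `k` centers. The search holds a list `R` of remaining points,
each with a key that bounds its distance to the centers chosen so far. Call a point bad if its
cluster belongs to a center of the competitor that has no substitute yet. Put `W = k * (k * w)` with
`w = 96 * ⌈1/ε⌉`.

If one of these clusters holds a fraction of at least `1/W` of `R`, then `m` uniform entries of `R`
all lie in it with probability at least `1/W^m`, and in that case the weak sampling property yields
a good candidate with probability at least `1 - δ`. Hence `M = W^m * (k * K)` samples all miss with
probability at most `δ/k` (`badCount_weakSampling`, `coll_cluster`, `one_sub_pow_le`), and the
search branches over all candidates. Otherwise at most a fraction `ρ = 1/(k * w)` of `R` is bad, and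
it is cheap to serve all points with keys up to an approximate median `θ` by the chosen centers and
to drop them. The two cases cannot be told apart by the program, so it explores both options and
keeps the cheaper result (`searchGood_step`).

Pruning overpays at most `θ` for each of at most `ρ * |R|` bad points. This is charged to the good
points: those that survive have keys above `θ`. The charges are controlled by the potential `96 * ρ
* (goodSum - |R| * μ / 16)`, where `μ` is a lower bound of the keys and the subtracted part is
already spent (`exists_level_prune`). So a whole chain of prunings between two new centers costs a
fraction `96 * ρ` of the weight, all chains together a factor `1 + 96 * ρ * k = 1 + 96 / w ≤ 1 + ε`.
The candidates contribute another `1 + ε`, and `(1 + ε)^2 ≤ 1 + 3 * ε`. Only the samples for the at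
most `k` centers can fail, which gives `δ` in total.

The threshold `θ` comes from a deterministic linear time summary (`approxMedian_spec`), so that
pruning always removes at least `7/16` of the list. The time on `n` points with `l` centers to go is
therefore at most that for `9 * n / 16` points, plus `M * t` times that for `l - 1` centers, plus
linear work for fixed `m`, `t`, `M` and oracle times; `searchTime` solves this recursion for every
run.

The infimum of the costs need not be attained. `main_good` compares the output with one fixed
solution, and `main_approx` passes to a minimizing sequence by continuity of measure. -/

namespace KMedian

open Outcome
open scoped ENNReal

/-! ## Outcomes: algebra and a union-bound logic -/

section OutcomeLogic

variable {α β γ : Type*}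

namespace Outcome

/-- Charge `s` additional units of time. -/
noncomputable def delay (s : ℕ) (p : Outcome α) : Outcome α :=
  PMF.map (Option.map fun r => (r.1, s + r.2)) p

@[simp] theorem delay_ret (s t : ℕ) (a : α) : delay s (ret a t) = ret a (s + t) := by
  simp [delay, ret, PMF.pure_map]

@[simp] theorem delay_delay (s t : ℕ) (p : Outcome α) : delay s (delay t p) = delay (s + t) p := by
  simp only [delay, PMF.map_comp]
  congr 1
  funext r
  cases r <;> simp [Nat.add_assoc]

@[simp] theorem andThen_ret (a : α) (s : ℕ) (f : α → Outcome β) :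
    andThen (ret a s) f = delay s (f a) := by
  simp [andThen, ret, delay, PMF.pure_bind]

@[simp] theorem andThen_delay (s : ℕ) (p : Outcome α) (f : α → Outcome β) :
    andThen (delay s p) f = delay s (andThen p f) := by
  simp only [andThen, delay, PMF.bind_map, PMF.map_bind]
  congr 1
  funext r
  cases r with
  | none => simp [PMF.pure_map]
  | some r =>
    simp only [Function.comp, Option.map_some, PMF.map_comp]
    congr 1
    funext r
    cases r <;> simp [Nat.add_assoc]

@[simp] theorem andThen_assoc (p : Outcome α) (f : α → Outcome β) (g : β → Outcome γ) :
    andThen (andThen p f) g = andThen p fun a => andThen (f a) g := by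
  simp only [andThen, PMF.bind_bind]
  congr 1
  funext r
  cases r with
  | none => simp [PMF.pure_bind]
  | some r =>
    simp only [PMF.bind_map, PMF.map_bind]
    congr 1
    funext r
    cases r with
    | none => simp [PMF.pure_map]
    | some r =>
      simp only [Function.comp, Option.map_some, PMF.map_comp]
      congr 1
      funext r
      cases r <;> simp [Nat.add_assoc]

/-- The runs that halt within time `T` with a result in `G`. -/
def Event (T : ℕ) (G : α → Prop) : Set (Option (α × ℕ)) :=
  {r | ∃ a τ, r = some (a, τ) ∧ τ ≤ T ∧ G a}

/-- Except with probability `η`, the computation halts within time `T` with a result in `G`. -/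
def Ensures (p : Outcome α) (T : ℕ) (η : ℝ≥0∞) (G : α → Prop) : Prop :=
  p.toOuterMeasure (Event T G)ᶜ ≤ η

theorem Ensures.mono {p : Outcome α} {T T' : ℕ} {η η' : ℝ≥0∞} {G G' : α → Prop}
    (h : Ensures p T η G) (hT : T ≤ T') (hη : η ≤ η') (hG : ∀ a, G a → G' a) :
    Ensures p T' η' G' := by
  refine le_trans (p.toOuterMeasure.mono ?_) (h.trans hη)
  apply Set.compl_subset_compl.2
  rintro _ ⟨a, τ, rfl, h1, h2⟩
  exact ⟨a, τ, rfl, h1.trans hT, hG a h2⟩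

theorem ensures_ret {a : α} {t T : ℕ} {G : α → Prop} (ht : t ≤ T) (h : G a) (η : ℝ≥0∞) :
    Ensures (ret a t) T η G := by
  refine le_trans (le_of_eq ?_) (zero_le (a := η))
  rw [PMF.toOuterMeasure_apply_eq_zero_iff]
  simp only [ret, PMF.support_pure]
  rw [Set.disjoint_singleton_left]
  simpa using ⟨a, t, rfl, ht, h⟩

theorem Ensures.delay {p : Outcome α} {T : ℕ} {η : ℝ≥0∞} {G : α → Prop}
    (h : Ensures p T η G) (s : ℕ) : Ensures (delay s p) (s + T) η G := by
  refine le_trans ?_ h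
  rw [Outcome.delay, PMF.toOuterMeasure_map_apply]
  apply p.toOuterMeasure.mono
  rintro r hr ⟨a, τ, rfl, h1, h2⟩
  exact hr ⟨a, s + τ, by simp, by omega, h2⟩

/-- Failure probability zero speaks about every single run. Worst case time bounds and probabilistic
guarantees thus share one calculus. -/
theorem ensures_zero_iff {p : Outcome α} {T : ℕ} {G : α → Prop} :
    Ensures p T 0 G ↔ ∀ r ∈ p.support, ∃ a τ, r = some (a, τ) ∧ τ ≤ T ∧ G a := by
  rw [Ensures, nonpos_iff_eq_zero, PMF.toOuterMeasure_apply_eq_zero_iff,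
    Set.disjoint_compl_right_iff_subset]
  rfl

theorem andThen_apply (p : Outcome α) (f : α → Outcome β) (s : Set (Option (β × ℕ))) :
    (andThen p f).toOuterMeasure s = ∑' r, p r *
      (match r with
        | none => (PMF.pure none : Outcome β)
        | some (a, τ) => Outcome.delay τ (f a)).toOuterMeasure s := by
  rw [andThen, PMF.toOuterMeasure_bind_apply]
  congr 1

theorem prob_le_one (p : PMF α) (s : Set α) : p.toOuterMeasure s ≤ 1 := by
  rw [PMF.toOuterMeasure_apply]
  calc ∑' x, s.indicator p x ≤ ∑' x, p x :=
        ENNReal.tsum_le_tsum fun x => Set.indicator_le_self _ _ _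
    _ = 1 := p.tsum_coe

theorem ensures_one (p : Outcome α) (T : ℕ) (G : α → Prop) : Ensures p T 1 G :=
  prob_le_one p _

/-- Sequential composition, where a failure of the first part (of probability at most `η₁`) leaves
a failure probability of at most `η₃`. -/
theorem Ensures.andThen_retry {p : Outcome α} {f : α → Outcome β} {T₁ T₂ : ℕ} {η₁ η₂ η₃ : ℝ≥0∞}
    {S G₁ : α → Prop} {G₂ : β → Prop} (hS : Ensures p T₁ 0 S) (h₁ : Ensures p T₁ η₁ G₁)
    (h₂ : ∀ a, S a → G₁ a → Ensures (f a) T₂ η₂ G₂) (h₃ : ∀ a, S a → Ensures (f a) T₂ η₃ G₂) :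
    Ensures (andThen p f) (T₁ + T₂) (η₁ * η₃ + η₂) G₂ := by
  classical
  rw [Ensures, andThen_apply]
  -- Pointwise in the first outcome: inside `Event T₁ G₁` the second part fails with probability at
  -- most `η₂`, outside with at most `η₃`.
  have key : ∀ r, p r *
      (match r with
        | none => (PMF.pure none : Outcome β)
        | some (a, τ) => Outcome.delay τ (f a)).toOuterMeasure (Event (T₁ + T₂) G₂)ᶜ ≤
      (Event T₁ G₁)ᶜ.indicator p r * η₃ + p r * η₂ := by
    intro r
    by_cases hr : p r = 0
    · simp [hr]
    obtain ⟨a, τ, rfl, hτ, ha⟩ := ensures_zero_iff.1 hS r ((PMF.mem_support_iff _ _).2 hr)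
    have hd : ∀ η, Ensures (f a) T₂ η G₂ →
        (Outcome.delay τ (f a)).toOuterMeasure (Event (T₁ + T₂) G₂)ᶜ ≤ η :=
      fun η h => (h.delay τ).mono (by omega) le_rfl fun _ h => h
    by_cases hG : some (a, τ) ∈ Event T₁ G₁
    · have hG' : G₁ a := by
        obtain ⟨a', τ', h, -, h'⟩ := hG
        simp only [Option.some.injEq, Prod.mk.injEq] at h
        rw [h.1]; exact h'
      refine le_trans ?_ le_add_self
      gcongr
      exact hd _ (h₂ a ha hG')
    · refine le_trans ?_ le_self_add
      rw [Set.indicator_of_mem (show some (a, τ) ∈ (Event T₁ G₁)ᶜ from hG)]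
      gcongr
      exact hd _ (h₃ a ha)
  refine (ENNReal.tsum_le_tsum key).trans ?_
  rw [ENNReal.tsum_add, ENNReal.tsum_mul_right, ENNReal.tsum_mul_right, p.tsum_coe, one_mul]
  gcongr
  rw [← PMF.toOuterMeasure_apply]
  exact h₁

/-- The union bound. Nothing is assumed about the second part after a failure of the first, not even
that it halts. -/
theorem Ensures.andThen {p : Outcome α} {f : α → Outcome β} {T₁ T₂ : ℕ} {η₁ η₂ : ℝ≥0∞}
    {G₁ : α → Prop} {G₂ : β → Prop} (h₁ : Ensures p T₁ η₁ G₁)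
    (h₂ : ∀ a, G₁ a → Ensures (f a) T₂ η₂ G₂) :
    Ensures (andThen p f) (T₁ + T₂) (η₁ + η₂) G₂ := by
  classical
  rw [Ensures, andThen_apply]
  have key : ∀ r, p r *
      (match r with
        | none => (PMF.pure none : Outcome β)
        | some (a, τ) => Outcome.delay τ (f a)).toOuterMeasure (Event (T₁ + T₂) G₂)ᶜ ≤
      (Event T₁ G₁)ᶜ.indicator p r + p r * η₂ := by
    intro r
    by_cases hG : r ∈ Event T₁ G₁
    · obtain ⟨a, τ, rfl, hτ, ha⟩ := hG
      refine le_trans ?_ le_add_self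
      gcongr
      exact ((h₂ a ha).delay τ).mono (by omega) le_rfl fun _ h => h
    · refine le_trans ?_ le_self_add
      rw [Set.indicator_of_mem (show r ∈ (Event T₁ G₁)ᶜ from hG)]
      exact mul_le_of_le_one_right' (prob_le_one _ _)
  refine (ENNReal.tsum_le_tsum key).trans ?_
  rw [ENNReal.tsum_add, ENNReal.tsum_mul_right, p.tsum_coe, one_mul]
  gcongr
  rw [← PMF.toOuterMeasure_apply]
  exact h₁

/-- A uniformly random choice followed by a computation whose failure probability depends on it. -/
theorem ensures_uniform {b : ℕ} {h : Fin (b + 1) → α} {f : α → Outcome β} {T t : ℕ}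
    {η : Fin (b + 1) → ℝ≥0∞} {G : β → Prop} (H : ∀ i, Ensures (f (h i)) T (η i) G) :
    Ensures (Outcome.andThen
      (PMF.map (fun i => some (h i, t)) (PMF.uniformOfFintype (Fin (b + 1)))) f) (t + T)
      ((∑ i, η i) / (b + 1 : ℕ)) G := by
  rw [Ensures, Outcome.andThen, PMF.bind_map, PMF.toOuterMeasure_bind_apply, tsum_fintype]
  simp only [div_eq_mul_inv, Finset.sum_mul]
  refine Finset.sum_le_sum fun i _ => ?_
  rw [PMF.uniformOfFintype_apply, Fintype.card_fin, mul_comm]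
  gcongr
  exact (H i).delay t

end Outcome

end OutcomeLogic

/-! ## The program -/

namespace Code

abbrev fst (e : Expr) : Expr := .un .fst e
abbrev snd (e : Expr) : Expr := .un .snd e
abbrev isPair (e : Expr) : Expr := .un .isPair e
abbrev mk (e₁ e₂ : Expr) : Expr := .bin .pair e₁ e₂
abbrev v (i : ℕ) : Expr := .var i

/-- Length of a list. -/
def len : Expr :=
  .ite (isPair (v 0)) (.bin .add (.nat 1) (.call 1 (snd (v 0)))) (.nat 0)

/-- `(l, i) ↦ l[i]`. -/
def nth : Expr :=
  .ite (snd (v 0)) (.call 2 (mk (snd (fst (v 0))) (.bin .sub (snd (v 0)) (.nat 1))))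
    (fst (fst (v 0)))

/-- `(j, n - 1, R) ↦` the points of `j` independent uniform entries of the list `R` of length `n`. -/
def draw : Expr :=
  .ite (fst (v 0))
    (mk (fst (.call 2 (mk (snd (snd (v 0))) (.un .rand (fst (snd (v 0)))))))
      (.call 3 (mk (.bin .sub (fst (v 0)) (.nat 1)) (snd (v 0)))))
    .nil

/-- `(a, b) ↦ a ++ b`. -/
def app : Expr :=
  .ite (isPair (fst (v 0)))
    (mk (fst (fst (v 0))) (.call 4 (mk (snd (fst (v 0))) (snd (v 0)))))
    (snd (v 0))

/-- `(j, n - 1, R) ↦` all candidates for `j` samples of size `m` of the list `R` of length `n`. -/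
def coll (m : ℕ) : Expr :=
  .ite (fst (v 0))
    (.call 4 (mk (.un .cand (.call 3 (mk (.nat m) (snd (v 0)))))
      (.call 5 (mk (.bin .sub (fst (v 0)) (.nat 1)) (snd (v 0))))))
    .nil

/-- `(c, R) ↦` the list `R` with each key replaced by its minimum with the distance to `c`. -/
def upd : Expr :=
  .ite (isPair (snd (v 0)))
    (.letIn (.bin .dst (fst (fst (snd (v 0)))) (fst (v 0)))
      (mk
        (mk (fst (fst (snd (v 1))))
          (.ite (.bin .le (v 0) (snd (fst (snd (v 1))))) (v 0) (snd (fst (snd (v 1))))))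
        (.call 6 (mk (fst (v 1)) (snd (snd (v 1)))))))
    .nil

/-- Attach the key `nil` to each point of a list. -/
def init : Expr :=
  .ite (isPair (v 0)) (mk (mk (fst (v 0)) .nil) (.call 7 (snd (v 0)))) .nil

/-- The keys of a list, as lists of length one. -/
def singles : Expr :=
  .ite (isPair (v 0)) (mk (mk (snd (fst (v 0))) .nil) (.call 8 (snd (v 0)))) .nil

/-- Merge two sorted lists. -/
def mrg : Expr :=
  .ite (isPair (fst (v 0)))
    (.ite (isPair (snd (v 0)))
      (.ite (.bin .le (fst (fst (v 0))) (fst (snd (v 0))))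
        (mk (fst (fst (v 0))) (.call 9 (mk (snd (fst (v 0))) (snd (v 0)))))
        (mk (fst (snd (v 0))) (.call 9 (mk (fst (v 0)) (snd (snd (v 0)))))))
      (fst (v 0)))
    (snd (v 0))

/-- Merge neighbours in a list of sorted lists. -/
def pairs : Expr :=
  .ite (isPair (v 0))
    (.ite (isPair (snd (v 0)))
      (mk (.call 9 (mk (fst (v 0)) (fst (snd (v 0))))) (.call 10 (snd (snd (v 0)))))
      (v 0))
    .nil

/-- Every second entry of a list. -/
def thin : Expr :=
  .ite (isPair (v 0))
    (.ite (isPair (snd (v 0)))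
      (mk (fst (snd (v 0))) (.call 11 (snd (snd (v 0)))))
      .nil)
    .nil

/-- Thin every list of a list. -/
def thins : Expr :=
  .ite (isPair (v 0)) (mk (.call 11 (fst (v 0))) (.call 12 (snd (v 0)))) .nil

/-- Merge by fours and thin until one list is left. -/
def red : Expr :=
  .ite (isPair (snd (v 0)))
    (.call 13 (.call 12 (.call 10 (.call 10 (v 0)))))
    (fst (v 0))

/-- `(a, b) ↦ a[|b| / 2]`. -/
def mid : Expr :=
  .ite (isPair (snd (v 0)))
    (.ite (isPair (snd (snd (v 0))))
      (.call 14 (mk (snd (fst (v 0))) (snd (snd (snd (v 0))))))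
      (fst (fst (v 0))))
    (fst (fst (v 0)))

/-- `(θ, R) ↦` the sum of the keys that are at most `θ`, and the list of the other entries. -/
def part : Expr :=
  .ite (isPair (snd (v 0)))
    (.letIn (.call 15 (mk (fst (v 0)) (snd (snd (v 0)))))
      (.ite (.bin .le (snd (fst (snd (v 1)))) (fst (v 1)))
        (mk (.bin .add (snd (fst (snd (v 1)))) (fst (v 0))) (snd (v 0)))
        (mk (fst (v 0)) (mk (fst (snd (v 1))) (snd (v 0))))))
    (mk (.un .toReal (.nat 0)) .nil)

/-- `R ↦` an approximate median of the keys. -/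
def pivot : Expr :=
  .letIn (.call 13 (.call 10 (.call 10 (.call 10 (.call 8 (v 0)))))) (.call 14 (mk (v 0) (v 0)))

/-- `(M, l, R, Cl) ↦` an upper bound of the cost of the points of `R`, and a list of centers that
extends `Cl` by at most `l` centers. -/
def search : Expr :=
  .ite (isPair (fst (snd (snd (v 0)))))
    (.letIn (.call 15 (mk (.call 19 (fst (snd (snd (v 0))))) (fst (snd (snd (v 0))))))
    (.letIn (.call 16 (mk (fst (v 1)) (mk (fst (snd (v 1))) (mk (snd (v 0)) (snd (snd (snd (v 1))))))))
    (.letIn (mk (.bin .add (fst (v 1)) (fst (v 0))) (snd (v 0)))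
    (.ite (fst (snd (v 3)))
      (.letIn (.call 17 (mk
          (.call 5 (mk (fst (v 3))
            (mk (.bin .sub (.call 1 (fst (snd (snd (v 3))))) (.nat 1)) (fst (snd (snd (v 3)))))))
          (mk (fst (v 3)) (mk (.bin .sub (fst (snd (v 3))) (.nat 1)) (snd (snd (v 3)))))))
        (.ite (.bin .le (fst (v 1)) (fst (v 0))) (v 1) (v 0)))
      (v 0)))))
    (mk (.un .toReal (.nat 0)) (snd (snd (snd (v 0)))))

/-- `(T, M, l, R, Cl) ↦` the best result of `search` over the ways to add a center from `T`. -/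
def branch : Expr :=
  .ite (isPair (fst (v 0)))
    (.letIn (.call 16 (mk (fst (snd (v 0))) (mk (fst (snd (snd (v 0))))
      (mk (.call 6 (mk (fst (fst (v 0))) (fst (snd (snd (snd (v 0)))))))
        (mk (fst (fst (v 0))) (snd (snd (snd (snd (v 0))))))))))
    (.letIn (.call 17 (mk (snd (fst (v 1))) (snd (v 1))))
      (.ite (.bin .le (fst (v 1)) (fst (v 0))) (v 1) (v 0))))
    .nil

/-- `(a, b) ↦ a * b`. -/
def mul : Expr :=
  .ite (fst (v 0))
    (.bin .add (snd (v 0)) (.call 18 (mk (.bin .sub (fst (v 0)) (.nat 1)) (snd (v 0)))))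
    (.nat 0)

/-- `(j, w, a) ↦ w ^ j * a`. -/
def pow : Expr :=
  .ite (fst (v 0))
    (.call 18 (mk (fst (snd (v 0))) (.call 20 (mk (.bin .sub (fst (v 0)) (.nat 1)) (snd (v 0))))))
    (snd (snd (v 0)))

/-- `(k, l) ↦` a list of centers. -/
def main (m w K : ℕ) : Expr :=
  .letIn (.call 7 (snd (v 0)))
  (.letIn (.call 20 (mk (.nat m) (mk
      (.call 18 (mk (fst (v 1)) (.call 18 (mk (fst (v 1)) (.nat w)))))
      (.call 18 (mk (fst (v 1)) (.nat K))))))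
  (snd (.call 17 (mk
    (.call 5 (mk (v 0) (mk (.bin .sub (.call 1 (v 1)) (.nat 1)) (v 1))))
    (mk (v 0) (mk (.bin .sub (fst (v 2)) (.nat 1)) (mk (v 1) .nil)))))))

end Code

/-- The program: its sample size is `m`, and it draws `K k (w k ^ 2) ^ m` samples for each
center. -/
def code (m w K : ℕ) : Program :=
  [Code.main m w K, Code.len, Code.nth, Code.draw, Code.app, Code.coll m, Code.upd, Code.init,
    Code.singles, Code.mrg, Code.pairs, Code.thin, Code.thins, Code.red, Code.mid, Code.part,
    Code.search, Code.branch, Code.mul, Code.pivot, Code.pow]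

/-! ### Mergeable summaries for an approximate median -/

/-- Every second entry of a list. -/
def everySecond {α : Type*} : List α → List α
  | [] => []
  | [_] => []
  | _ :: y :: l => y :: everySecond l

/-- Merge neighbours in a list of sorted lists. -/
noncomputable def mergePairs : List (List ℝ) → List (List ℝ)
  | [] => []
  | [a] => [a]
  | a :: b :: L => a.merge b (fun x y => decide (x ≤ y)) :: mergePairs L

theorem length_mergePairs (L : List (List ℝ)) : (mergePairs L).length = (L.length + 1) / 2 := by
  fun_induction mergePairs L <;> simp <;> omega

theorem sum_length_mergePairs (L : List (List ℝ)) :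
    ((mergePairs L).map List.length).sum = (L.map List.length).sum := by
  fun_induction mergePairs L <;> simp [*] <;> omega

theorem length_everySecond {α : Type*} (l : List α) : (everySecond l).length = l.length / 2 := by
  fun_induction everySecond l <;> simp [*] <;> omega

/-- Merging keeps the total length and thinning halves it, so the time of `reduce` is a geometric
series. -/
theorem sum_length_map_everySecond (L : List (List ℝ)) :
    2 * ((L.map everySecond).map List.length).sum ≤ (L.map List.length).sum := by
  induction L with
  | nil => simp
  | cons a L ih =>
    simp only [List.map_cons, List.sum_cons, length_everySecond]
    omega

/-- Merge by fours and thin until one list is left. -/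
noncomputable def reduce (L : List (List ℝ)) : List ℝ :=
  if 2 ≤ L.length then reduce ((mergePairs (mergePairs L)).map everySecond) else L.headD []
termination_by L.length
decreasing_by
  simp only [List.length_map, length_mergePairs]
  omega

theorem length_reduce_le (L : List (List ℝ)) : (reduce L).length ≤ (L.map List.length).sum := by
  fun_induction reduce L with
  | case1 L h ih =>
    have hs := sum_length_map_everySecond (mergePairs (mergePairs L))
    rw [sum_length_mergePairs, sum_length_mergePairs] at hs
    omega
  | case2 L h => cases L <;> simp

/-- A sorted list that approximates the distribution of the entries of a list. -/
noncomputable def summary (l : List ℝ) : List ℝ :=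
  reduce (mergePairs (mergePairs (mergePairs (l.map fun x => [x]))))

/-- An approximate median. -/
noncomputable def approxMedian (l : List ℝ) : ℝ :=
  (summary l).getD ((summary l).length / 2) 0

/-! ### Evaluation of the deterministic functions -/

section Semantics

variable {X C : Type*} (O : Oracles X C) (m w K : ℕ)

/-- The choice that a conditional makes. -/
def select {α : Type*} (v : Val X C) (p q : α) : α :=
  match v with
  | .nat 0 => q
  | _ => p

@[simp] theorem select_zero {α : Type*} (p q : α) : select (.nat 0 : Val X C) p q = q := rfl
@[simp] theorem select_succ {α : Type*} (n : ℕ) (p q : α) :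
    select (.nat (n + 1) : Val X C) p q = p := rfl
@[simp] theorem select_nil {α : Type*} (p q : α) : select (.nil : Val X C) p q = p := rfl
@[simp] theorem select_ofProp {α : Type*} (a : Prop) [Decidable a] (p q : α) :
    select (.ofProp a : Val X C) p q = if a then p else q := by
  by_cases h : a <;> simp [Val.ofProp, h]

section

variable (calls : ℕ → Val X C → Outcome (Val X C)) (env : List (Val X C))

@[simp] theorem sem_var (i : ℕ) : (Expr.var i).sem O calls env = ret (env.getD i .nil) 1 := rfl
@[simp] theorem sem_nil : Expr.nil.sem O calls env = ret .nil 1 := rfl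
@[simp] theorem sem_nat (n : ℕ) : (Expr.nat n).sem O calls env = ret (.nat n) 1 := rfl
@[simp] theorem sem_un (o : UnOp) (e : Expr) : (Expr.un o e).sem O calls env =
    andThen (e.sem O calls env) fun v => o.sem O v := rfl
@[simp] theorem sem_bin (o : BinOp) (e₁ e₂ : Expr) : (Expr.bin o e₁ e₂).sem O calls env =
    andThen (e₁.sem O calls env) fun v => andThen (e₂.sem O calls env) fun w => o.sem O v w := rfl
@[simp] theorem sem_letIn (e₁ e₂ : Expr) : (Expr.letIn e₁ e₂).sem O calls env =
    andThen (e₁.sem O calls env) fun v => delay 1 (e₂.sem O calls (v :: env)) := by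
  simp [Expr.sem]
@[simp] theorem sem_ite (e e₁ e₂ : Expr) : (Expr.ite e e₁ e₂).sem O calls env =
    andThen (e.sem O calls env) fun v =>
      delay 1 (select v (e₁.sem O calls env) (e₂.sem O calls env)) := by
  simp only [Expr.sem, andThen_ret]
  rfl
@[simp] theorem sem_call (f : ℕ) (e : Expr) : (Expr.call f e).sem O calls env =
    andThen (e.sem O calls env) fun v => delay 1 (calls f v) := by
  simp [Expr.sem]

end

@[simp] theorem sem_fst (a b : Val X C) : UnOp.fst.sem O (.pair a b) = ret a 1 := rfl
@[simp] theorem sem_snd (a b : Val X C) : UnOp.snd.sem O (.pair a b) = ret b 1 := rfl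
@[simp] theorem sem_isPair (a b : Val X C) : UnOp.isPair.sem O (.pair a b) = ret (.nat 1) 1 := rfl
@[simp] theorem sem_isPair_nil : UnOp.isPair.sem O .nil = ret (.nat 0) 1 := rfl
@[simp] theorem sem_fst_nil : UnOp.fst.sem O (.nil) = ret .nil 1 := rfl
@[simp] theorem sem_toReal (n : ℕ) : UnOp.toReal.sem O (.nat n) = ret (.real n) 1 := rfl
@[simp] theorem sem_cand (v : Val X C) :
    UnOp.cand.sem O v = ret (.ofList ((O.cand v.toPts).map .ctr)) O.candTime := by
  cases v <;> rfl
@[simp] theorem sem_pair (a b : Val X C) : BinOp.pair.sem O a b = ret (.pair a b) 1 := rfl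
@[simp] theorem sem_add (a b : ℕ) : BinOp.add.sem O (.nat a) (.nat b) = ret (.nat (a + b)) 1 := rfl
@[simp] theorem sem_add_real (a b : ℝ) :
    BinOp.add.sem O (.real a) (.real b) = ret (.real (a + b)) 1 := rfl
@[simp] theorem sem_sub (a b : ℕ) : BinOp.sub.sem O (.nat a) (.nat b) = ret (.nat (a - b)) 1 := rfl
open Classical in
@[simp] theorem sem_le_real (a b : ℝ) :
    BinOp.le.sem O (.real a) (.real b) = ret (.ofProp (a ≤ b)) 1 := rfl
-- An ill-typed comparison gives `nil`, and `nil` counts as true. A missing key therefore acts as an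
-- infinite distance and a missing result as an infinite cost, without any test in the code.
@[simp] theorem sem_le_nil (a : ℝ) : BinOp.le.sem O (.real a) .nil = ret .nil 1 := rfl
@[simp] theorem sem_dst (x : X) (c : C) :
    BinOp.dst.sem O (.pt x) (.ctr c) = ret (.real (O.dst x c)) O.dstTime := rfl

/-- The computation returns `y` within time `T`. -/
def Returns {α : Type*} (p : Outcome α) (y : α) (T : ℕ) : Prop := ∃ τ ≤ T, p = ret y τ

theorem returns_ret {α : Type*} {y : α} {s T : ℕ} (h : s ≤ T) : Returns (ret y s) y T :=
  ⟨s, h, rfl⟩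

/-- Function `f` maps `x` to `y` within time (and recursion depth) `T`. -/
def Computes (f : ℕ) (x y : Val X C) (T : ℕ) : Prop :=
  ∀ d, T ≤ d → Returns (Program.run O (code m w K) d f x) y T

variable {O m w K}

/-- Every call costs a unit of time, so the bound of a callee is smaller than that of its caller.
This is why one number can bound both time and recursion depth. -/
theorem computes_of_body {f : ℕ} {x y : Val X C} {T : ℕ} (e : Expr)
    (he : (code m w K).getD f .nil = e) (hT : 0 < T)
    (h : ∀ d, T ≤ d + 1 → Returns (e.sem O (Program.run O (code m w K) d) [x]) y T) :
    Computes O m w K f x y T := by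
  rintro (_ | d) hd
  · omega
  · subst he
    exact h d hd

open Val

@[simp] theorem ofList_nil : (ofList [] : Val X C) = .nil := rfl
@[simp] theorem ofList_cons (a : Val X C) (l : List (Val X C)) :
    ofList (a :: l) = .pair a (ofList l) := rfl

/-- A key that may be missing, as a machine value. -/
def encKey : Option ℝ → Val X C
  | none => .nil
  | some r => .real r

/-- A list of pairs of a point and a key that may be missing, as a machine value. -/
def encOpt (R : List (X × Option ℝ)) : Val X C :=
  ofList (R.map fun p => .pair (.pt p.1) (encKey p.2))

/-- A list of real numbers, as a machine value. -/
def encReals (a : List ℝ) : Val X C := ofList (a.map .real)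

/-- A list of lists of real numbers, as a machine value. -/
def encRuns (L : List (List ℝ)) : Val X C := ofList (L.map encReals)

/-- The key of a point at distance `r` from a new center. -/
noncomputable def newKey (r : ℝ) : Option ℝ → ℝ
  | none => r
  | some y => min r y

@[simp] theorem encKey_none : (encKey none : Val X C) = .nil := rfl
@[simp] theorem encKey_some (r : ℝ) : (encKey (some r) : Val X C) = .real r := rfl
@[simp] theorem newKey_some (r y : ℝ) : newKey r (some y) = min r y := rfl

/-- Update of the keys for a new center. -/
noncomputable def update (O : Oracles X C) (c : C) (R : List (X × Option ℝ)) : List (X × ℝ) :=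
  R.map fun p => (p.1, newKey (O.dst p.1 c) p.2)

/-- A list of pairs of a point and a key, as a machine value. -/
def enc (R : List (X × ℝ)) : Val X C := ofList (R.map fun p => .pair (.pt p.1) (.real p.2))

theorem computes_len (l : List (Val X C)) :
    Computes O m w K 1 (ofList l) (.nat l.length) (10 * l.length + 10) := by
  induction l with
  | nil =>
    refine computes_of_body Code.len rfl (by simp) fun d hd => ?_
    simp [Code.len]
    exact returns_ret (by simp)
  | cons a l ih =>
    refine computes_of_body Code.len rfl (by simp) fun d hd => ?_
    simp only [List.length_cons] at hd ⊢
    obtain ⟨τ, hτ, h⟩ := ih d (by omega)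
    simp [Code.len, h, Nat.add_comm 1]
    exact returns_ret (by omega)

theorem computes_nth (l : List (Val X C)) (i : ℕ) (hi : i < l.length) :
    Computes O m w K 2 (.pair (ofList l) (.nat i)) l[i] (20 * l.length + 10) := by
  induction l generalizing i with
  | nil => simp at hi
  | cons a l ih =>
    refine computes_of_body Code.nth rfl (by simp) fun d hd => ?_
    cases i with
    | zero =>
      simp [Code.nth]
      exact returns_ret (by simp)
    | succ i =>
      simp only [List.length_cons] at hd hi ⊢
      obtain ⟨τ, hτ, h⟩ := ih i (by omega) d (by omega)
      simp [Code.nth, h]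
      exact returns_ret (by omega)

theorem computes_app (l₁ l₂ : List (Val X C)) :
    Computes O m w K 4 (.pair (ofList l₁) (ofList l₂)) (ofList (l₁ ++ l₂))
      (30 * l₁.length + 30) := by
  induction l₁ with
  | nil =>
    refine computes_of_body Code.app rfl (by simp) fun d hd => ?_
    simp [Code.app]
    exact returns_ret (by simp)
  | cons a l ih =>
    refine computes_of_body Code.app rfl (by simp) fun d hd => ?_
    simp only [List.length_cons] at hd ⊢
    obtain ⟨τ, hτ, h⟩ := ih d (by omega)
    simp [Code.app, h]
    exact returns_ret (by omega)

theorem computes_init (l : List X) :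
    Computes O m w K 7 (ofList (l.map .pt)) (encOpt (l.map fun x => (x, none)))
      (30 * l.length + 30) := by
  induction l with
  | nil =>
    refine computes_of_body Code.init rfl (by simp) fun d hd => ?_
    simp [Code.init, encOpt]
    exact returns_ret (by simp)
  | cons a l ih =>
    refine computes_of_body Code.init rfl (by simp) fun d hd => ?_
    simp only [List.length_cons] at hd ⊢
    obtain ⟨τ, hτ, h⟩ := ih d (by omega)
    simp [encOpt] at h
    simp [Code.init, h, encOpt]
    exact returns_ret (by omega)

theorem computes_upd (c : C) (R : List (X × Option ℝ)) :
    Computes O m w K 6 (.pair (.ctr c) (encOpt R)) (enc (update O c R))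
      ((O.dstTime + 60) * R.length + 60) := by
  induction R with
  | nil =>
    refine computes_of_body Code.upd rfl (by simp) fun d hd => ?_
    simp [Code.upd, encOpt, update, enc]
    exact returns_ret (by simp)
  | cons a R ih =>
    refine computes_of_body Code.upd rfl (by simp) fun d hd => ?_
    simp only [List.length_cons, Nat.mul_succ] at hd ⊢
    obtain ⟨τ, hτ, h⟩ := ih d (by omega)
    obtain ⟨x, _ | y⟩ := a
    · simp [encOpt] at h
      simp [Code.upd, h, encOpt, update, enc]
      exact returns_ret (by omega)
    · simp [encOpt] at h
      by_cases hy : O.dst x c ≤ y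
      · simp [Code.upd, h, encOpt, update, enc, hy]
        exact returns_ret (by omega)
      · simp [Code.upd, h, encOpt, update, enc, hy, (not_le.1 hy).le]
        exact returns_ret (by omega)

theorem computes_singles (R : List (X × ℝ)) :
    Computes O m w K 8 (enc R) (encRuns (R.map fun p => [p.2])) (30 * R.length + 30) := by
  induction R with
  | nil =>
    refine computes_of_body Code.singles rfl (by simp) fun d hd => ?_
    simp [Code.singles, enc, encRuns]
    exact returns_ret (by simp)
  | cons a l ih =>
    refine computes_of_body Code.singles rfl (by simp) fun d hd => ?_
    simp only [List.length_cons] at hd ⊢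
    obtain ⟨τ, hτ, h⟩ := ih d (by omega)
    simp [encRuns, enc] at h
    simp [Code.singles, h, enc, encRuns, encReals]
    exact returns_ret (by omega)

theorem computes_mrg (a b : List ℝ) :
    Computes O m w K 9 (.pair (encReals a) (encReals b)) (encReals (a.merge b (fun x y => decide (x ≤ y))))
      (40 * (a.length + b.length) + 30) := by
  induction a generalizing b with
  | nil =>
    refine computes_of_body Code.mrg rfl (by simp) fun d hd => ?_
    simp [Code.mrg, encReals]
    exact returns_ret (by simp)
  | cons x a iha =>
    induction b with
    | nil =>
      refine computes_of_body Code.mrg rfl (by simp) fun d hd => ?_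
      simp [Code.mrg, encReals]
      exact returns_ret (by simp)
    | cons y b ihb =>
      refine computes_of_body Code.mrg rfl (by simp) fun d hd => ?_
      simp only [List.length_cons] at hd ⊢
      by_cases hxy : x ≤ y
      · obtain ⟨τ, hτ, h⟩ := iha (y :: b) d (by simp; omega)
        simp [encReals] at h hτ
        simp [Code.mrg, encReals, hxy, h]
        exact returns_ret (by omega)
      · obtain ⟨τ, hτ, h⟩ := ihb d (by simp; omega)
        simp [encReals] at h hτ
        simp [Code.mrg, encReals, hxy, h]
        exact returns_ret (by omega)

theorem computes_thin (a : List ℝ) :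
    Computes O m w K 11 (encReals a) (encReals (everySecond a)) (20 * a.length + 20) := by
  fun_induction everySecond a with
  | case1 =>
    refine computes_of_body Code.thin rfl (by simp) fun d hd => ?_
    simp [Code.thin, encReals]
    exact returns_ret (by simp)
  | case2 x =>
    refine computes_of_body Code.thin rfl (by simp) fun d hd => ?_
    simp [Code.thin, encReals]
    exact returns_ret (by simp)
  | case3 x y l ih =>
    refine computes_of_body Code.thin rfl (by simp) fun d hd => ?_
    simp only [List.length_cons] at hd ⊢
    obtain ⟨τ, hτ, h⟩ := ih d (by omega)
    simp [encReals] at h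
    simp [Code.thin, encReals, h]
    exact returns_ret (by omega)

theorem computes_thins (L : List (List ℝ)) :
    Computes O m w K 12 (encRuns L) (encRuns (L.map everySecond))
      (50 * ((L.map List.length).sum + L.length) + 20) := by
  induction L with
  | nil =>
    refine computes_of_body Code.thins rfl (by simp) fun d hd => ?_
    simp [Code.thins, encRuns]
    exact returns_ret (by simp)
  | cons a L ih =>
    refine computes_of_body Code.thins rfl (by simp) fun d hd => ?_
    simp only [List.length_cons, List.map_cons, List.sum_cons] at hd ⊢
    obtain ⟨τ, hτ, h⟩ := ih d (by omega)
    obtain ⟨τ', hτ', h'⟩ := computes_thin (O := O) (m := m) (w := w) (K := K) a d (by omega)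
    simp [encRuns] at h
    simp [Code.thins, encRuns, h, h']
    exact returns_ret (by omega)

theorem computes_pairs (L : List (List ℝ)) :
    Computes O m w K 10 (encRuns L) (encRuns (mergePairs L))
      (60 * ((L.map List.length).sum + L.length) + 20) := by
  fun_induction mergePairs L with
  | case1 =>
    refine computes_of_body Code.pairs rfl (by simp) fun d hd => ?_
    simp [Code.pairs, encRuns]
    exact returns_ret (by simp)
  | case2 x =>
    refine computes_of_body Code.pairs rfl (by simp) fun d hd => ?_
    simp [Code.pairs, encRuns]
    exact returns_ret (by simp)
  | case3 x y l ih =>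
    refine computes_of_body Code.pairs rfl (by simp) fun d hd => ?_
    simp only [List.length_cons, List.map_cons, List.sum_cons] at hd ⊢
    obtain ⟨τ, hτ, h⟩ := ih d (by omega)
    obtain ⟨τ', hτ', h'⟩ := computes_mrg (O := O) (m := m) (w := w) (K := K) x y d (by omega)
    simp [encRuns] at h
    simp [Code.pairs, encRuns, h, h']
    exact returns_ret (by omega)

/-- The second list loses two entries whenever the first loses one, so the middle is reached without
a division. -/
theorem computes_mid (a b : List ℝ) (ha : b.length / 2 < a.length) :
    Computes O m w K 14 (.pair (encReals a) (encReals b)) (.real (a.getD (b.length / 2) 0))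
      (30 * b.length + 30) := by
  induction a generalizing b with
  | nil => simp at ha
  | cons x a ih =>
    refine computes_of_body Code.mid rfl (by simp) fun d hd => ?_
    match b with
    | [] =>
      simp [Code.mid, encReals]
      exact returns_ret (by simp)
    | [y] =>
      simp [Code.mid, encReals]
      exact returns_ret (by simp)
    | y :: z :: b =>
      have e : (y :: z :: b).length / 2 = b.length / 2 + 1 := by simp; omega
      rw [e] at ha ⊢
      simp only [List.length_cons, List.getD_cons_succ] at hd ha ⊢
      obtain ⟨τ, hτ, h⟩ := ih b (by omega) d (by omega)
      simp [encReals] at h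
      simp [Code.mid, encReals, h]
      exact returns_ret (by omega)

/-- Two merges and one thinning cost about `60 + 60 + 50 = 170` per entry. The total length then
halves, hence `340`. The number of lists falls to about a quarter. -/
theorem computes_red (L : List (List ℝ)) (hL : L ≠ []) :
    Computes O m w K 13 (encRuns L) (encReals (reduce L))
      (340 * (L.map List.length).sum + 400 * L.length + 20) := by
  fun_induction reduce L with
  | case1 L h ih =>
    refine computes_of_body Code.red rfl (by simp) fun d hd => ?_
    have hs := sum_length_map_everySecond (mergePairs (mergePairs L))
    have hs₁ := sum_length_mergePairs L
    have hs₂ := sum_length_mergePairs (mergePairs L)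
    have hl₁ := length_mergePairs L
    have hl₂ := length_mergePairs (mergePairs L)
    simp only [List.length_map] at ih
    obtain ⟨τ₁, hτ₁, h₁⟩ := computes_pairs (O := O) (m := m) (w := w) (K := K) L d (by omega)
    obtain ⟨τ₂, hτ₂, h₂⟩ := computes_pairs (O := O) (m := m) (w := w) (K := K) (mergePairs L) d
      (by omega)
    obtain ⟨τ₃, hτ₃, h₃⟩ := computes_thins (O := O) (m := m) (w := w) (K := K)
      (mergePairs (mergePairs L)) d (by omega)
    obtain ⟨τ₄, hτ₄, h₄⟩ := ih (by
      intro h0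
      have := congrArg List.length h0
      simp at this
      simp [this] at hl₂
      omega) d (by omega)
    match L, h with
    | a :: b :: L, h =>
      have e : (encRuns (a :: b :: L) : Val X C) =
        .pair (encReals a) (.pair (encReals b) (encRuns L)) := rfl
      rw [e] at h₁ ⊢
      have hs₀ : ((a :: b :: L).map List.length).sum =
        a.length + (b.length + (L.map List.length).sum) := by simp
      have hl₀ : (a :: b :: L).length = L.length + 2 := rfl
      simp [Code.red, h₁, h₂, h₃, h₄]
      exact returns_ret (by omega)
  | case2 L h =>
    refine computes_of_body Code.red rfl (by simp) fun d hd => ?_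
    match L, h with
    | [a], h =>
      simp [Code.red, encRuns]
      exact returns_ret (by simp)
    | a :: b :: L, h => simp at h

theorem computes_pivot (R : List (X × ℝ)) (hR : R ≠ []) (hF : summary (R.map Prod.snd) ≠ [])  :
    Computes O m w K 19 (enc R) (.real (approxMedian (R.map Prod.snd)))
      (2000 * R.length + 2000) := by
  refine computes_of_body Code.pivot rfl (by simp) fun d hd => ?_
  set L₀ := R.map fun p => [p.2] with hL₀
  have hl₀ : L₀.length = R.length := by simp [hL₀]
  have hs₀ : (L₀.map List.length).sum = R.length := by simp [hL₀, Function.comp_def]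
  have hl₁ := length_mergePairs L₀
  have hl₂ := length_mergePairs (mergePairs L₀)
  have hl₃ := length_mergePairs (mergePairs (mergePairs L₀))
  have hs₁ := sum_length_mergePairs L₀
  have hs₂ := sum_length_mergePairs (mergePairs L₀)
  have hs₃ := sum_length_mergePairs (mergePairs (mergePairs L₀))
  have hpos := List.length_pos_of_ne_nil hR
  have e : mergePairs (mergePairs (mergePairs L₀)) ≠ [] := by
    intro h0
    rw [h0] at hl₃
    simp at hl₃
    omega
  have hF' : reduce (mergePairs (mergePairs (mergePairs L₀))) = summary (R.map Prod.snd) := by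
    simp [summary, hL₀, Function.comp_def]
  have hFl := length_reduce_le (mergePairs (mergePairs (mergePairs L₀)))
  obtain ⟨τ₀, hτ₀, h₀⟩ := computes_singles (O := O) (m := m) (w := w) (K := K) R d (by omega)
  rw [← hL₀] at h₀
  obtain ⟨τ₁, hτ₁, h₁⟩ := computes_pairs (O := O) (m := m) (w := w) (K := K) L₀ d (by omega)
  obtain ⟨τ₂, hτ₂, h₂⟩ := computes_pairs (O := O) (m := m) (w := w) (K := K) (mergePairs L₀) d
    (by omega)
  obtain ⟨τ₃, hτ₃, h₃⟩ := computes_pairs (O := O) (m := m) (w := w) (K := K)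
    (mergePairs (mergePairs L₀)) d (by omega)
  obtain ⟨τ₄, hτ₄, h₄⟩ := computes_red (O := O) (m := m) (w := w) (K := K) _ e d (by omega)
  rw [hF'] at h₄ hFl
  have hFpos := List.length_pos_of_ne_nil hF
  obtain ⟨τ₅, hτ₅, h₅⟩ := computes_mid (O := O) (m := m) (w := w) (K := K)
    (summary (R.map Prod.snd)) (summary (R.map Prod.snd)) (by omega) d (by omega)
  simp [Code.pivot, h₀, h₁, h₂, h₃, h₄, h₅]
  exact returns_ret (by omega)

theorem computes_part (θ : ℝ) (R : List (X × ℝ)) :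
    Computes O m w K 15 (.pair (.real θ) (enc R))
      (.pair (.real ((R.filter fun p => p.2 ≤ θ).map Prod.snd).sum) (enc (R.filter fun p => ¬ p.2 ≤ θ)))
      (60 * R.length + 60) := by
  induction R with
  | nil =>
    refine computes_of_body Code.part rfl (by simp) fun d hd => ?_
    simp [Code.part, enc]
    exact returns_ret (by simp)
  | cons a R ih =>
    refine computes_of_body Code.part rfl (by simp) fun d hd => ?_
    simp only [List.length_cons] at hd ⊢
    obtain ⟨τ, hτ, h⟩ := ih d (by omega)
    simp [enc] at h
    by_cases ha : a.2 ≤ θ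
    · simp [Code.part, h, enc, ha, not_lt.2 ha]
      exact returns_ret (by omega)
    · simp [Code.part, h, enc, ha, not_le.1 ha]
      exact returns_ret (by omega)

/-- Multiplication is repeated addition, so the time depends on the first factor only. The callers
put the small factor first. -/
theorem computes_mul (a b : ℕ) :
    Computes O m w K 18 (.pair (.nat a) (.nat b)) (.nat (a * b)) (20 * a + 20) := by
  induction a with
  | zero =>
    refine computes_of_body Code.mul rfl (by simp) fun d hd => ?_
    simp [Code.mul]
    exact returns_ret (by simp)
  | succ a ih =>
    refine computes_of_body Code.mul rfl (by simp) fun d hd => ?_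
    obtain ⟨τ, hτ, h⟩ := ih d (by omega)
    simp [Code.mul, h]
    rw [show b + a * b = (a + 1) * b by ring]
    exact returns_ret (by omega)

theorem computes_pow (j a b : ℕ) :
    Computes O m w K 20 (.pair (.nat j) (.pair (.nat a) (.nat b))) (.nat (a ^ j * b))
      ((20 * a + 60) * j + 20) := by
  induction j with
  | zero =>
    refine computes_of_body Code.pow rfl (by simp) fun d hd => ?_
    simp [Code.pow]
    exact returns_ret (by simp)
  | succ j ih =>
    refine computes_of_body Code.pow rfl (by simp) fun d hd => ?_
    rw [Nat.mul_succ] at hd ⊢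
    obtain ⟨τ, hτ, h⟩ := ih d (by omega)
    obtain ⟨τ', hτ', h'⟩ := computes_mul (O := O) (m := m) (w := w) (K := K) a (a ^ j * b) d
      (by omega)
    simp [Code.pow, h, h']
    rw [show a * (a ^ j * b) = a ^ (j + 1) * b by ring]
    exact returns_ret (by omega)

end Semantics

/-! ## The randomized functions of the program -/

section Randomized

variable {X C : Type*} (O : Oracles X C) (m w K : ℕ)

/-- On the argument `x`, except with probability `η`, function `f` halts within time (and recursion
depth) `T` with a result in `G`. -/
def Guarantees (f : ℕ) (x : Val X C) (T : ℕ) (η : ℝ≥0∞) (G : Val X C → Prop) : Prop :=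
  ∀ d, T ≤ d → Ensures (Program.run O (code m w K) d f x) T η G

variable {O m w K}

open Val

theorem Guarantees.mono {f : ℕ} {x : Val X C} {T T' : ℕ} {η η' : ℝ≥0∞} {G G' : Val X C → Prop}
    (h : Guarantees O m w K f x T η G) (hT : T ≤ T') (hη : η ≤ η') (hG : ∀ a, G a → G' a) :
    Guarantees O m w K f x T' η' G' :=
  fun d hd => (h d (hT.trans hd)).mono hT hη hG

theorem guarantees_of_body {f : ℕ} {x : Val X C} {T : ℕ} {η : ℝ≥0∞} {G : Val X C → Prop} (e : Expr)
    (he : (code m w K).getD f .nil = e) (hT : 0 < T)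
    (h : ∀ d, T ≤ d + 1 → Ensures (e.sem O (Program.run O (code m w K) d) [x]) T η G) :
    Guarantees O m w K f x T η G := by
  rintro (_ | d) hd
  · omega
  · subst he
    exact h d hd

theorem Outcome.Ensures.delay' {α : Type*} {p : Outcome α} {T s T' : ℕ} {η η' : ℝ≥0∞}
    {G G' : α → Prop} (h : Ensures p T η G) (hT : s + T ≤ T') (hη : η ≤ η')
    (hG : ∀ a, G a → G' a) : Ensures (Outcome.delay s p) T' η' G' :=
  (h.delay s).mono hT hη hG

theorem Outcome.Ensures.andThen' {α β : Type*} {p : Outcome α} {f : α → Outcome β} {T₁ T₂ T : ℕ}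
    {η₁ η₂ η : ℝ≥0∞} {G₁ : α → Prop} {G₂ : β → Prop} (h₁ : Ensures p T₁ η₁ G₁)
    (h₂ : ∀ a, G₁ a → Ensures (f a) T₂ η₂ G₂) (hT : T₁ + T₂ ≤ T) (hη : η₁ + η₂ ≤ η) :
    Ensures (Outcome.andThen p f) T η G₂ :=
  (h₁.andThen h₂).mono hT hη fun _ h => h

@[simp] theorem toPts_ofList (l : List X) : (ofList (l.map .pt) : Val X C).toPts = l := by
  induction l with
  | nil => rfl
  | cons a l ih => simp [toPts, ih]

@[simp] theorem toCtrs_ofList (l : List C) : (ofList (l.map .ctr) : Val X C).toCtrs = l := by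
  induction l with
  | nil => rfl
  | cons a l ih => simp [toCtrs, ih]

open Classical in
/-- The number of sequences of `j` positions in `xs` whose entries violate `G`. -/
noncomputable def badCount (xs : List X) : ℕ → (List X → Prop) → ℕ
  | 0, G => if G [] then 0 else 1
  | j + 1, G => ∑ i : Fin xs.length, badCount xs j fun S => G (xs[i] :: S)

/-- The recursion of `badCount` mirrors the draws: the first index is averaged by `ensures_uniform`,
and what is asked of the later ones depends on it. -/
theorem draw_guarantees (R : List (X × Option ℝ)) (hR : R ≠ []) (j : ℕ) (G : List X → Prop) :
    Guarantees O m w K 3 (.pair (.nat j) (.pair (.nat (R.length - 1)) (encOpt R)))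
      ((20 * R.length + 60) * j + 30)
      (badCount (R.map Prod.fst) j G / (R.length ^ j : ℕ))
      (fun v => ∃ S : List X, v = ofList (S.map .pt) ∧ S.length = j ∧ G S) := by
  classical
  induction j generalizing G with
  | zero =>
    refine guarantees_of_body Code.draw rfl (by simp) fun d hd => ?_
    by_cases hG : G []
    · simp [Code.draw]
      exact ensures_ret (by simp) ⟨rfl, hG⟩ _
    · refine (ensures_one _ _ _).mono le_rfl ?_ fun _ h => h
      simp [badCount, hG]
  | succ j ih =>
    refine guarantees_of_body Code.draw rfl (by simp) fun d hd => ?_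
    -- `rand` draws from `{0, …, b}`, so the code carries the length minus one.
    obtain ⟨b, hb⟩ : ∃ b, R.length = b + 1 := ⟨R.length - 1, by
      have := List.length_pos_of_ne_nil hR
      omega⟩
    simp only [Nat.mul_succ] at hd ⊢
    simp [Code.draw]
    have e : UnOp.rand.sem O (.nat (R.length - 1)) =
        PMF.map (fun i : Fin (b + 1) => some ((Val.nat i : Val X C), 1))
          (PMF.uniformOfFintype (Fin (b + 1))) := by
      rw [hb]; rfl
    rw [e]
    set T := (20 * R.length + 60) * j + (20 * R.length + 60) with hT
    refine (Ensures.delay' (T := 1 + (T + 10)) (ensures_uniform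
      (η := fun i : Fin (b + 1) =>
        (badCount (R.map Prod.fst) j (fun S => G ((R[i]'(by omega)).1 :: S)) /
          (R.length ^ j : ℕ) : ℝ≥0∞)) (G := fun v => ∃ S : List X, v = ofList (S.map .pt) ∧
            S.length = j + 1 ∧ G S) (T := T + 10) fun i => ?_) (by omega) ?_ fun _ h => h)
    · obtain ⟨τ, hτ, h⟩ := computes_nth (O := O) (m := m) (w := w) (K := K)
        (R.map fun p => .pair (.pt p.1) (encKey p.2)) i (by simp; omega) d (by simp; nlinarith)
      simp only [List.getElem_map, List.length_map] at h hτ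
      rw [encOpt, h]
      simp
      refine Ensures.delay' (T := (20 * R.length + 60) * j + 30 + 1) (Ensures.andThen'
        (ih (fun S => G ((R[i]'(by omega)).1 :: S)) d (by omega)) (T₂ := 1) (η₂ := 0) ?_ le_rfl
        le_rfl) (by omega) (by simp) fun _ h => h
      rintro _ ⟨S, rfl, hS, hG⟩
      exact ensures_ret le_rfl ⟨_ :: S, by simp, by simp [hS], hG⟩ _
    · simp only [badCount, div_eq_mul_inv]
      have hp : R.length ^ (j + 1) = R.length ^ j * (b + 1) := by rw [pow_succ, hb]
      rw [← Finset.sum_mul, mul_assoc, ← Nat.cast_pow, hp, Nat.cast_mul,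
        ENNReal.mul_inv (Or.inr (by simp)) (Or.inr (by simp))]
      gcongr
      push_cast
      apply le_of_eq
      refine Fintype.sum_equiv (finCongr (by simp [hb])) _ _ fun i => ?_
      simp

/-- The arguments of `draw` and `coll`. -/
noncomputable def sampleInput (j : ℕ) (R : List (X × Option ℝ)) : Val X C :=
  .pair (.nat j) (.pair (.nat (R.length - 1)) (encOpt R))

/-- A list of centers, as a machine value. -/
def encCtrs (T : List C) : Val X C := ofList (T.map .ctr)

/-- If the first sample is good, the others may give anything; only after its failure do they have
to succeed. With `η₂ = 0` the failure probabilities multiply, which is the independence of the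
samples. -/
theorem coll_step {R : List (X × Option ℝ)} {j T T₁ t : ℕ} {η₁ η₂ η₃ : ℝ≥0∞}
    {G₁ : List X → Prop} {G₂ : List C → Prop} 
    (ht : ∀ S, (O.cand S).length ≤ t)
    (hS : Guarantees O m w K 3 (sampleInput m R) T₁ 0 fun v => ∃ S : List X, v = ofList (S.map .pt))
    (h₁ : Guarantees O m w K 3 (sampleInput m R) T₁ η₁
      fun v => ∃ S : List X, v = ofList (S.map .pt) ∧ G₁ S)
    (h₂ : ∀ S, G₁ S → Guarantees O m w K 5 (sampleInput j R) T η₂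
      fun v => ∃ L : List C, v = encCtrs L ∧ G₂ (O.cand S ++ L))
    (h₃ : ∀ S, Guarantees O m w K 5 (sampleInput j R) T η₃
      fun v => ∃ L : List C, v = encCtrs L ∧ G₂ (O.cand S ++ L)) :
    Guarantees O m w K 5 (sampleInput (j + 1) R) (T₁ + T + O.candTime + 30 * t + 100)
      (η₁ * η₃ + η₂) fun v => ∃ L : List C, v = encCtrs L ∧ G₂ L := by
  refine guarantees_of_body (Code.coll m) rfl (by simp) fun d hd => ?_
  simp only [sampleInput] at *
  simp [Code.coll]
  refine Ensures.delay' (T := T₁ + (T + O.candTime + 30 * t + 70)) (Ensures.andThen_retry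
    (hS d (by omega)) (h₁ d (by omega)) ?_ ?_) (by omega) le_rfl fun _ h => h
  · rintro _ - ⟨S, rfl, hG⟩
    have := ht S
    simp
    refine Ensures.delay' (T := T + (30 * t + 40)) (Ensures.andThen' (h₂ S hG d (by omega))
      (T₂ := 30 * t + 40) (η₂ := 0) ?_ le_rfl le_rfl) (by omega) (by simp) fun _ h => h
    rintro _ ⟨L, rfl, hL⟩
    simp [encCtrs]
    obtain ⟨τ, hτ, h⟩ := computes_app (O := O) (m := m) (w := w) (K := K)
      ((O.cand S).map .ctr) (L.map .ctr) d (by simp; omega)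
    simp at hτ
    rw [h, delay_ret]
    exact ensures_ret (by omega) ⟨_, by rw [List.map_append], hL⟩ _
  · rintro _ ⟨S, rfl⟩
    have := ht S
    simp
    refine Ensures.delay' (T := T + (30 * t + 40)) (Ensures.andThen' (h₃ S d (by omega))
      (T₂ := 30 * t + 40) (η₂ := 0) ?_ le_rfl le_rfl) (by omega) (by simp) fun _ h => h
    rintro _ ⟨L, rfl, hL⟩
    simp [encCtrs]
    obtain ⟨τ, hτ, h⟩ := computes_app (O := O) (m := m) (w := w) (K := K)
      ((O.cand S).map .ctr) (L.map .ctr) d (by simp; omega)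
    simp at hτ
    rw [h, delay_ret]
    exact ensures_ret (by omega) ⟨_, by rw [List.map_append], hL⟩ _

/-- Time for `j` samples of a list of length `n`. -/
def collTime (O : Oracles X C) (m t n j : ℕ) : ℕ :=
  ((20 * n + 60) * m + O.candTime + 30 * t + 130) * j + 30

theorem badCount_true (xs : List X) (j : ℕ) : badCount xs j (fun _ => True) = 0 := by
  induction j <;> simp [badCount, *]

theorem coll_safe {R : List (X × Option ℝ)} (hR : R ≠ []) {t : ℕ}
    (ht : ∀ S, (O.cand S).length ≤ t) (j : ℕ) :
    Guarantees O m w K 5 (sampleInput j R) (collTime O m t R.length j) 0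
      fun v => ∃ L : List C, v = encCtrs L ∧ L.length ≤ j * t := by
  induction j with
  | zero =>
    refine guarantees_of_body (Code.coll m) rfl (by simp [collTime]) fun d hd => ?_
    simp [Code.coll, sampleInput, collTime]
    exact ensures_ret (by simp) (by simp [encCtrs]) _
  | succ j ih =>
    have hd := draw_guarantees (O := O) (m := m) (w := w) (K := K) R hR m (fun _ => True)
    rw [badCount_true, Nat.cast_zero, ENNReal.zero_div] at hd
    refine (coll_step (G₁ := fun _ => True) (G₂ := fun L => L.length ≤ (j + 1) * t) ht
      (hd.mono le_rfl le_rfl ?_) (hd.mono le_rfl le_rfl ?_)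
      (fun S _ => ih.mono le_rfl le_rfl ?_) (fun S => ih.mono le_rfl le_rfl ?_)).mono
      ?_ (by simp) fun _ h => h
    · rintro _ ⟨S, h, -⟩
      exact ⟨S, h⟩
    · rintro _ ⟨S, h, -⟩
      exact ⟨S, h, trivial⟩
    · rintro _ ⟨L, h, h'⟩
      have := ht S
      exact ⟨L, h, by rw [List.length_append, Nat.succ_mul]; omega⟩
    · rintro _ ⟨L, h, h'⟩
      have := ht S
      exact ⟨L, h, by rw [List.length_append, Nat.succ_mul]; omega⟩
    · simp only [collTime, Nat.mul_succ]
      omega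

/-- All `j` samples have to fail. The premise `S.length = m` inside `badCount` costs nothing, since
`draw` delivers exactly `m` points, and it is what the candidate oracle needs. -/
theorem coll_good {R : List (X × Option ℝ)} (hR : R ≠ []) {t : ℕ}
    (ht : ∀ S, (O.cand S).length ≤ t) {q : ℝ≥0∞} {g : C → Prop}
    (hq : (badCount (R.map Prod.fst) m (fun S => S.length = m → ∃ c ∈ O.cand S, g c) : ℝ≥0∞) /
      (R.length ^ m : ℕ) ≤ q) (j : ℕ) :
    Guarantees O m w K 5 (sampleInput j R) (collTime O m t R.length j) (q ^ j)
      fun v => ∃ L : List C, v = encCtrs L ∧ L.length ≤ j * t ∧ ∃ c ∈ L, g c := by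
  induction j with
  | zero => exact fun d hd => by simpa using ensures_one _ _ _
  | succ j ih =>
    have hd := draw_guarantees (O := O) (m := m) (w := w) (K := K) R hR m (fun _ => True)
    rw [badCount_true, Nat.cast_zero, ENNReal.zero_div] at hd
    refine (coll_step (G₁ := fun S => ∃ c ∈ O.cand S, g c)
      (G₂ := fun L => L.length ≤ (j + 1) * t ∧ ∃ c ∈ L, g c) ht
      (hd.mono le_rfl le_rfl ?_)
      ((draw_guarantees R hR m (fun S => S.length = m → ∃ c ∈ O.cand S, g c)).mono le_rfl hq ?_)
      (fun S hS => (coll_safe hR ht j).mono le_rfl le_rfl ?_)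
      (fun S => ih.mono le_rfl le_rfl ?_)).mono ?_ (by rw [pow_succ', add_zero]) fun _ h => h
    · rintro _ ⟨S, h, -⟩
      exact ⟨S, h⟩
    · rintro _ ⟨S, h, h', h''⟩
      exact ⟨S, h, h'' h'⟩
    · rintro _ ⟨L, h, h'⟩
      have := ht S
      obtain ⟨c, hc, hg⟩ := hS
      exact ⟨L, h, by rw [List.length_append, Nat.succ_mul]; omega, c, by simp [hc], hg⟩
    · rintro _ ⟨L, h, h', c, hc, hg⟩
      have := ht S
      exact ⟨L, h, by rw [List.length_append, Nat.succ_mul]; omega, c, by simp [hc], hg⟩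
    · simp only [collTime, Nat.mul_succ]
      omega

/-- The arguments of `search`. -/
def searchInput (M l : ℕ) (R : List (X × ℝ)) (Cl : List C) : Val X C :=
  .pair (.nat M) (.pair (.nat l) (.pair (enc R) (encCtrs Cl)))

/-- The arguments of `branch`. -/
def branchInput (T : List C) (M l : ℕ) (R : List (X × Option ℝ)) (Cl : List C) : Val X C :=
  .pair (encCtrs T) (.pair (.nat M) (.pair (.nat l) (.pair (encOpt R) (encCtrs Cl))))

/-- A result of `search`. -/
def encRes (r : ℝ × List C) : Val X C := .pair (.real r.1) (encCtrs r.2)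

/-- A result of `branch`. -/
def encOptRes : Option (ℝ × List C) → Val X C
  | none => .nil
  | some r => encRes r

/-- The better one of two results, the first of which exists. -/
noncomputable def pick (r : ℝ × List C) : Option (ℝ × List C) → ℝ × List C
  | none => r
  | some r' => if r.1 ≤ r'.1 then r else r'

theorem enc_eq_encOpt (R : List (X × ℝ)) :
    (enc R : Val X C) = encOpt (R.map fun p => (p.1, some p.2)) := by
  simp [enc, encOpt, Function.comp_def]

/-- A branch on the comparison of two results returns the better one. -/
theorem select_pick (r : ℝ × List C) (o : Option (ℝ × List C)) {T : ℕ} {η : ℝ≥0∞}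
    {p : Val X C → Outcome (Val X C)} {G : Val X C → Prop}
    (h : Ensures (p (encRes (pick r o))) T η G) :
    Ensures (Outcome.andThen (UnOp.fst.sem O (encOptRes o)) fun x =>
      Outcome.andThen (BinOp.le.sem O (.real r.1) x) fun y =>
        Outcome.delay 1 (select y (p (encRes r)) (p (encOptRes o)))) (3 + T) η G := by
  classical
  cases o with
  | none =>
    simp [encOptRes]
    exact h.delay' (by omega) le_rfl fun _ h => h
  | some r' =>
    simp [encOptRes, encRes]
    refine Ensures.delay' (T := T) ?_ (by omega) le_rfl fun _ h => h
    by_cases hr : r.1 ≤ r'.1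
    · simpa [hr, pick, encRes] using h
    · simpa [hr, pick, encRes] using h

theorem search_nil (M l : ℕ) (Cl : List C) :
    Guarantees O m w K 16 (searchInput M l [] Cl) 30 0
      (fun v => v = encRes (0, Cl)) := by
  refine guarantees_of_body Code.search rfl (by simp) fun d hd => ?_
  simp [Code.search, searchInput, enc]
  exact ensures_ret (by simp) (by simp [encRes]) _

/-- The guarantees for pruning, sampling and branching are parameters, so that the worst case bound
and both cases of the probabilistic analysis are instances. For `l = 0` there is no branching, and
`Tc`, `Tb` are merely slack. -/
theorem search_step {R : List (X × ℝ)} (hR : R ≠ []) (hF : summary (R.map Prod.snd) ≠ [])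
    {M l T₁ Tc Tb : ℕ} {η₁ ηc ηb : ℝ≥0∞} {Cl : List C} {θ : ℝ}
    (hθ : θ = approxMedian (R.map Prod.snd)) {G₁ G : ℝ × List C → Prop} {Gc : List C → Prop}
    {Gb : Option (ℝ × List C) → Prop}
    (h₁ : Guarantees O m w K 16 (searchInput M l (R.filter fun p => ¬ p.2 ≤ θ) Cl) T₁ η₁
      fun v => ∃ r, v = encRes r ∧ G₁ r)
    (hc : Guarantees O m w K 5 (sampleInput M (R.map fun p => (p.1, some p.2))) Tc ηc
      fun v => ∃ L, v = encCtrs L ∧ Gc L)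
    (hb : ∀ l', l = l' + 1 → ∀ L, Gc L →
      Guarantees O m w K 17 (branchInput L M l' (R.map fun p => (p.1, some p.2)) Cl) Tb ηb
        fun v => ∃ o, v = encOptRes o ∧ Gb o)
    (hG₀ : l = 0 → ∀ r, G₁ r → G (((R.filter fun p => p.2 ≤ θ).map Prod.snd).sum + r.1, r.2))
    (hG : l ≠ 0 → ∀ r o, G₁ r → Gb o →
      G (pick (((R.filter fun p => p.2 ≤ θ).map Prod.snd).sum + r.1, r.2) o)) :
    Guarantees O m w K 16 (searchInput M l R Cl) (T₁ + Tc + Tb + 2100 * R.length + 2200)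
      (η₁ + ηc + ηb) fun v => ∃ r, v = encRes r ∧ G r := by
  refine guarantees_of_body Code.search rfl (by simp) fun d hd => ?_
  obtain ⟨τ₁, hτ₁, h₁'⟩ := computes_pivot (O := O) (m := m) (w := w) (K := K) R hR hF d (by omega)
  obtain ⟨τ₂, hτ₂, h₂'⟩ := computes_part (O := O) (m := m) (w := w) (K := K) θ R d (by omega)
  obtain ⟨τ₃, hτ₃, h₃'⟩ := computes_len (O := O) (m := m) (w := w) (K := K)
    (R.map fun p => .pair (.pt p.1) (.real p.2)) d (by simp; omega)
  have h₁'' := h₁ d (by omega)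
  simp only [List.length_map] at h₃' hτ₃
  rw [← hθ] at h₁'
  rw [show ofList (R.map fun p => .pair (.pt p.1) (.real p.2)) = (enc R : Val X C) from rfl] at h₃'
  set S := ((R.filter fun p => p.2 ≤ θ).map Prod.snd).sum with hS
  set H : List (X × ℝ) := R.filter fun p => ¬ p.2 ≤ θ with hH
  obtain ⟨a, b, e⟩ : ∃ a b, (enc R : Val X C) = .pair a b := by
    obtain ⟨p, R', rfl⟩ := List.exists_cons_of_ne_nil hR
    exact ⟨_, _, rfl⟩
  have e' : UnOp.isPair.sem O (enc R : Val X C) = ret (.nat 1) 1 := by rw [e]; rfl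
  simp only [searchInput] at *
  simp [Code.search, h₁', h₂', h₃', e']
  refine Ensures.delay' (T := T₁ + (Tc + Tb + 10 * R.length + 70)) (Ensures.andThen' h₁''
    (T₂ := Tc + Tb + 10 * R.length + 70) (η₂ := ηc + ηb) ?_ le_rfl le_rfl)
    (by omega) (by rw [add_assoc]) fun _ h => h
  rintro _ ⟨r, rfl, hr⟩
  simp [encRes]
  cases l with
  | zero =>
    simp
    exact ensures_ret (by omega) ⟨_, _, rfl, hG₀ rfl r hr⟩ _
  | succ l =>
    simp
    have hc' := hc d (by omega)
    simp only [sampleInput, List.length_map, ← enc_eq_encOpt] at hc'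
    refine Ensures.delay' (T := Tc + (Tb + 30)) (Ensures.andThen' hc' (T₂ := Tb + 30) (η₂ := ηb) ?_
      le_rfl le_rfl) (by omega) le_rfl fun _ h => h
    rintro _ ⟨L, rfl, hL⟩
    have hb' := hb l rfl L hL d (by omega)
    simp only [branchInput, ← enc_eq_encOpt] at hb'
    refine Ensures.delay' (T := Tb + 10) (Ensures.andThen' hb' (T₂ := 10) (η₂ := 0) ?_
      le_rfl le_rfl) (by omega) (by simp) fun _ h => h
    rintro _ ⟨o, rfl, ho⟩
    refine Ensures.delay' (T := 3 + 1) (select_pick (p := fun v => ret v 1) (S + r.1, r.2) o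
      (ensures_ret le_rfl ?_ 0)) (by omega) le_rfl fun _ h => h
    exact ⟨_, _, rfl, hG (by simp) r o hr ho⟩

theorem branch_nil (M l : ℕ) (R : List (X × Option ℝ)) (Cl : List C) :
    Guarantees O m w K 17 (branchInput [] M l R Cl) 30 0 fun v => v = encOptRes none := by
  refine guarantees_of_body Code.branch rfl (by simp) fun d hd => ?_
  simp [Code.branch, branchInput, encCtrs]
  exact ensures_ret (by simp) (by simp [encOptRes]) _

theorem branch_step {c : C} {L : List C} {M l T₁ T₂ : ℕ} {R : List (X × Option ℝ)} {Cl : List C}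
    {η₁ η₂ : ℝ≥0∞} {G₁ : ℝ × List C → Prop} {G₂ G : Option (ℝ × List C) → Prop}
    (h₁ : Guarantees O m w K 16 (searchInput M l (update O c R) (c :: Cl)) T₁ η₁
      fun v => ∃ r, v = encRes r ∧ G₁ r)
    (h₂ : Guarantees O m w K 17 (branchInput L M l R Cl) T₂ η₂ fun v => ∃ o, v = encOptRes o ∧ G₂ o)
    (hG : ∀ r o, G₁ r → G₂ o → G (some (pick r o))) :
    Guarantees O m w K 17 (branchInput (c :: L) M l R Cl)
      (T₁ + T₂ + (O.dstTime + 60) * R.length + 200) (η₁ + η₂)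
      fun v => ∃ o, v = encOptRes o ∧ G o := by
  refine guarantees_of_body Code.branch rfl (by simp) fun d hd => ?_
  obtain ⟨τ₁, hτ₁, h₁'⟩ := computes_upd (O := O) (m := m) (w := w) (K := K) c R d (by omega)
  have h₁'' := h₁ d (by omega)
  have h₂'' := h₂ d (by omega)
  simp only [searchInput, branchInput, encCtrs, List.map_cons, ofList_cons] at *
  simp [Code.branch, h₁']
  refine Ensures.delay' (T := T₁ + (T₂ + 50)) (Ensures.andThen' h₁''
    (T₂ := T₂ + 50) (η₂ := η₂) ?_ le_rfl le_rfl) (by omega) le_rfl fun _ h => h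
  rintro _ ⟨r, rfl, hr⟩
  simp [encRes]
  refine Ensures.delay' (T := T₂ + 20) (Ensures.andThen' h₂''
    (T₂ := 20) (η₂ := 0) ?_ le_rfl le_rfl) (by omega) (by simp) fun _ h => h
  rintro _ ⟨o, rfl, ho⟩
  refine Ensures.delay' (T := 3 + 1) (select_pick (p := fun v => ret v 1) r o
    (ensures_ret le_rfl ?_ 0)) (by omega) le_rfl fun _ h => h
  exact ⟨some (pick r o), rfl, hG r o hr ho⟩

/-- Without any center there are no keys to prune by, so the computation starts with `branch` rather
than `search`. -/
theorem main_step {k : ℕ} {l : List X} {Tc Tb : ℕ} {ηc ηb : ℝ≥0∞} {M : ℕ}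
    (hM : M = (k * (k * w)) ^ m * (k * K))
    {Gc : List C → Prop} {Gb : Option (ℝ × List C) → Prop} {G : Val X C → Prop}
    (hc : Guarantees O m w K 5 (sampleInput M (l.map fun x => (x, none))) Tc ηc
      fun v => ∃ L, v = encCtrs L ∧ Gc L)
    (hb : ∀ L, Gc L →
      Guarantees O m w K 17 (branchInput L M (k - 1) (l.map fun x => (x, none)) []) Tb ηb
        fun v => ∃ o, v = encOptRes o ∧ Gb o)
    (hG₀ : Gb none → G .nil) (hG : ∀ r, Gb (some r) → G (encCtrs r.2)) :
    Guarantees O m w K 0 (.pair (.nat k) (ofList (l.map .pt)))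
      (Tc + Tb + 40 * l.length + ((20 * (k * (k * w)) + 60) * m + 60 * k) + 300) (ηc + ηb) G := by
  refine guarantees_of_body (Code.main m w K) rfl (by simp) fun d hd => ?_
  obtain ⟨τ₁, hτ₁, h₁⟩ := computes_init (O := O) (m := m) (w := w) (K := K) l d (by omega)
  obtain ⟨τ₂, hτ₂, h₂⟩ := computes_mul (O := O) (m := m) (w := w) (K := K) k w d (by omega)
  obtain ⟨τ₃, hτ₃, h₃⟩ := computes_mul (O := O) (m := m) (w := w) (K := K) k (k * w) d (by omega)
  obtain ⟨τ₄, hτ₄, h₄⟩ := computes_mul (O := O) (m := m) (w := w) (K := K) k K d (by omega)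
  obtain ⟨τ₅, hτ₅, h₅⟩ := computes_pow (O := O) (m := m) (w := w) (K := K) m (k * (k * w)) (k * K) d
    (by omega)
  obtain ⟨τ₆, hτ₆, h₆⟩ := computes_len (O := O) (m := m) (w := w) (K := K)
    ((l.map fun x => ((x, none) : X × Option ℝ)).map fun p => .pair (.pt p.1) (encKey p.2)) d
    (by simp; omega)
  rw [show ofList ((l.map fun x => ((x, none) : X × Option ℝ)).map
    fun p => .pair (.pt p.1) (encKey p.2)) =
    (encOpt (l.map fun x => (x, none)) : Val X C) from rfl] at h₆
  have hc' := hc d (by omega)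
  simp only [sampleInput, branchInput, List.length_map] at *
  rw [← hM] at h₅
  simp [Code.main, h₁, h₂, h₃, h₄, h₅, h₆]
  refine Ensures.delay' (T := Tc + (Tb + 30)) (Ensures.andThen' hc' (T₂ := Tb + 30) (η₂ := ηb) ?_
    le_rfl le_rfl) (by omega) le_rfl fun _ h => h
  rintro _ ⟨L, rfl, hL⟩
  have hb' := hb L hL d (by omega)
  refine Ensures.delay' (T := Tb + 10) (Ensures.andThen' hb' (T₂ := 10) (η₂ := 0) ?_
    le_rfl le_rfl) (by omega) (by simp) fun _ h => h
  rintro _ ⟨o, rfl, ho⟩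
  cases o with
  | none => exact ensures_ret (a := Val.nil) (t := 1) (by omega) (hG₀ ho) _
  | some r => exact ensures_ret (a := encCtrs r.2) (t := 1) (by omega) (hG r ho) _

end Randomized

/-! ## The approximate median -/

section Ranks

theorem everySecond_sublist {α : Type*} (l : List α) : (everySecond l).Sublist l := by
  fun_induction everySecond l with
  | case1 => exact List.Sublist.refl _
  | case2 => exact List.nil_sublist _
  | case3 x y l ih => exact (ih.cons_cons y).cons x

/-- In a sorted list the entries with a downward closed property form a prefix, and thinning keeps
every second entry of it. -/
theorem countP_everySecond {p : ℝ → Bool} (hp : ∀ x y, x ≤ y → p y → p x) (l : List ℝ)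
    (hl : l.Pairwise (· ≤ ·)) : (everySecond l).countP p = l.countP p / 2 := by
  fun_induction everySecond l with
  | case1 => simp
  | case2 x =>
    by_cases h : p x <;> simp [h]
  | case3 x y l ih =>
    simp only [List.pairwise_cons] at hl
    obtain ⟨h1, h2, h3⟩ := hl
    by_cases h : p y
    · have hx : p x := hp x y (h1 y (by simp)) h
      simp only [List.countP_cons, h, hx, ih h3, if_true]
      omega
    · have h0 : l.countP p = 0 := List.countP_eq_zero.2 fun z hz hz' => h (hp y z (h2 z hz) hz')
      simp only [List.countP_cons, h, ih h3, h0]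
      by_cases hx : p x <;> simp [hx]

/-- The number of entries of a list of lists that satisfy `p`. -/
def countRuns (p : ℝ → Bool) (L : List (List ℝ)) : ℕ := (L.map (List.countP p)).sum

theorem countRuns_mergePairs (p : ℝ → Bool) (L : List (List ℝ)) :
    countRuns p (mergePairs L) = countRuns p L := by
  fun_induction mergePairs L with
  | case1 => rfl
  | case2 a => rfl
  | case3 a b L ih =>
    simp only [countRuns, List.map_cons, List.sum_cons] at ih ⊢
    rw [ih, (List.merge_perm_append (xs := a) (ys := b) _).countP_eq, List.countP_append, add_assoc]

theorem pairwise_mergePairs (L : List (List ℝ)) (hL : ∀ a ∈ L, a.Pairwise (· ≤ ·)) :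
    ∀ a ∈ mergePairs L, a.Pairwise (· ≤ ·) := by
  fun_induction mergePairs L with
  | case1 => simp
  | case2 a => exact hL
  | case3 a b L ih =>
    intro c hc
    rcases List.mem_cons.1 hc with rfl | hc
    · have := List.pairwise_merge (le := fun x y : ℝ => decide (x ≤ y))
        (fun a b c h1 h2 => by simp at *; exact h1.trans h2)
        (fun a b => by simpa using le_total a b) (l₁ := a) (l₂ := b)
        (by simpa using hL a (by simp)) (by simpa using hL b (by simp))
      simpa using this
    · exact ih (fun a ha => hL a (by simp [ha])) c hc

theorem countRuns_thin {p : ℝ → Bool} (hp : ∀ x y, x ≤ y → p y → p x) (L : List (List ℝ))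
    (hL : ∀ a ∈ L, a.Pairwise (· ≤ ·)) :
    2 * countRuns p (L.map everySecond) ≤ countRuns p L ∧
      countRuns p L ≤ 2 * countRuns p (L.map everySecond) + L.length := by
  induction L with
  | nil => simp [countRuns]
  | cons a L ih =>
    have := ih fun a ha => hL a (by simp [ha])
    simp only [countRuns, List.map_cons, List.sum_cons, List.length_cons] at this ⊢
    rw [countP_everySecond hp a (hL a (by simp))]
    omega

/-- Each surviving entry stands for `W` original ones, and the rank error is at most the number of
lists minus one. If merging by fours leaves `s ≤ (L.length + 3) / 4` lists, then thinning doubles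
the later error `s - 1` and adds at most `s` for rounding, and `2 * (s - 1) + s ≤ L.length - 1`.
Merging by twos would not close this induction. -/
theorem reduce_spec (L : List (List ℝ)) (hL₀ : L ≠ []) (hL : ∀ a ∈ L, a.Pairwise (· ≤ ·)) :
    (reduce L).Pairwise (· ≤ ·) ∧ ∃ W : ℕ, ∀ p : ℝ → Bool, (∀ x y, x ≤ y → p y → p x) →
      W * (reduce L).countP p ≤ countRuns p L ∧
      countRuns p L + 1 ≤ W * (reduce L).countP p + L.length := by
  fun_induction reduce L with
  | case1 L h ih =>
    have hl₁ := length_mergePairs L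
    have hl₂ := length_mergePairs (mergePairs L)
    have hs := pairwise_mergePairs _ (pairwise_mergePairs L hL)
    obtain ⟨h1, W, h2⟩ := ih (by
        intro h0
        have := congrArg List.length h0
        simp at this
        simp [this] at hl₂
        omega) (by
        intro a ha
        obtain ⟨b, hb, rfl⟩ := List.mem_map.1 ha
        exact (hs b hb).sublist (everySecond_sublist b))
    refine ⟨h1, 2 * W, fun p hp => ?_⟩
    obtain ⟨h3, h4⟩ := h2 p hp
    have h5 := countRuns_thin hp _ hs
    rw [countRuns_mergePairs, countRuns_mergePairs] at h5
    rw [List.length_map] at h4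
    rw [mul_assoc]
    omega
  | case2 L h =>
    match L, h with
    | [a], h => exact ⟨hL a (by simp), 1, fun p _ => by simp [countRuns]⟩
    | a :: b :: L, h => simp at h

theorem countRuns_singles (p : ℝ → Bool) (l : List ℝ) :
    countRuns p (l.map fun x => [x]) = l.countP p := by
  induction l with
  | nil => rfl
  | cons a l ih =>
    simp only [countRuns, List.map_cons, List.sum_cons, List.countP_cons] at ih ⊢
    rw [ih]
    simp [add_comm]

/-- Three merges without thinning leave at most `(l.length + 7) / 8` runs, so the rank error stays
below `l.length / 8`. -/
theorem summary_spec (l : List ℝ) (hl : l ≠ []) :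
    (summary l).Pairwise (· ≤ ·) ∧ ∃ W : ℕ, ∀ p : ℝ → Bool, (∀ x y, x ≤ y → p y → p x) →
      W * (summary l).countP p ≤ l.countP p ∧
      8 * l.countP p + 1 ≤ 8 * (W * (summary l).countP p) + l.length := by
  set L₀ := l.map fun x => [x] with hL₀
  have hl₀ : L₀.length = l.length := by simp [hL₀]
  have hl₁ := length_mergePairs L₀
  have hl₂ := length_mergePairs (mergePairs L₀)
  have hl₃ := length_mergePairs (mergePairs (mergePairs L₀))
  have hpos := List.length_pos_of_ne_nil hl
  obtain ⟨h1, W, h2⟩ := reduce_spec (mergePairs (mergePairs (mergePairs L₀))) (by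
      intro h0
      rw [h0] at hl₃
      simp at hl₃
      omega) (pairwise_mergePairs _ (pairwise_mergePairs _ (pairwise_mergePairs _ (by
        intro a ha
        obtain ⟨b, hb, rfl⟩ := List.mem_map.1 ha
        exact List.pairwise_singleton _ _))))
  refine ⟨h1, W, fun p hp => ?_⟩
  obtain ⟨h3, h4⟩ := h2 p hp
  rw [countRuns_mergePairs, countRuns_mergePairs, countRuns_mergePairs, hL₀,
    countRuns_singles] at h3 h4
  rw [← hL₀] at h3 h4
  simp only [summary, ← hL₀]
  omega

theorem summary_ne_nil {l : List ℝ} (hl : l ≠ []) : summary l ≠ [] := by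
  intro h
  obtain ⟨-, W, h2⟩ := summary_spec l hl
  have h3 := (h2 (fun _ => true) (by simp)).2
  have := List.length_pos_of_ne_nil hl
  rw [h] at h3
  simp at h3
  omega

/-- With `n = l.length`, the summary represents at least `7/8 * n` entries, and half of them are at
most its middle. At most `n/2 + n/8` entries are strictly smaller. Because of ties neither bound
follows from the other. -/
theorem approxMedian_spec {l : List ℝ} (hl : l ≠ []) :
    7 * l.length ≤ 16 * l.countP (fun x => x ≤ approxMedian l) ∧
      3 * l.length ≤ 8 * l.countP (fun x => approxMedian l ≤ x) := by
  classical
  have hF := List.length_pos_of_ne_nil (summary_ne_nil hl)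
  obtain ⟨h1, W, h2⟩ := summary_spec l hl
  set F := summary l with hFdef
  have hj : F.length / 2 < F.length := by omega
  set θ := approxMedian l with hθ
  have hθ' : θ = F[F.length / 2] := by
    rw [hθ, approxMedian, ← hFdef, List.getD_eq_getElem _ _ hj]
  have hmono : ∀ i j (hi : i < F.length) (hj : j < F.length), i ≤ j → F[i] ≤ F[j] := by
    intro i j hi hj hij
    rcases hij.eq_or_lt with rfl | hij
    · exact le_rfl
    · exact List.pairwise_iff_getElem.1 h1 i j hi hj hij
  have hlt : F.countP (fun x => x < θ) ≤ F.length / 2 := by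
    conv_lhs => rw [← List.take_append_drop (F.length / 2) F]
    rw [List.countP_append]
    have h0 : (F.drop (F.length / 2)).countP (fun x => x < θ) = 0 := by
      refine List.countP_eq_zero.2 fun z hz => ?_
      obtain ⟨i, hi, rfl⟩ := List.mem_iff_getElem.1 hz
      rw [List.getElem_drop]
      simp only [decide_eq_true_eq, not_lt, hθ']
      exact hmono _ _ _ _ (by omega)
    rw [h0, add_zero]
    exact List.countP_le_length.trans (by simp)
  have hle : F.length / 2 + 1 ≤ F.countP (fun x => x ≤ θ) := by
    conv_rhs => rw [← List.take_append_drop (F.length / 2 + 1) F]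
    rw [List.countP_append]
    have h0 : (F.take (F.length / 2 + 1)).countP (fun x => x ≤ θ) = F.length / 2 + 1 := by
      rw [List.countP_eq_length.2]
      · simp; omega
      · intro z hz
        obtain ⟨i, hi, rfl⟩ := List.mem_iff_getElem.1 hz
        rw [List.getElem_take]
        simp only [decide_eq_true_eq, hθ']
        simp at hi
        exact hmono _ _ _ _ (by omega)
    omega
  obtain ⟨a1, a2⟩ := h2 (fun _ => true) (by simp)
  obtain ⟨b1, b2⟩ := h2 (fun x => x ≤ θ) (by simp; intro x y h h'; exact h.trans h')
  obtain ⟨c1, c2⟩ := h2 (fun x => x < θ) (by simp; intro x y h h'; exact h.trans_lt h')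
  simp only [List.countP_true] at a1 a2
  have e1 : W * (F.length / 2 + 1) ≤ W * F.countP (fun x => x ≤ θ) := Nat.mul_le_mul_left _ hle
  have e2 : W * F.countP (fun x => x < θ) ≤ W * (F.length / 2) := Nat.mul_le_mul_left _ hlt
  have e3 : W * (2 * (F.length / 2)) ≤ W * F.length := Nat.mul_le_mul_left _ (by omega)
  have e4 : W * F.length ≤ W * (2 * (F.length / 2 + 1)) := Nat.mul_le_mul_left _ (by omega)
  rw [mul_left_comm] at e3 e4
  have e5 : l.length = l.countP (fun x => θ ≤ x) + l.countP (fun x => x < θ) := by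
    rw [List.length_eq_countP_add_countP (p := fun x => decide (θ ≤ x))]
    simp
  constructor <;> omega

end Ranks

/-! ## The cost of pruning -/

section Pruning

variable {X β : Type*}

theorem sum_map_filter_add (R : List (X × ℝ)) (q : X × ℝ → Bool) (f : X × ℝ → ℝ) :
    (R.map f).sum = ((R.filter q).map f).sum + ((R.filter fun p => ¬ q p).map f).sum := by
  induction R with
  | nil => simp
  | cons a R ih =>
    by_cases h : q a <;> simp [h, ih] <;> ring

open Classical in
/-- The weight of the points of a list that are not bad. -/
noncomputable def goodSum (bad : X → Prop) (wt : X → ℝ) (R : List (X × β)) : ℝ :=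
  (R.map fun p => if bad p.1 then 0 else wt p.1).sum

open Classical in
/-- The number of bad points of a list. -/
noncomputable def badNum (bad : X → Prop) (R : List (X × β)) : ℕ := R.countP fun p => bad p.1

/-- A good entry with key at least `ν` weighs at least `ν`. This is the source that pays for
pruning. -/
theorem goodSum_ge {bad : X → Prop} {wt : X → ℝ} {R : List (X × ℝ)} {ν : ℝ}
    (h₀ : ∀ p ∈ R, 0 ≤ p.2) (hw : ∀ p ∈ R, ¬ bad p.1 → p.2 ≤ wt p.1) :
    ((R.countP fun p => ν ≤ p.2 : ℕ) - (badNum bad R : ℝ)) * ν ≤ goodSum bad wt R := by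
  classical
  induction R with
  | nil => simp [badNum, goodSum]
  | cons a R ih =>
    have := ih (fun p hp => h₀ p (by simp [hp])) (fun p hp => hw p (by simp [hp]))
    have h1 := h₀ a (by simp)
    have h2 := hw a (by simp)
    simp only [badNum, goodSum, List.countP_cons, List.map_cons, List.sum_cons] at this ⊢
    by_cases hb : bad a.1 <;> by_cases hc : ν ≤ a.2 <;> simp [hb, hc] at h2 ⊢ <;> nlinarith

/-- The expense of pruning: keys of good points are covered by their weights, those of bad points
only by `θ`. -/
theorem sum_keys_le {bad : X → Prop} {wt : X → ℝ} {R : List (X × ℝ)} {θ : ℝ}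
    (hθ : ∀ p ∈ R, p.2 ≤ θ) (hw : ∀ p ∈ R, ¬ bad p.1 → p.2 ≤ wt p.1) :
    (R.map Prod.snd).sum ≤ goodSum bad wt R + badNum bad R * θ := by
  classical
  induction R with
  | nil => simp [badNum, goodSum]
  | cons a R ih =>
    have := ih (fun p hp => hθ p (by simp [hp])) (fun p hp => hw p (by simp [hp]))
    have h1 := hθ a (by simp)
    have h2 := hw a (by simp)
    simp only [badNum, goodSum, List.countP_cons, List.map_cons, List.sum_cons] at this ⊢
    by_cases hb : bad a.1 <;> simp [hb] at h2 ⊢ <;> nlinarith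

open Classical in
/-- The weight of all points of a list, where `b` is the weight of the bad points. -/
noncomputable def totalSum (bad : X → Prop) (wt b : X → ℝ) (R : List (X × β)) : ℝ :=
  (R.map fun p => if bad p.1 then b p.1 else wt p.1).sum

theorem goodSum_le_totalSum {bad : X → Prop} {wt b : X → ℝ} (hb : ∀ x, 0 ≤ b x)
    (R : List (X × β)) : goodSum bad wt R ≤ totalSum bad wt b R := by
  classical
  refine List.sum_le_sum fun p _ => ?_
  split_ifs
  · exact hb _
  · exact le_rfl

/-- `μ` is a lower bound for the keys of `R`, nontrivial only if few points are bad. -/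
def IsLevel (bad : X → Prop) (R : List (X × ℝ)) (μ : ℝ) : Prop :=
  0 ≤ μ ∧ (∀ p ∈ R, μ ≤ p.2) ∧ (μ = 0 ∨ 2 * badNum bad R ≤ R.length)

/-- Amortization of one pruning. Bad points cost at most `a * |R| * θ` beyond the weights. Usually
many points survive with keys above `θ`; raising the level to `θ` spends part of their weight in
advance. If few survive, ties force many dropped keys to equal `θ`, and the dropped good points pay
themselves, so the level can restart at zero. Here `e` stands for the cost of the rest. -/
theorem exists_level_prune {bad : X → Prop} {wt b : X → ℝ} {R : List (X × ℝ)} (hR : R ≠ [])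
    (hb : ∀ x, 0 ≤ b x) (h₀ : ∀ p ∈ R, 0 ≤ p.2) (hw : ∀ p ∈ R, ¬ bad p.1 → p.2 ≤ wt p.1)
    {θ : ℝ} (hθ : θ = approxMedian (R.map Prod.snd)) {a s μ : ℝ} (ha₀ : 0 ≤ a) (ha : a ≤ 1 / 32)
    (hs : 0 ≤ s)
    (hbad : badNum bad R ≤ a * R.length) (hμ₀ : 0 ≤ μ) (hμ : ∀ p ∈ R, μ ≤ p.2) :
    ∃ μ', IsLevel bad (R.filter fun p => ¬ p.2 ≤ θ) μ' ∧ ∀ e : ℝ,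
      e ≤ (1 + s) * totalSum bad wt b (R.filter fun p => ¬ p.2 ≤ θ) +
        96 * a * (goodSum bad wt (R.filter fun p => ¬ p.2 ≤ θ) -
          1 / 16 * (R.filter fun p => ¬ p.2 ≤ θ).length * μ') →
      ((R.filter fun p => p.2 ≤ θ).map Prod.snd).sum + e ≤
        (1 + s) * totalSum bad wt b R +
          96 * a * (goodSum bad wt R - 1 / 16 * R.length * μ) := by
  classical
  obtain ⟨r1, r2⟩ := approxMedian_spec (l := R.map Prod.snd) (by simpa using hR)
  rw [← hθ, List.countP_map, List.length_map] at r1 r2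
  have hpos : 0 < R.length := List.length_pos_of_ne_nil hR
  have hG : goodSum bad wt R = goodSum bad wt (R.filter fun p => p.2 ≤ θ) +
      goodSum bad wt (R.filter fun p => ¬ p.2 ≤ θ) := by
    simpa [goodSum] using sum_map_filter_add R (fun p => p.2 ≤ θ)
      (fun p => if bad p.1 then 0 else wt p.1)
  have hT : totalSum bad wt b R = totalSum bad wt b (R.filter fun p => p.2 ≤ θ) +
      totalSum bad wt b (R.filter fun p => ¬ p.2 ≤ θ) := by
    simpa [totalSum] using sum_map_filter_add R (fun p => p.2 ≤ θ)
      (fun p => if bad p.1 then b p.1 else wt p.1)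
  have hN : (R.filter fun p => p.2 ≤ θ).length = R.countP ((fun x => x ≤ θ) ∘ Prod.snd) := by
    rw [List.countP_eq_length_filter]; rfl
  have hlen : R.length = (R.filter fun p => p.2 ≤ θ).length +
      (R.filter fun p => ¬ p.2 ≤ θ).length := by
    rw [← List.countP_eq_length_filter, ← List.countP_eq_length_filter,
      List.length_eq_countP_add_countP (p := fun p : X × ℝ => decide (p.2 ≤ θ))]
    simp
  have hge : R.countP ((fun x => θ ≤ x) ∘ Prod.snd) ≤
      ((R.filter fun p => p.2 ≤ θ).countP fun p => θ ≤ p.2) +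
        (R.filter fun p => ¬ p.2 ≤ θ).length := by
    rw [List.countP_eq_countP_filter_add R _ (fun p => decide (p.2 ≤ θ))]
    refine Nat.add_le_add le_rfl (List.countP_le_length.trans (le_of_eq ?_))
    simp only [decide_not]
  have hbN : badNum bad (R.filter fun p => p.2 ≤ θ) ≤ badNum bad R :=
    List.Sublist.countP_le List.filter_sublist
  have hbH : badNum bad (R.filter fun p => ¬ p.2 ≤ θ) ≤ badNum bad R :=
    List.Sublist.countP_le List.filter_sublist
  have hmN : ∀ p ∈ R.filter (fun p => p.2 ≤ θ), p ∈ R ∧ p.2 ≤ θ := by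
    intro p hp; simpa using hp
  have hmH : ∀ p ∈ R.filter (fun p => ¬ p.2 ≤ θ), p ∈ R ∧ θ < p.2 := by
    intro p hp; simpa using hp
  set N := R.filter fun p => p.2 ≤ θ with hNdef
  set H := R.filter fun p => ¬ p.2 ≤ θ with hHdef
  have hNne : N ≠ [] := by
    intro h
    rw [h] at hN
    simp at hN
    omega
  obtain ⟨p₀, hp₀⟩ := List.exists_mem_of_ne_nil _ hNne
  have hμθ : μ ≤ θ := (hμ p₀ (hmN p₀ hp₀).1).trans (hmN p₀ hp₀).2
  have hθ₀ : 0 ≤ θ := hμ₀.trans hμθ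
  have hkeys := sum_keys_le (bad := bad) (wt := wt) (fun p hp => (hmN p hp).2)
    (fun p hp => hw p (hmN p hp).1)
  have hge₁ := goodSum_ge (bad := bad) (wt := wt) (R := N) (ν := μ) (fun p hp => h₀ p (hmN p hp).1)
    (fun p hp => hw p (hmN p hp).1)
  have hge₂ := goodSum_ge (bad := bad) (wt := wt) (R := N) (ν := θ) (fun p hp => h₀ p (hmN p hp).1)
    (fun p hp => hw p (hmN p hp).1)
  have hall : N.countP (fun p => μ ≤ p.2) = N.length :=
    List.countP_eq_length.2 fun p hp => by simpa using hμ p (hmN p hp).1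
  rw [hall] at hge₁
  have hGT := goodSum_le_totalSum (bad := bad) (wt := wt) hb N
  have hG₀ : 0 ≤ goodSum bad wt N := List.sum_nonneg (by
    intro x hx
    obtain ⟨p, hp, rfl⟩ := List.mem_map.1 hx
    split_ifs with h
    · exact le_rfl
    · exact (h₀ p (hmN p hp).1).trans (hw p (hmN p hp).1 h))
  have hNb : (badNum bad N : ℝ) ≤ a * R.length := le_trans (by exact_mod_cast hbN) hbad
  have hn : (0 : ℝ) < R.length := by exact_mod_cast hpos
  have r1' : (7 : ℝ) * R.length ≤ 16 * N.length := by rw [hN]; exact_mod_cast r1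
  set n : ℝ := ((R.length : ℕ) : ℝ) with hndef
  -- It suffices that the expense for the bad points fits into the drop of the potential.
  have hdone : ∀ μ', a * n * θ - 96 * a * (1 / 16 * H.length * μ') ≤
      96 * a * (goodSum bad wt N - 1 / 16 * n * μ) → ∀ e : ℝ,
      e ≤ (1 + s) * totalSum bad wt b H + 96 * a * (goodSum bad wt H - 1 / 16 * H.length * μ') →
      (N.map Prod.snd).sum + e ≤ (1 + s) * totalSum bad wt b R +
          96 * a * (goodSum bad wt R - 1 / 16 * n * μ) := by
    intro μ' h1 e he
    have h2 : badNum bad N * θ ≤ a * n * θ := mul_le_mul_of_nonneg_right hNb hθ₀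
    have h3 : 0 ≤ s * totalSum bad wt b N := mul_nonneg hs (hG₀.trans hGT)
    rw [hG, hT]
    linarith
  have han : a * n ≤ 1 / 32 * n := mul_le_mul_of_nonneg_right ha hn.le
  -- With `3/16 * n` survivors the reserve `96 * a * |H| * θ / 16` is at least `9/8 * a * n * θ`.
  -- Otherwise at least `3/8 - 3/16` of the entries are dropped with key `θ`; minus `1/32` for bad
  -- points and `1/16` already spent, `3/32 * n * θ` is left, and `96 * a` times that exceeds `a * n
  -- * θ`.
  by_cases hH : 3 * R.length ≤ 16 * H.length
  · have hH' : 3 * n ≤ 16 * (H.length : ℝ) := by rw [hndef]; exact_mod_cast hH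
    refine ⟨θ, ⟨hθ₀, fun p hp => (hmH p hp).2.le, Or.inr ?_⟩, hdone θ ?_⟩
    · have : (2 : ℝ) * badNum bad H ≤ H.length := by
        have : (badNum bad H : ℝ) ≤ badNum bad R := by exact_mod_cast hbH
        linarith
      exact_mod_cast this
    · have h1 : (7 / 16 - 1 / 32) * n * μ ≤ goodSum bad wt N :=
        le_trans (mul_le_mul_of_nonneg_right (by linarith) hμ₀) hge₁
      have h2 : 1 / 16 * n * μ ≤ goodSum bad wt N := by
        refine le_trans ?_ h1
        exact mul_le_mul_of_nonneg_right (by linarith) hμ₀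
      have h3 : 0 ≤ 96 * a * (goodSum bad wt N - 1 / 16 * n * μ) :=
        mul_nonneg (by positivity) (by linarith)
      have h4 : 3 * n * (a * θ) ≤ 16 * (H.length : ℝ) * (a * θ) :=
        mul_le_mul_of_nonneg_right hH' (by positivity)
      nlinarith [mul_nonneg (mul_nonneg ha₀ hθ₀) hn.le]
  · refine ⟨0, ⟨le_rfl, fun p hp => h₀ p (hmH p hp).1, Or.inl rfl⟩, hdone 0 ?_⟩
    have h1 : 3 * R.length ≤ 16 * N.countP (fun p => θ ≤ p.2) := by omega
    have h1' : 3 * n ≤ 16 * (N.countP (fun p => θ ≤ p.2) : ℝ) := by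
      rw [hndef]; exact_mod_cast h1
    have h2 : (3 / 16 - 1 / 32) * n * θ ≤ goodSum bad wt N :=
      le_trans (mul_le_mul_of_nonneg_right (by linarith) hθ₀) hge₂
    have h3 : 1 / 16 * n * μ ≤ 1 / 16 * n * θ := mul_le_mul_of_nonneg_left hμθ (by positivity)
    have h4 : (3 / 16 - 1 / 32 - 1 / 16) * n * θ ≤ goodSum bad wt N - 1 / 16 * n * μ := by
      linarith
    have h5 := mul_le_mul_of_nonneg_left h4 (show 0 ≤ 96 * a by positivity)
    nlinarith [mul_nonneg (mul_nonneg ha₀ hθ₀) hn.le]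

end Pruning

/-! ## Sampling -/

section Sampling

variable {X : Type*}

open Classical in
theorem badCount_eq_sum (xs : List X) (j : ℕ) (G : List X → Prop) :
    badCount xs j G =
      ∑ f : Fin j → Fin xs.length, if G (List.ofFn fun i => xs[f i]) then 0 else 1 := by
  induction j generalizing G with
  | zero => simp [badCount]
  | succ j ih =>
    rw [badCount, ← (Fin.consEquiv fun _ : Fin (j + 1) => Fin xs.length).sum_comp,
      Fintype.sum_prod_type]
    refine Finset.sum_congr rfl fun i _ => ?_
    rw [ih]
    simp [Fin.consEquiv, List.ofFn_succ]

-- First occurrences embed the tuples from `P` into the position sequences, so good tuples are at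
-- most as many as good position sequences.
open Classical in
theorem badCount_add_card_le {xs : List X} (m : ℕ) (G : List X → Prop)
    (P : Finset X) (hP : ∀ x ∈ P, x ∈ xs) :
    badCount xs m G + (Finset.univ.filter fun S : Fin m → P =>
      G (List.ofFn fun i => (S i : X))).card ≤ xs.length ^ m := by
  have h1 : (Finset.univ.filter fun S : Fin m → P => G (List.ofFn fun i => (S i : X))).card ≤
      (Finset.univ.filter fun f : Fin m → Fin xs.length => G (List.ofFn fun i => xs[f i])).card := by
    have hidx : ∀ x : P, xs.idxOf (x : X) < xs.length :=
      fun x => List.idxOf_lt_length_of_mem (hP x x.2)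
    refine Finset.card_le_card_of_injOn (fun S i => ⟨xs.idxOf (S i : X), hidx (S i)⟩) ?_ ?_
    · intro S hS
      simpa using hS
    · intro S _ S' _ h
      funext i
      have h' : xs.idxOf (S i : X) = xs.idxOf (S' i : X) := congrArg Fin.val (congrFun h i)
      exact Subtype.ext ((List.idxOf_inj (hP _ (S i).2)).1 h')
  have h2 : badCount xs m G = (Finset.univ.filter fun f : Fin m → Fin xs.length =>
      ¬ G (List.ofFn fun i => xs[f i])).card := by
    rw [badCount_eq_sum, Finset.card_filter]
    exact Finset.sum_congr rfl fun f _ => (ite_not _ _ _).symm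
  have h3 := Finset.card_filter_add_card_filter_not (s := (Finset.univ : Finset (Fin m → Fin xs.length)))
    (fun f => G (List.ofFn fun i => xs[f i]))
  simp only [Finset.card_univ, Fintype.card_fun, Fintype.card_fin] at h3
  omega

-- At least `(1 - δ) * |P|^m` of the `n^m ≤ W^m * |P|^m` sequences are good.
open Classical in
theorem badCount_div_le {xs : List X} (hxs : xs ≠ []) (m : ℕ) (G : List X → Prop)
    (P : Finset X) (hP : ∀ x ∈ P, x ∈ xs) {W : ℕ} (hW : xs.length ≤ W * P.card) {δ : ℝ} (hδ : δ < 1)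
    (h : (1 - δ) * P.card ^ m ≤ (Finset.univ.filter fun S : Fin m → P =>
      G (List.ofFn fun i => (S i : X))).card) :
    (badCount xs m G : ℝ≥0∞) / (xs.length ^ m : ℕ) ≤ ENNReal.ofReal (1 - (1 - δ) / W ^ m) := by
  have hn : 0 < xs.length := List.length_pos_of_ne_nil hxs
  have hW₀ : 0 < W := by
    rcases Nat.eq_zero_or_pos W with rfl | h
    · rw [Nat.zero_mul] at hW; omega
    · assumption
  have h1 := badCount_add_card_le m G P hP
  have h1' : (badCount xs m G : ℝ) + (Finset.univ.filter fun S : Fin m → P =>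
      G (List.ofFn fun i => (S i : X))).card ≤ (xs.length : ℝ) ^ m := by exact_mod_cast h1
  have hn' : (0 : ℝ) < (xs.length : ℝ) ^ m := by positivity
  have hW' : (0 : ℝ) < (W : ℝ) ^ m := by positivity
  have h2 : (xs.length : ℝ) ^ m ≤ W ^ m * P.card ^ m := by
    rw [← mul_pow]
    exact pow_le_pow_left₀ (by positivity) (by exact_mod_cast hW) m
  have h3 : (1 - δ) / W ^ m * (xs.length : ℝ) ^ m ≤ (1 - δ) * P.card ^ m := by
    rw [div_mul_eq_mul_div, div_le_iff₀ hW']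
    have := mul_le_mul_of_nonneg_left h2 (sub_nonneg.2 hδ.le)
    linarith
  rw [← ENNReal.ofReal_natCast, ← ENNReal.ofReal_natCast, ← ENNReal.ofReal_div_of_pos (by exact_mod_cast hn')]
  apply ENNReal.ofReal_le_ofReal
  push_cast
  rw [div_le_iff₀ hn']
  linarith

/-- By `1 - x ≤ exp (-x)` the power is at most `exp (-(k * K * (1 - δ)))`, and the choice of `K`
gives `k * K * (1 - δ) ≥ k * (1 - log δ) ≥ log k - log δ`. -/
theorem one_sub_pow_le {δ : ℝ} (hδ : 0 < δ) (hδ' : δ < 1) {k K W m : ℕ} (hk : 0 < k) (hW : 0 < W)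
    (hK : (1 - Real.log δ) / (1 - δ) ≤ K) :
    (1 - (1 - δ) / (W : ℝ) ^ m) ^ (W ^ m * (k * K)) ≤ δ / k := by
  have hW' : (0 : ℝ) < (W : ℝ) ^ m := by positivity
  have hW1 : (1 : ℝ) ≤ (W : ℝ) ^ m := one_le_pow₀ (by exact_mod_cast hW)
  have h1δ : 0 < 1 - δ := by linarith
  have hx : (1 - δ) / (W : ℝ) ^ m ≤ 1 := by
    rw [div_le_one hW']; linarith
  have h1 : (1 - (1 - δ) / (W : ℝ) ^ m) ≤ Real.exp (-((1 - δ) / (W : ℝ) ^ m)) := by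
    have := Real.add_one_le_exp (-((1 - δ) / (W : ℝ) ^ m))
    linarith
  have hk' : (0 : ℝ) < k := by exact_mod_cast hk
  have hk1 : (1 : ℝ) ≤ k := by exact_mod_cast hk
  rw [div_le_iff₀ h1δ] at hK
  have hlog : Real.log δ < 0 := Real.log_neg hδ hδ'
  calc (1 - (1 - δ) / (W : ℝ) ^ m) ^ (W ^ m * (k * K))
      ≤ Real.exp (-((1 - δ) / (W : ℝ) ^ m)) ^ (W ^ m * (k * K)) :=
        pow_le_pow_left₀ (by linarith) h1 _
    _ = Real.exp (-(k * (K * (1 - δ)))) := by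
        rw [← Real.exp_nat_mul]
        congr 1
        push_cast
        field_simp
    _ ≤ Real.exp (Real.log δ - Real.log k) := by
        apply Real.exp_le_exp.2
        have h2 : (k : ℝ) * (1 - Real.log δ) ≤ k * (K * (1 - δ)) :=
          mul_le_mul_of_nonneg_left hK hk'.le
        have h3 : Real.log k ≤ k := (Real.log_le_sub_one_of_pos hk').trans (by linarith)
        nlinarith
    _ = δ / k := by rw [Real.exp_sub, Real.exp_log hδ, Real.exp_log hk']

/-- In the setting of the weak sampling property, the probability that a sample of `m` points of a
list yields no good candidate for a large part `P` of the list. -/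
theorem badCount_weakSampling [PseudoMetricSpace X] {C : Set X} {ε δ : ℝ} {m t : ℕ}
    {Γ : (Fin m → X) → Finset C} (hΓ : WeakSampling C ε δ m t Γ) (hδ : δ < 1)
    {near : X → C} {Gt Q D : ℕ} {xs : List X} (hxs : xs ≠ []) (P : Finset X) (hP₀ : P.Nonempty)
    (hP : ∀ x ∈ P, x ∈ xs) {W : ℕ} (hW : xs.length ≤ W * P.card) {o : X} (ho : o ∈ C) :
    (badCount xs m (fun S => S.length = m → ∃ c ∈ (oracles C Γ near Gt Q D).cand S,
      ∑ p ∈ P, dist p (c : X) ≤ (1 + ε) * ∑ p ∈ P, dist p o) : ℝ≥0∞) / (xs.length ^ m : ℕ) ≤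
      ENNReal.ofReal (1 - (1 - δ) / W ^ m) := by
  classical
  refine badCount_div_le hxs m _ P hP hW hδ ?_
  have : Nonempty P := hP₀.to_subtype
  have h := hΓ.2 P
  rw [PMF.toOuterMeasure_uniformOfFintype_apply] at h
  simp only [ENNReal.toReal_div, ENNReal.toReal_natCast, Fintype.card_fun, Fintype.card_coe,
    Fintype.card_fin, Nat.cast_pow, ENNReal.toReal_pow] at h
  have hc : (0 : ℝ) < (P.card : ℝ) ^ m := by
    have := hP₀.card_pos
    positivity
  rw [le_div_iff₀ hc] at h
  refine h.trans ?_
  rw [Fintype.card_ofFinset] 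
  norm_cast
  apply Finset.card_le_card
  intro S hS
  simp only [Finset.mem_filter, Finset.mem_univ, true_and, Set.mem_ofPred_eq] at hS ⊢
  obtain ⟨c, hc, hc'⟩ := hS
  intro hlen
  refine ⟨c, ?_, hc' o ho⟩
  simp only [oracles]
  rw [dif_pos hlen]
  simpa using hc

end Sampling

/-! ## Analysis of the search -/

section Branching

variable {X C : Type*} {O : Oracles X C} {m w K : ℕ}

theorem pick_cases (r : ℝ × List C) (o : Option (ℝ × List C)) :
    pick r o = r ∨ o = some (pick r o) := by
  cases o with
  | none => exact Or.inl rfl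
  | some r' =>
    by_cases h : r.1 ≤ r'.1
    · simp [pick, h]
    · simp [pick, h]

theorem pick_fst_le_left (r : ℝ × List C) (o : Option (ℝ × List C)) : (pick r o).1 ≤ r.1 := by
  cases o with
  | none => exact le_rfl
  | some r' =>
    by_cases h : r.1 ≤ r'.1
    · simp [pick, h]
    · simp [pick, h, (not_le.1 h).le]

theorem pick_fst_le_right (r r' : ℝ × List C) : (pick r (some r')).1 ≤ r'.1 := by
  by_cases h : r.1 ≤ r'.1
  · simp [pick, h]
  · simp [pick, h]

theorem branch_safe {M l T₁ : ℕ} {R : List (X × Option ℝ)} {Cl : List C} {V : ℝ × List C → Prop}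
    {L : List C} (h : ∀ c ∈ L, Guarantees O m w K 16 (searchInput M l (update O c R) (c :: Cl)) T₁ 0
      fun v => ∃ r, v = encRes r ∧ V r) :
    Guarantees O m w K 17 (branchInput L M l R Cl)
      (L.length * (T₁ + (O.dstTime + 60) * R.length + 200) + 30) 0
      fun v => ∃ o, v = encOptRes o ∧ ∀ r, o = some r → V r := by
  induction L with
  | nil =>
    refine (branch_nil M l R Cl).mono (by simp) le_rfl ?_
    rintro _ rfl
    exact ⟨none, rfl, by simp⟩
  | cons c L ih =>
    refine (branch_step (h c (by simp)) (ih fun c hc => h c (by simp [hc]))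
      (G := fun o => ∀ r, o = some r → V r) ?_).mono ?_ (by simp) fun _ h => h
    · rintro r o hr ho r' h
      obtain rfl := Option.some_injective _ h
      rcases pick_cases r o with e | e
      · rw [e]; exact hr
      · exact ho _ e
    · rw [List.length_cons, Nat.add_mul L.length 1]; omega

/-- Keeping the cheaper result cannot spoil a good one. The other candidates only need valid
results, so failure probabilities are not summed over the candidates. -/
theorem branch_good {M l T₁ : ℕ} {R : List (X × Option ℝ)} {Cl : List C} {V : ℝ × List C → Prop}
    {η : ℝ≥0∞} {b : ℝ} {L : List C}
    (h : ∀ c ∈ L, Guarantees O m w K 16 (searchInput M l (update O c R) (c :: Cl)) T₁ 0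
      fun v => ∃ r, v = encRes r ∧ V r)
    (h' : ∃ c ∈ L, Guarantees O m w K 16 (searchInput M l (update O c R) (c :: Cl)) T₁ η
      fun v => ∃ r, v = encRes r ∧ V r ∧ r.1 ≤ b) :
    Guarantees O m w K 17 (branchInput L M l R Cl)
      (L.length * (T₁ + (O.dstTime + 60) * R.length + 200) + 30) η
      fun v => ∃ o, v = encOptRes o ∧ ∃ r, o = some r ∧ V r ∧ r.1 ≤ b := by
  induction L with
  | nil => simp at h'
  | cons c L ih =>
    have hT : T₁ + (L.length * (T₁ + (O.dstTime + 60) * R.length + 200) + 30) +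
        (O.dstTime + 60) * R.length + 200 ≤
        (c :: L).length * (T₁ + (O.dstTime + 60) * R.length + 200) + 30 := by
      rw [List.length_cons, Nat.add_mul L.length 1]; omega
    obtain ⟨c', hc', hg⟩ := h'
    rcases List.mem_cons.1 hc' with rfl | hc'
    · refine (branch_step hg (branch_safe (V := V) fun c hc => h c (by simp [hc]))
        (G := fun o => ∃ r, o = some r ∧ V r ∧ r.1 ≤ b) ?_).mono hT (by simp) fun _ h => h
      rintro r o ⟨hr, hr'⟩ ho
      refine ⟨_, rfl, ?_, (pick_fst_le_left r o).trans hr'⟩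
      rcases pick_cases r o with e | e
      · rw [e]; exact hr
      · exact ho _ e
    · refine (branch_step (h c (by simp)) (ih (fun c hc => h c (by simp [hc])) ⟨c', hc', hg⟩)
        (G := fun o => ∃ r, o = some r ∧ V r ∧ r.1 ≤ b) ?_).mono hT (by simp) fun _ h => h
      rintro r _ hr ⟨r', rfl, ho, ho'⟩
      refine ⟨_, rfl, ?_, (pick_fst_le_right r r').trans ho'⟩
      rcases pick_cases r (some r') with e | e
      · rw [e]; exact hr
      · rw [← Option.some_injective _ e]; exact ho

end Branching

/-! ### Validity and running time of the search -/

section Search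

variable {X : Type*} [PseudoMetricSpace X] {C : Set X} {m w K t G Q D : ℕ}
  {Γ : (Fin m → X) → Finset C} {near : X → C}

/-- The set of the centers in a list. -/
def centers (cs : List C) : Set X := {x | ∃ c ∈ cs, (c : X) = x}

/-- `r` consists of an upper bound for the cost of the points `xs`, and a nonempty list of centers that
extends `Cl` by at most `l` centers. -/
def Valid (xs : List X) (Cl : List C) (l : ℕ) (r : ℝ × List C) : Prop :=
  (∀ c ∈ Cl, c ∈ r.2) ∧ r.2.length ≤ Cl.length + l ∧
    (xs.map fun x => Metric.infDist x (centers r.2)).sum ≤ r.1 ∧ r.2 ≠ []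

/-- The factor by which one more center increases the time for the search. -/
def timeFactor (m t G M : ℕ) : ℕ := 16000 * (m * t * G * M)

/-- Time for the search on a list of length `n` with at most `l` more centers. -/
def searchTime (m t G U M l n : ℕ) : ℕ := timeFactor m t G M ^ (l + 1) * (U * n) + 30

theorem infDist_centers_anti {Cl Cl' : List C} (hCl : Cl ≠ []) (h : ∀ c ∈ Cl, c ∈ Cl') (x : X) :
    Metric.infDist x (centers Cl') ≤ Metric.infDist x (centers Cl) := by
  obtain ⟨c, hc⟩ := List.exists_mem_of_ne_nil _ hCl
  refine Metric.infDist_le_infDist_of_subset ?_ ⟨c, c, hc, rfl⟩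
  rintro _ ⟨c, hc, rfl⟩
  exact ⟨c, h c hc, rfl⟩

theorem infDist_centers_le {Cl : List C} {c : C} (h : c ∈ Cl) (x : X) :
    Metric.infDist x (centers Cl) ≤ dist x c :=
  Metric.infDist_le_dist_of_mem ⟨c, h, rfl⟩

/-- Dropped points are charged their keys, and later centers only bring them closer. -/
theorem Valid.prune {R : List (X × ℝ)} {Cl : List C} (hCl : Cl ≠ []) {l : ℕ} {θ : ℝ}
    (hR : ∀ p ∈ R, Metric.infDist p.1 (centers Cl) ≤ p.2) {r : ℝ × List C}
    (h : Valid ((R.filter fun p => ¬ p.2 ≤ θ).map Prod.fst) Cl l r) :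
    Valid (R.map Prod.fst) Cl l
      (((R.filter fun p => p.2 ≤ θ).map Prod.snd).sum + r.1, r.2) := by
  obtain ⟨h1, h2, h3, h4⟩ := h
  refine ⟨h1, h2, ?_, h4⟩
  have e := sum_map_filter_add R (fun p => decide (p.2 ≤ θ))
    fun p => Metric.infDist p.1 (centers r.2)
  rw [List.map_map] at h3 ⊢
  simp only [Function.comp_def]
  rw [e]
  refine add_le_add (List.sum_le_sum fun p hp => ?_) ?_
  · exact (infDist_centers_anti hCl h1 _).trans (hR p (List.mem_of_mem_filter hp))
  · simpa [Function.comp_def] using h3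

omit [PseudoMetricSpace X] in
theorem map_fst_update {O : Oracles X C} {c : C} (R : List (X × Option ℝ)) :
    (update O c R).map Prod.fst = R.map Prod.fst := by
  simp [update, Function.comp_def]

omit [PseudoMetricSpace X] in
theorem length_update {O : Oracles X C} {c : C} (R : List (X × Option ℝ)) :
    (update O c R).length = R.length := by
  simp [update]

/-- The keys of `R` are upper bounds of the distances to `Cl`. -/
def KeysValid (R : List (X × Option ℝ)) (Cl : List C) : Prop :=
  ∀ p ∈ R, ∀ y, p.2 = some y → Cl ≠ [] ∧ Metric.infDist p.1 (centers Cl) ≤ y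

theorem KeysValid.update {R : List (X × Option ℝ)} {Cl : List C} (h : KeysValid R Cl) (c : C) :
    ∀ p ∈ update (oracles C Γ near G Q D) c R,
      Metric.infDist p.1 (centers (c :: Cl)) ≤ p.2 := by
  intro p hp
  obtain ⟨⟨x, o⟩, hq, rfl⟩ := List.mem_map.1 hp
  have h1 : Metric.infDist x (centers (c :: Cl)) ≤ dist x c := infDist_centers_le (by simp) x
  cases o with
  | none => exact h1
  | some y =>
    obtain ⟨h2, h3⟩ := h _ hq y rfl
    exact le_min h1 ((infDist_centers_anti h2 (by simp +contextual) x).trans h3)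

theorem length_cand_le (ht : ∀ S, (Γ S).card ≤ t) (S : List X) :
    ((oracles C Γ near G Q D).cand S).length ≤ t := by
  simp only [oracles]
  split_ifs with h
  · rw [Finset.length_toList]; exact ht _
  · simp

theorem collTime_le {M n : ℕ} (hm : 0 < m) (ht : 0 < t) (hG : 0 < G) (hM : 0 < M)
    (hD : 0 < D) (hn : 0 < n) : collTime (oracles C Γ near G Q D) m t n M ≤
      300 * ((m * t * G * M) * ((Q + D) * n)) := by
  have hU : 0 < Q + D := by omega
  set U := Q + D with hUdef
  set Z := (m * t * G * M) * (U * n) with hZ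
  have h1 : n * m * M ≤ Z := by
    rw [hZ, show m * t * G * M * (U * n) = n * m * M * (t * G * U) by ring]
    exact Nat.le_mul_of_pos_right _ (by positivity)
  have h2 : m * M ≤ Z := by
    rw [hZ, show m * t * G * M * (U * n) = m * M * (n * t * G * U) by ring]
    exact Nat.le_mul_of_pos_right _ (by positivity)
  have h3 : G * U * M ≤ Z := by
    rw [hZ, show m * t * G * M * (U * n) = G * U * M * (n * t * m) by ring]
    exact Nat.le_mul_of_pos_right _ (by positivity)
  have h4 : t * M ≤ Z := by
    rw [hZ, show m * t * G * M * (U * n) = t * M * (n * m * G * U) by ring]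
    exact Nat.le_mul_of_pos_right _ (by positivity)
  have h5 : M ≤ Z := (Nat.le_mul_of_pos_left _ ht).trans h4
  have h6 : ((20 * n + 60) * m + G * U + 30 * t + 130) * M + 30 =
      20 * (n * m * M) + 60 * (m * M) + G * U * M + 30 * (t * M) + 130 * M + 30 := by ring
  simp only [collTime, oracles, ← hUdef]
  rw [h6]
  omega

/-- Time for one more center. -/
theorem branchTime_le {M l n : ℕ} (hm : 0 < m) (ht : 0 < t) (hG : 0 < G) (hM : 0 < M)
    (hD : 0 < D) (hn : 0 < n) {c : ℕ} (hc : c ≤ M * t) :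
    c * (searchTime m t G (Q + D) M l n + (D + 60) * n + 200) + 30 ≤
      timeFactor m t G M ^ (l + 1) * ((m * t * G * M) * ((Q + D) * n)) +
        400 * ((m * t * G * M) * ((Q + D) * n)) := by
  have hU : 0 < Q + D := by omega
  have hDU : D ≤ Q + D := by omega
  set U := Q + D with hUdef
  set B := m * t * G * M with hB
  set Y := timeFactor m t G M ^ (l + 1) with hY
  have hB₀ : 0 < B := by positivity
  have hcB : c ≤ B := by
    refine hc.trans ?_
    rw [hB, show m * t * G * M = M * t * (m * G) by ring]
    exact Nat.le_mul_of_pos_right _ (by positivity)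
  have hnZ : n ≤ U * n := Nat.le_mul_of_pos_left _ hU
  have h1 : searchTime m t G U M l n + (D + 60) * n + 200 ≤ Y * (U * n) + 291 * (U * n) := by
    have : D * n ≤ U * n := Nat.mul_le_mul_right _ hDU
    simp only [searchTime, ← hY]
    rw [Nat.add_mul D 60 n]
    omega
  have h2 := Nat.mul_le_mul hcB h1
  have h3 : B * (Y * (U * n) + 291 * (U * n)) = Y * (B * (U * n)) + 291 * (B * (U * n)) := by ring
  have h4 : 0 < B * (U * n) := by positivity
  omega

/-- The pruned list uses `9000` of the `16000` units of the factor; sampling, branching and linear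
work need `5001` of the remaining `7000`. -/
theorem searchTime_step {M l n h U : ℕ} (hm : 0 < m) (ht : 0 < t) (hG : 0 < G) (hM : 0 < M)
    (hU : 0 < U) (hn : 0 < n) (hh : 16 * h ≤ 9 * n) :
    searchTime m t G U M l h +
      300 * ((m * t * G * M) * (U * n)) + (timeFactor m t G M ^ l * ((m * t * G * M) * (U * n)) +
        400 * ((m * t * G * M) * (U * n))) + 2100 * n + 2200 ≤ searchTime m t G U M l n := by
  have hY₀ : 0 < timeFactor m t G M := by simp only [timeFactor]; positivity
  simp only [searchTime, pow_succ]
  set Y := timeFactor m t G M ^ l with hY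
  have hY1 : 0 < Y := pow_pos hY₀ l
  simp only [timeFactor]
  set B := m * t * G * M with hB
  have hB₀ : 0 < B := by positivity
  have h1 : n ≤ B * (U * n) := by
    rw [show B * (U * n) = n * (B * U) by ring]
    exact Nat.le_mul_of_pos_right _ (by positivity)
  have h2 : B * (U * n) ≤ Y * (B * (U * n)) := Nat.le_mul_of_pos_left _ hY1
  have h3 : Y * (16000 * B) * (U * n) = 16000 * (Y * (B * (U * n))) := by ring
  have h4 : Y * (16000 * B) * (U * h) = 1000 * (Y * B * U * (16 * h)) := by ring
  have h5 : Y * B * U * (16 * h) ≤ Y * B * U * (9 * n) := Nat.mul_le_mul_left _ hh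
  have h6 : Y * B * U * (9 * n) = 9 * (Y * (B * (U * n))) := by ring
  omega

omit [PseudoMetricSpace X] in
theorem length_prune {R : List (X × ℝ)} (hR : R ≠ []) {θ : ℝ}
    (hθ : θ = approxMedian (R.map Prod.snd)) :
    16 * (R.filter fun p => ¬ p.2 ≤ θ).length ≤ 9 * R.length := by
  obtain ⟨r1, -⟩ := approxMedian_spec (l := R.map Prod.snd) (by simpa using hR)
  rw [← hθ, List.countP_map, List.length_map] at r1
  have h := List.length_eq_countP_add_countP (p := fun p : X × ℝ => decide (p.2 ≤ θ)) (l := R)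
  rw [← List.countP_eq_length_filter]
  have e : R.countP ((fun x => decide (x ≤ θ)) ∘ Prod.snd) =
    R.countP (fun p : X × ℝ => decide (p.2 ≤ θ)) := rfl
  rw [e] at r1
  simp only [decide_not, decide_eq_true_eq] at h ⊢
  omega

theorem keysValid_some {R : List (X × ℝ)} {Cl : List C} (hCl : Cl ≠ [])
    (h : ∀ p ∈ R, Metric.infDist p.1 (centers Cl) ≤ p.2) :
    KeysValid (R.map fun p => (p.1, some p.2)) Cl := by
  intro p hp y hy
  obtain ⟨q, hq, rfl⟩ := List.mem_map.1 hp
  obtain rfl := Option.some_injective _ hy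
  exact ⟨hCl, h q hq⟩

theorem Valid.of_cons {xs : List X} {c : C} {Cl : List C} {l : ℕ} {r : ℝ × List C}
    (h : Valid xs (c :: Cl) l r) : Valid xs Cl (l + 1) r :=
  ⟨fun c' hc' => h.1 c' (by simp [hc']), by have := h.2.1; simp at this; omega, h.2.2⟩

theorem branch_valid (hm : 0 < m) (ht : 0 < t) (hG : 0 < G) (hD : 0 < D) {M : ℕ} (hM : 0 < M)
    {l : ℕ} {R : List (X × Option ℝ)} {Cl : List C} (hR₀ : R ≠ [])
    (hS : ∀ c, Guarantees (oracles C Γ near G Q D) m w K 16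
      (searchInput M l (update (oracles C Γ near G Q D) c R) (c :: Cl))
      (searchTime m t G (Q + D) M l R.length) 0
      fun v => ∃ r, v = encRes r ∧ Valid (R.map Prod.fst) (c :: Cl) l r)
    {L : List C} (hL : L.length ≤ M * t) :
    Guarantees (oracles C Γ near G Q D) m w K 17 (branchInput L M l R Cl)
      (timeFactor m t G M ^ (l + 1) * ((m * t * G * M) * ((Q + D) * R.length)) +
        400 * ((m * t * G * M) * ((Q + D) * R.length))) 0
      fun v => ∃ o, v = encOptRes o ∧ ∀ r, o = some r → Valid (R.map Prod.fst) Cl (l + 1) r := by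
  refine (branch_safe (V := Valid (R.map Prod.fst) Cl (l + 1)) fun c _ => (hS c).mono le_rfl le_rfl
    ?_).mono (branchTime_le hm ht hG hM hD (List.length_pos_of_ne_nil hR₀) hL) le_rfl fun _ h => h
  rintro _ ⟨r, rfl, hr⟩
  exact ⟨r, rfl, hr.of_cons⟩

theorem branch_valid_le (hm : 0 < m) (ht : 0 < t) (hG : 0 < G) (hD : 0 < D) {M : ℕ} (hM : 0 < M)
    {l : ℕ} {R : List (X × Option ℝ)} {Cl : List C} (hR₀ : R ≠ [])
    (hS : ∀ c, Guarantees (oracles C Γ near G Q D) m w K 16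
      (searchInput M l (update (oracles C Γ near G Q D) c R) (c :: Cl))
      (searchTime m t G (Q + D) M l R.length) 0
      fun v => ∃ r, v = encRes r ∧ Valid (R.map Prod.fst) (c :: Cl) l r)
    {L : List C} (hL : L.length ≤ M * t) {η : ℝ≥0∞} {b : ℝ}
    (hg : ∃ c ∈ L, Guarantees (oracles C Γ near G Q D) m w K 16
      (searchInput M l (update (oracles C Γ near G Q D) c R) (c :: Cl))
      (searchTime m t G (Q + D) M l R.length) η
      fun v => ∃ r, v = encRes r ∧ Valid (R.map Prod.fst) (c :: Cl) l r ∧ r.1 ≤ b) :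
    Guarantees (oracles C Γ near G Q D) m w K 17 (branchInput L M l R Cl)
      (timeFactor m t G M ^ (l + 1) * ((m * t * G * M) * ((Q + D) * R.length)) +
        400 * ((m * t * G * M) * ((Q + D) * R.length))) η
      fun v => ∃ o, v = encOptRes o ∧
        ∃ r, o = some r ∧ Valid (R.map Prod.fst) Cl (l + 1) r ∧ r.1 ≤ b := by
  refine (branch_good (V := Valid (R.map Prod.fst) Cl (l + 1)) (b := b) (η := η)
    (fun c _ => (hS c).mono le_rfl le_rfl ?_) ?_).mono
    (branchTime_le hm ht hG hM hD (List.length_pos_of_ne_nil hR₀) hL) le_rfl fun _ h => h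
  · rintro _ ⟨r, rfl, hr⟩
    exact ⟨r, rfl, hr.of_cons⟩
  · obtain ⟨c, hc, h⟩ := hg
    refine ⟨c, hc, h.mono le_rfl le_rfl ?_⟩
    rintro _ ⟨r, rfl, hr, hr'⟩
    exact ⟨r, rfl, hr.of_cons, hr'⟩

omit [PseudoMetricSpace X] in
theorem map_fst_some (R : List (X × ℝ)) :
    (R.map fun p => (p.1, some p.2)).map Prod.fst = R.map Prod.fst := by
  simp [Function.comp_def]

/-- One level of the search, in terms of what is known about pruning and about branching. -/
theorem search_recursion (hm : 0 < m) (ht : 0 < t) (hG : 0 < G) (hD : 0 < D)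
    {M : ℕ} (hM : 0 < M) {l : ℕ} {R : List (X × ℝ)} (hR₀ : R ≠ [])
    {Cl : List C} {θ : ℝ} (hθ : θ = approxMedian (R.map Prod.snd)) {η₁ ηc ηb : ℝ≥0∞}
    {G₁ G₀ : ℝ × List C → Prop} {Gc : List C → Prop} {Gb : Option (ℝ × List C) → Prop}
    (h₁ : Guarantees (oracles C Γ near G Q D) m w K 16
      (searchInput M l (R.filter fun p => ¬ p.2 ≤ θ) Cl)
      (searchTime m t G (Q + D) M l (R.filter fun p => ¬ p.2 ≤ θ).length) η₁
      fun v => ∃ r, v = encRes r ∧ G₁ r)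
    (hc : Guarantees (oracles C Γ near G Q D) m w K 5
      (sampleInput M (R.map fun p => (p.1, some p.2)))
      (collTime (oracles C Γ near G Q D) m t R.length M) ηc fun v => ∃ L, v = encCtrs L ∧ Gc L)
    (hb : ∀ l', l = l' + 1 → ∀ L, Gc L → Guarantees (oracles C Γ near G Q D) m w K 17
      (branchInput L M l' (R.map fun p => (p.1, some p.2)) Cl)
      (timeFactor m t G M ^ (l' + 1) * ((m * t * G * M) * ((Q + D) * R.length)) +
        400 * ((m * t * G * M) * ((Q + D) * R.length))) ηb fun v => ∃ o, v = encOptRes o ∧ Gb o)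
    (hG₀ : l = 0 → ∀ r, G₁ r → G₀ (((R.filter fun p => p.2 ≤ θ).map Prod.snd).sum + r.1, r.2))
    (hpick : l ≠ 0 → ∀ r o, G₁ r → Gb o →
      G₀ (pick (((R.filter fun p => p.2 ≤ θ).map Prod.snd).sum + r.1, r.2) o)) :
    Guarantees (oracles C Γ near G Q D) m w K 16 (searchInput M l R Cl)
      (searchTime m t G (Q + D) M l R.length)
      (η₁ + ηc + ηb) fun v => ∃ r, v = encRes r ∧ G₀ r := by
  have hn : 0 < R.length := List.length_pos_of_ne_nil hR₀
  have h1 := collTime_le (C := C) (Γ := Γ) (near := near) (Q := Q) hm ht hG hM hD hn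
  have h2 := searchTime_step (l := l) hm ht hG hM (U := Q + D) (by omega) hn (length_prune hR₀ hθ)
  refine (search_step hR₀ (summary_ne_nil (by simpa using hR₀)) hθ h₁ hc
    (Tb := timeFactor m t G M ^ l * ((m * t * G * M) * ((Q + D) * R.length)) +
        400 * ((m * t * G * M) * ((Q + D) * R.length))) ?_ hG₀ hpick).mono ?_ le_rfl fun _ h => h
  · rintro l' rfl L hL
    exact hb l' rfl L hL
  · omega

/-- Branching lowers `l` and keeps the list, pruning keeps `l` and shortens the list; hence the
nested induction. -/
theorem search_safe (hm : 0 < m) (ht : 0 < t) (hG : 0 < G) (hD : 0 < D)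
    (hΓ : ∀ S, (Γ S).card ≤ t) {M : ℕ} (hM : 0 < M) (l : ℕ) (R : List (X × ℝ)) (Cl : List C)
    (hCl : Cl ≠ []) (hR : ∀ p ∈ R, Metric.infDist p.1 (centers Cl) ≤ p.2) :
    Guarantees (oracles C Γ near G Q D) m w K 16 (searchInput M l R Cl)
      (searchTime m t G (Q + D) M l R.length) 0
      fun v => ∃ r, v = encRes r ∧ Valid (R.map Prod.fst) Cl l r := by
  induction l generalizing R Cl with
  | zero =>
    induction hn : R.length using Nat.strong_induction_on generalizing R with
    | _ n ih =>
    subst hn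
    by_cases hR₀ : R = []
    · subst hR₀
      refine (search_nil M 0 Cl).mono (by simp [searchTime]) le_rfl ?_
      rintro _ rfl
      exact ⟨_, rfl, by simp [Valid, hCl]⟩
    have hn : 0 < R.length := List.length_pos_of_ne_nil hR₀
    have hlen := length_prune hR₀ rfl
    have hc := coll_safe (O := oracles C Γ near G Q D) (m := m) (w := w) (K := K)
      (R := R.map fun p => (p.1, some p.2)) (by simpa using hR₀) (length_cand_le hΓ) M
    rw [List.length_map] at hc
    refine (search_recursion hm ht hG hD hM hR₀ rfl
      (ih _ (by omega) _ (fun p hp => hR p (List.mem_of_mem_filter hp)) rfl) hc (ηb := 0)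
      (Gb := fun _ => True) (by simp) (fun _ r hr => Valid.prune hCl hR hr) (by simp)).mono le_rfl
      (by simp) fun _ h => h
  | succ l ihl =>
    induction hn : R.length using Nat.strong_induction_on generalizing R with
    | _ n ih =>
    subst hn
    by_cases hR₀ : R = []
    · subst hR₀
      refine (search_nil M (l + 1) Cl).mono (by simp [searchTime]) le_rfl ?_
      rintro _ rfl
      exact ⟨_, rfl, by simp [Valid, hCl]⟩
    have hn : 0 < R.length := List.length_pos_of_ne_nil hR₀
    have hlen := length_prune hR₀ rfl
    have hkeys := keysValid_some hCl hR
    have hc := coll_safe (O := oracles C Γ near G Q D) (m := m) (w := w) (K := K)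
      (R := R.map fun p => (p.1, some p.2)) (by simpa using hR₀) (length_cand_le hΓ) M
    rw [List.length_map] at hc
    refine (search_recursion hm ht hG hD hM hR₀ rfl
      (ih _ (by omega) _ (fun p hp => hR p (List.mem_of_mem_filter hp)) rfl) hc (ηb := 0)
      (Gb := fun o => ∀ r, o = some r → Valid (R.map Prod.fst) Cl (l + 1) r) ?_ (by simp) ?_).mono
      le_rfl (by simp) fun _ h => h
    · rintro l' hl' L hL
      obtain rfl : l = l' := by omega
      have := branch_valid (Γ := Γ) (near := near) (Q := Q) (w := w) (K := K) hm ht hG hD hM (l := l)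
        (R := R.map fun p => (p.1, some p.2)) (Cl := Cl) (by simpa using hR₀)
        (fun c => by
          have := ihl (update (oracles C Γ near G Q D) c (R.map fun p => (p.1, some p.2)))
            (c :: Cl) (by simp) (hkeys.update c)
          rwa [map_fst_update, length_update] at this) hL
      rwa [List.length_map, map_fst_some] at this
    · rintro - r o hr ho
      rcases pick_cases (((R.filter fun p => p.2 ≤ approxMedian (R.map Prod.snd)).map
        Prod.snd).sum + r.1, r.2) o with e | e
      · rw [e]; exact Valid.prune hCl hR hr
      · exact ho _ e

end Search

/-! ### Clusters of a fixed assignment -/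

section Clusters

variable {X β : Type*}

open Classical in
/-- The points of a list that `a` assigns to `o`. -/
noncomputable def cluster (a : X → X) (o : X) (R : List (X × β)) : Finset X :=
  (R.map Prod.fst).toFinset.filter fun x => a x = o

open Classical in
theorem badNum_eq_card {bad : X → Prop} {R : List (X × β)} (hR : (R.map Prod.fst).Nodup) :
    badNum bad R = ((R.map Prod.fst).toFinset.filter fun x => bad x).card := by
  have e : (R.map Prod.fst).toFinset.filter (fun x => bad x) =
      ((R.map Prod.fst).filter fun x => bad x).toFinset := by
    ext; simp
  rw [e, List.toFinset_card_of_nodup (hR.filter _), ← List.countP_eq_length_filter,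
    List.countP_map]
  simp [badNum, Function.comp_def]

open Classical in
theorem totalSum_eq_sum {bad : X → Prop} {wt b : X → ℝ} {R : List (X × β)}
    (hR : (R.map Prod.fst).Nodup) :
    totalSum bad wt b R = ∑ x ∈ (R.map Prod.fst).toFinset, if bad x then b x else wt x := by
  rw [List.sum_toFinset _ hR, List.map_map]
  rfl

/-- If no cluster is large, then there are few points in all the clusters of `U`. -/
theorem exists_large_cluster (a : X → X) (U : Finset X) {R : List (X × β)}
    (hR : (R.map Prod.fst).Nodup) (W : ℕ) :
    (∃ o ∈ U, R.length ≤ W * (cluster a o R).card) ∨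
      W * badNum (fun x => a x ∈ U) R ≤ U.card * R.length := by
  classical
  by_cases h : ∃ o ∈ U, R.length ≤ W * (cluster a o R).card
  · exact Or.inl h
  · right
    push Not at h
    have e := Finset.card_eq_sum_card_fiberwise (f := a)
      (s := (R.map Prod.fst).toFinset.filter fun x => a x ∈ U) (t := U)
      (fun x hx => (Finset.mem_filter.1 hx).2)
    have e' : badNum (fun x => a x ∈ U) R = ∑ o ∈ U,
        (((R.map Prod.fst).toFinset.filter fun x => a x ∈ U).filter fun x => a x = o).card := by
      rw [badNum_eq_card hR, ← e]
      congr
    rw [e', Finset.mul_sum]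
    refine (Finset.sum_le_card_nsmul U _ R.length fun o ho => ?_).trans_eq (by simp)
    refine le_trans (Nat.mul_le_mul_left _ (Finset.card_le_card ?_)) (h o ho).le
    intro x hx
    simp only [Finset.mem_filter, cluster] at hx ⊢
    exact ⟨hx.1.1, hx.2⟩

open Classical in
/-- A good center for the cluster of `o` does not increase the weight. -/
theorem totalSum_erase_le {a : X → X} {U : Finset X} {o : X} (ho : o ∈ U) {wt b f : X → ℝ}
    {R : List (X × β)} (hR : (R.map Prod.fst).Nodup)
    (h : ∑ x ∈ cluster a o R, f x ≤ ∑ x ∈ cluster a o R, b x) :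
    totalSum (fun x => a x ∈ U.erase o) (fun x => if a x = o then f x else wt x) b R ≤
      totalSum (fun x => a x ∈ U) wt b R := by
  rw [totalSum_eq_sum hR, totalSum_eq_sum hR]
  conv_lhs => rw [← Finset.sum_filter_add_sum_filter_not _ (a · = o)]
  conv_rhs => rw [← Finset.sum_filter_add_sum_filter_not _ (a · = o)]
  refine add_le_add (le_trans (le_of_eq ?_) (h.trans (le_of_eq ?_))) (le_of_eq ?_)
  · refine Finset.sum_congr rfl fun x hx => ?_
    simp [(Finset.mem_filter.1 hx).2]
  · refine Finset.sum_congr rfl fun x hx => ?_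
    simp [(Finset.mem_filter.1 hx).2, ho]
  · refine Finset.sum_congr rfl fun x hx => ?_
    simp [(Finset.mem_filter.1 hx).2]

end Clusters

/-! ### Approximation guarantee of the search -/

section Search

variable {X : Type*} [PseudoMetricSpace X] {C : Set X} {m w K t G Q D : ℕ}
  {Γ : (Fin m → X) → Finset C} {near : X → C}

/-- The search finds a cheap solution on `R`, except with probability `l * η`. Here `a` assigns
points to centers, the clusters of the centers in `U` have not been found yet, and `wt` is the
weight of the points in the other clusters. -/
def SearchGood (Γ : (Fin m → X) → Finset C) (near : X → C) (w K t G Q D M : ℕ) (a : X → X)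
    (ε ρ : ℝ) (η : ℝ≥0∞) (l : ℕ) : Prop :=
  ∀ (R : List (X × ℝ)) (Cl : List C) (U : Finset X) (wt : X → ℝ) (μ : ℝ), Cl ≠ [] →
    (∀ p ∈ R, Metric.infDist p.1 (centers Cl) ≤ p.2) → (R.map Prod.fst).Nodup →
    (∀ o ∈ U, o ∈ C) → U.card ≤ l → (∀ p ∈ R, a p.1 ∉ U → p.2 ≤ wt p.1) →
    IsLevel (fun x => a x ∈ U) R μ →
    Guarantees (oracles C Γ near G Q D) m w K 16 (searchInput M l R Cl)
      (searchTime m t G (Q + D) M l R.length) (l * η)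
      fun v => ∃ r, v = encRes r ∧ Valid (R.map Prod.fst) Cl l r ∧ r.1 ≤
        (1 + 96 * ρ * l) * totalSum (fun x => a x ∈ U) wt (fun x => (1 + ε) * dist x (a x)) R +
          96 * ρ * (goodSum (fun x => a x ∈ U) wt R - 1 / 16 * R.length * μ)

/-- With the good candidate `c`, the cluster of `o` turns good with weight `dist x c`, which in
total does not exceed its former weight `(1 + ε) * dist x o`. The level restarts at zero, and
`goodSum ≤ totalSum` turns the potential into one more `96 * ρ` in the factor. -/
theorem branch_good_of_searchGood (hm : 0 < m) (ht : 0 < t) (hG : 0 < G) (hD : 0 < D)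
    (hΓ : ∀ S, (Γ S).card ≤ t) {M : ℕ} (hM : 0 < M) {a : X → X}
    {ε ρ : ℝ} (hε : 0 ≤ ε) (hρ : 0 ≤ ρ) {η : ℝ≥0∞} {l : ℕ}
    (ih : SearchGood Γ near w K t G Q D M a ε ρ η l)
    {R : List (X × Option ℝ)} (hR₀ : R ≠ []) (hR : (R.map Prod.fst).Nodup) {Cl : List C}
    (hkeys : KeysValid R Cl) {U : Finset X} (hU : ∀ o ∈ U, o ∈ C) (hUl : U.card ≤ l + 1)
    {wt : X → ℝ} (hwt : ∀ p ∈ R, a p.1 ∉ U → ∃ y, p.2 = some y ∧ y ≤ wt p.1) {o : X} (ho : o ∈ U)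
    {L : List C} (hL : L.length ≤ M * t)
    (hc : ∃ c ∈ L, ∑ x ∈ cluster a o R, dist x (c : X) ≤
      (1 + ε) * ∑ x ∈ cluster a o R, dist x o) :
    Guarantees (oracles C Γ near G Q D) m w K 17 (branchInput L M l R Cl)
      (timeFactor m t G M ^ (l + 1) * ((m * t * G * M) * ((Q + D) * R.length)) +
        400 * ((m * t * G * M) * ((Q + D) * R.length))) (l * η)
      fun v => ∃ o, v = encOptRes o ∧
        ∃ r, o = some r ∧ Valid (R.map Prod.fst) Cl (l + 1) r ∧ r.1 ≤
          (1 + 96 * ρ * (l + 1)) *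
            totalSum (fun x => a x ∈ U) wt (fun x => (1 + ε) * dist x (a x)) R := by
  classical
  set O := oracles C Γ near G Q D with hO
  refine branch_valid_le hm ht hG hD hM hR₀ (fun c => ?_) hL ?_
  · have := search_safe (Γ := Γ) (near := near) (w := w) (K := K) (Q := Q) hm ht hG hD hΓ hM l
      (update O c R) (c :: Cl) (by simp) (hkeys.update c)
    rwa [map_fst_update, length_update] at this
  · obtain ⟨c, hcL, hc⟩ := hc
    refine ⟨c, hcL, ?_⟩
    have hnonneg : ∀ p ∈ update O c R, 0 ≤ p.2 :=
      fun p hp => Metric.infDist_nonneg.trans (hkeys.update c p hp)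
    have h := ih (update O c R) (c :: Cl) (U.erase o)
      (fun x => if a x = o then dist x (c : X) else wt x) 0 (by simp) (hkeys.update c)
      (by rwa [map_fst_update]) (fun o' ho' => hU o' (Finset.mem_of_mem_erase ho'))
      (by rw [Finset.card_erase_of_mem ho]; omega) ?_ ⟨le_rfl, hnonneg, Or.inl rfl⟩
    · rw [map_fst_update, length_update] at h
      refine h.mono le_rfl le_rfl ?_
      rintro _ ⟨r, rfl, hr, hr'⟩
      refine ⟨r, rfl, hr, hr'.trans ?_⟩
      have h1 := goodSum_le_totalSum (bad := fun x => a x ∈ U.erase o)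
        (wt := fun x => if a x = o then dist x (c : X) else wt x)
        (b := fun x => (1 + ε) * dist x (a x)) (fun x => by positivity) (update O c R)
      have h2 : totalSum (fun x => a x ∈ U.erase o)
          (fun x => if a x = o then dist x (c : X) else wt x)
          (fun x => (1 + ε) * dist x (a x)) (update O c R) ≤
          totalSum (fun x => a x ∈ U) wt (fun x => (1 + ε) * dist x (a x)) R := by
        refine le_trans (le_of_eq ?_) (totalSum_erase_le (f := fun x => dist x (c : X)) ho hR ?_)
        · simp [totalSum, update, Function.comp_def]
        · refine hc.trans (le_of_eq ?_)
          rw [Finset.mul_sum]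
          refine Finset.sum_congr rfl fun x hx => ?_
          simp only [cluster, Finset.mem_filter] at hx
          rw [hx.2]
      have h3 : (0 : ℝ) ≤ 96 * ρ := by positivity
      calc _ ≤ (1 + 96 * ρ * l) * totalSum (fun x => a x ∈ U.erase o)
              (fun x => if a x = o then dist x (c : X) else wt x)
              (fun x => (1 + ε) * dist x (a x)) (update O c R) + 96 * ρ * totalSum
              (fun x => a x ∈ U.erase o) (fun x => if a x = o then dist x (c : X) else wt x)
              (fun x => (1 + ε) * dist x (a x)) (update O c R) := by
            rw [mul_zero, sub_zero]
            gcongr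
        _ = (1 + 96 * ρ * (l + 1)) * totalSum (fun x => a x ∈ U.erase o)
              (fun x => if a x = o then dist x (c : X) else wt x)
              (fun x => (1 + ε) * dist x (a x)) (update O c R) := by ring
        _ ≤ _ := by gcongr
    · intro p hp hpU
      obtain ⟨⟨x, y⟩, hq, rfl⟩ := List.mem_map.1 hp
      have hd : ∀ y, newKey (O.dst x c) y ≤ dist x (c : X) := by
        rintro (_ | y)
        · exact le_rfl
        · exact min_le_left _ _
      by_cases hx : a x = o
      · simpa [hx] using hd y
      · simp only [hx, if_false]
        obtain ⟨z, hz, hz'⟩ := hwt _ hq (by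
          simp only [Finset.mem_erase, not_and] at hpU
          exact hpU hx)
        simp only at hz hz'
        subst hz
        exact (min_le_right _ _).trans hz'

theorem coll_cluster {ε δ : ℝ} (hΓ : WeakSampling C ε δ m t Γ) (hδ : δ < 1) {W M : ℕ} {η : ℝ≥0∞}
    (hη : ENNReal.ofReal (1 - (1 - δ) / W ^ m) ^ M ≤ η) {R : List (X × Option ℝ)} (hR₀ : R ≠ [])
    {a : X → X} {o : X} (ho : o ∈ C) (hW : R.length ≤ W * (cluster a o R).card) :
    Guarantees (oracles C Γ near G Q D) m w K 5 (sampleInput M R)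
      (collTime (oracles C Γ near G Q D) m t R.length M) η
      fun v => ∃ L, v = encCtrs L ∧ L.length ≤ M * t ∧
        ∃ c ∈ L, ∑ x ∈ cluster a o R, dist x (c : X) ≤ (1 + ε) * ∑ x ∈ cluster a o R, dist x o := by
  have hpos := List.length_pos_of_ne_nil hR₀
  have hP₀ : (cluster a o R).Nonempty := by
    rw [← Finset.card_pos]
    by_contra h
    simp only [not_lt, nonpos_iff_eq_zero] at h
    rw [h] at hW
    omega
  have h := badCount_weakSampling hΓ hδ (near := near) (Gt := G) (Q := Q) (D := D)
    (xs := R.map Prod.fst) (by simpa using hR₀) (cluster a o R) hP₀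
    (fun x hx => by classical exact List.mem_toFinset.1 (Finset.mem_filter.1 hx).1)
    (by simpa using hW) ho
  rw [List.length_map] at h
  exact (coll_good hR₀ (length_cand_le hΓ.1) h M).mono le_rfl hη fun _ h => h

-- The last clause of `IsLevel` serves this purpose: at a nonzero level half of the entries are good
-- with keys at least `μ`, so the potential is nonnegative and may be discarded when a new center is
-- added.
omit [PseudoMetricSpace X] in
theorem goodSum_level_nonneg {bad : X → Prop} {wt : X → ℝ} {R : List (X × ℝ)} {μ : ℝ}
    (h₀ : ∀ p ∈ R, 0 ≤ p.2) (hw : ∀ p ∈ R, ¬ bad p.1 → p.2 ≤ wt p.1) (hμ : IsLevel bad R μ) :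
    0 ≤ goodSum bad wt R - 1 / 16 * R.length * μ := by
  obtain ⟨hμ₀, hμ₁, hμ₂⟩ := hμ
  have h := goodSum_ge (ν := μ) h₀ hw
  have hall : R.countP (fun p => μ ≤ p.2) = R.length :=
    List.countP_eq_length.2 fun p hp => by simpa using hμ₁ p hp
  rw [hall] at h
  rcases hμ₂ with rfl | hμ₂
  · simpa using h
  · have h2 : (2 : ℝ) * badNum bad R ≤ R.length := by exact_mod_cast hμ₂
    have h3 : (1 / 16 * R.length : ℝ) * μ ≤ ((R.length : ℝ) - badNum bad R) * μ :=
      mul_le_mul_of_nonneg_right (by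
        have : (0 : ℝ) ≤ R.length := Nat.cast_nonneg _
        linarith) hμ₀
    linarith

theorem branch_valid_search (hm : 0 < m) (ht : 0 < t) (hG : 0 < G) (hD : 0 < D)
    (hΓ : ∀ S, (Γ S).card ≤ t) {M : ℕ} (hM : 0 < M) {l : ℕ} {R : List (X × Option ℝ)} {Cl : List C}
    (hR₀ : R ≠ []) (hkeys : KeysValid R Cl) {L : List C} (hL : L.length ≤ M * t) :
    Guarantees (oracles C Γ near G Q D) m w K 17 (branchInput L M l R Cl)
      (timeFactor m t G M ^ (l + 1) * ((m * t * G * M) * ((Q + D) * R.length)) +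
        400 * ((m * t * G * M) * ((Q + D) * R.length))) 0
      fun v => ∃ o, v = encOptRes o ∧ ∀ r, o = some r → Valid (R.map Prod.fst) Cl (l + 1) r :=
  branch_valid hm ht hG hD hM hR₀ (fun c => by
    have := search_safe (Γ := Γ) (near := near) (w := w) (K := K) (Q := Q) hm ht hG hD hΓ hM l
      (update (oracles C Γ near G Q D) c R) (c :: Cl) (by simp) (hkeys.update c)
    rwa [map_fst_update, length_update] at this) hL

theorem searchGood_step {ε δ : ℝ} (hΓ : WeakSampling C ε δ m t Γ) (hε : 0 ≤ ε) (hδ : δ < 1)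
    (hm : 0 < m) (ht : 0 < t) (hG : 0 < G) (hD : 0 < D) {W M : ℕ} (hM : 0 < M) {η : ℝ≥0∞}
    (hη : ENNReal.ofReal (1 - (1 - δ) / W ^ m) ^ M ≤ η) (a : X → X) {ρ : ℝ} (hρ : 0 ≤ ρ)
    (hρ' : ρ ≤ 1 / 32) (hW : 0 < W) {l : ℕ} (hl : (l : ℝ) ≤ ρ * W)
    (ih : ∀ l', l = l' + 1 → SearchGood Γ near w K t G Q D M a ε ρ η l') :
    SearchGood Γ near w K t G Q D M a ε ρ η l := by
  classical
  intro R Cl U wt μ hCl hR hnd hU hUl hwt hμ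
  induction hn : R.length using Nat.strong_induction_on generalizing R μ with
  | _ n ihR =>
  subst hn
  by_cases hR₀ : R = []
  · subst hR₀
    refine (search_nil M l Cl).mono (by simp [searchTime]) (by simp) ?_
    rintro _ rfl
    exact ⟨_, rfl, by simp [Valid, hCl], by simp [totalSum, goodSum]⟩
  have hn : 0 < R.length := List.length_pos_of_ne_nil hR₀
  set θ := approxMedian (R.map Prod.snd) with hθ
  have hlen := length_prune hR₀ hθ
  have hnonneg : ∀ p ∈ R, 0 ≤ p.2 := fun p hp => Metric.infDist_nonneg.trans (hR p hp)
  have hRH : ∀ p ∈ R.filter (fun p => ¬ p.2 ≤ θ), Metric.infDist p.1 (centers Cl) ≤ p.2 :=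
    fun p hp => hR p (List.mem_of_mem_filter hp)
  have hkeys := keysValid_some hCl hR
  have hR₀' : (R.map fun p => (p.1, some p.2)) ≠ [] := by simpa using hR₀
  -- With a large cluster the branching carries the bound, at the price of one `η`, and the pruned
  -- search merely has to be valid. With few bad points the roles are exchanged and no sample
  -- matters.
  rcases exists_large_cluster a U hnd W with ⟨o, ho, hlarge⟩ | hfew
  · obtain ⟨l, rfl⟩ : ∃ l', l = l' + 1 :=
      ⟨l - 1, by have := Finset.card_pos.2 ⟨o, ho⟩; omega⟩
    have hcl : cluster a o (R.map fun p => (p.1, some p.2)) = cluster a o R := by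
      simp [cluster, Function.comp_def]
    have hc := coll_cluster (near := near) (w := w) (K := K) (G := G) (Q := Q) (D := D) (M := M) hΓ
      hδ hη hR₀' (hU o ho) (a := a) (by rw [hcl, List.length_map]; exact hlarge)
    rw [List.length_map] at hc
    have hs := search_safe (Γ := Γ) (near := near) (w := w) (K := K) (Q := Q) hm ht hG hD hΓ.1 hM
      (l + 1) (R.filter fun p => ¬ p.2 ≤ θ) Cl hCl hRH
    refine (search_recursion hm ht hG hD hM hR₀ hθ hs hc (ηb := l * η)
      (Gb := fun o => ∃ r, o = some r ∧ Valid (R.map Prod.fst) Cl (l + 1) r ∧ r.1 ≤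
        (1 + 96 * ρ * (l + 1)) *
          totalSum (fun x => a x ∈ U) wt (fun x => (1 + ε) * dist x (a x)) R)
      ?_ (by simp) ?_).mono le_rfl (by push_cast; rw [zero_add, add_mul, one_mul, add_comm])
        fun _ h => h
    · rintro l' hl' L ⟨hL, hLc⟩
      obtain rfl : l = l' := by omega
      have := branch_good_of_searchGood (Q := Q) hm ht hG hD hΓ.1 hM hε hρ (ih l rfl) hR₀'
        (by rwa [map_fst_some]) hkeys hU hUl (wt := wt) ?_ ho hL hLc
      · rw [List.length_map, map_fst_some] at this
        simpa [totalSum, Function.comp_def] using this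
      · intro p hp hpU
        obtain ⟨q, hq, rfl⟩ := List.mem_map.1 hp
        exact ⟨q.2, rfl, hwt q hq hpU⟩
    · rintro - r _ hr ⟨r', rfl, hr', hb⟩
      refine ⟨?_, ?_⟩
      · rcases pick_cases (((R.filter fun p => p.2 ≤ θ).map Prod.snd).sum + r.1, r.2)
          (some r') with e | e
        · rw [e]; exact Valid.prune hCl hR hr
        · rw [← Option.some_injective _ e]; exact hr'
      · refine (pick_fst_le_right _ r').trans (hb.trans ?_)
        have h := goodSum_level_nonneg hnonneg hwt hμ
        have h' : 0 ≤ 96 * ρ * (goodSum (fun x => a x ∈ U) wt R - 1 / 16 * R.length * μ) := by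
          positivity
        push_cast
        linarith
  · have hbad : (badNum (fun x => a x ∈ U) R : ℝ) ≤ ρ * R.length := by
      have h1 : (W : ℝ) * badNum (fun x => a x ∈ U) R ≤ U.card * R.length := by
        exact_mod_cast hfew
      have h2 : (U.card : ℝ) ≤ ρ * W := le_trans (by exact_mod_cast hUl) hl
      have h3 : (U.card : ℝ) * R.length ≤ ρ * W * R.length :=
        mul_le_mul_of_nonneg_right h2 (Nat.cast_nonneg _)
      have hW' : (0 : ℝ) < W := by exact_mod_cast hW
      refine le_of_mul_le_mul_left (h1.trans (h3.trans_eq ?_)) hW'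
      ring
    obtain ⟨μ', hμ', hbound⟩ := exists_level_prune (b := fun x => (1 + ε) * dist x (a x)) hR₀
      (fun x => by positivity) hnonneg hwt hθ hρ hρ' (s := 96 * ρ * l) (by positivity) hbad
      hμ.1 hμ.2.1
    have hs := ihR _ (by omega) (R.filter fun p => ¬ p.2 ≤ θ) μ' hRH
      (hnd.sublist (List.filter_sublist.map _)) (fun p hp => hwt p (List.mem_of_mem_filter hp))
      hμ' rfl
    have hc := coll_safe (O := oracles C Γ near G Q D) (m := m) (w := w) (K := K) hR₀'
      (length_cand_le hΓ.1) M
    rw [List.length_map] at hc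
    refine (search_recursion hm ht hG hD hM hR₀ hθ hs hc (ηb := 0)
      (Gb := fun o => ∀ r, o = some r → Valid (R.map Prod.fst) Cl l r) ?_ ?_ ?_).mono le_rfl
        (by simp) fun _ h => h
    · rintro l' rfl L hL
      have := branch_valid_search (near := near) (Q := Q) (w := w) (K := K) hm ht hG hD hΓ.1 hM
        (l := l') hR₀' hkeys hL
      rwa [List.length_map, map_fst_some] at this
    · rintro - r ⟨hr, hr'⟩
      exact ⟨Valid.prune hCl hR hr, hbound _ hr'⟩
    · rintro - r o ⟨hr, hr'⟩ ho
      refine ⟨?_, (pick_fst_le_left _ o).trans (hbound _ hr')⟩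
      rcases pick_cases (((R.filter fun p => p.2 ≤ θ).map Prod.snd).sum + r.1, r.2) o with e | e
      · rw [e]; exact Valid.prune hCl hR hr
      · exact ho _ e

theorem searchGood {ε δ : ℝ} (hΓ : WeakSampling C ε δ m t Γ) (hε : 0 ≤ ε) (hδ : δ < 1)
    (hm : 0 < m) (ht : 0 < t) (hG : 0 < G) (hD : 0 < D) {W M : ℕ} (hM : 0 < M) {η : ℝ≥0∞}
    (hη : ENNReal.ofReal (1 - (1 - δ) / W ^ m) ^ M ≤ η) (a : X → X) {ρ : ℝ} (hρ : 0 ≤ ρ)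
    (hρ' : ρ ≤ 1 / 32) (hW : 0 < W) {l : ℕ} (hl : (l : ℝ) ≤ ρ * W) :
    SearchGood Γ near w K t G Q D M a ε ρ η l := by
  induction l with
  | zero => exact searchGood_step hΓ hε hδ hm ht hG hD hM hη a hρ hρ' hW hl (by simp)
  | succ l ih =>
    refine searchGood_step hΓ hε hδ hm ht hG hD hM hη a hρ hρ' hW hl fun l' hl' => ?_
    obtain rfl : l = l' := by omega
    exact ih (le_trans (by push_cast; linarith) hl)

end Search

/-! ## The main theorem -/

/-! ### Limits of events, and success probabilities -/

section Limit

variable {α : Type*}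

/-- The failure events increase, so their union has the limit of their probabilities; a union bound
over infinitely many events would be useless. -/
theorem Outcome.Ensures.forall_of_antitone {p : Outcome α} {T : ℕ} {η : ℝ≥0∞} {G : ℕ → α → Prop}
    (hG : ∀ j a, G (j + 1) a → G j a) (h : ∀ j, Ensures p T η (G j)) :
    Ensures p T η fun a => ∀ j, G j a := by
  let _ : MeasurableSpace (Option (α × ℕ)) := ⊤
  have hE : (Event T fun a => ∀ j, G j a)ᶜ = ⋃ j, (Event T (G j))ᶜ := by
    rw [← Set.compl_iInter]
    congr 1
    ext r
    simp only [Set.mem_iInter]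
    constructor
    · rintro ⟨a, τ, rfl, h1, h2⟩ j
      exact ⟨a, τ, rfl, h1, h2 j⟩
    · intro hr
      obtain ⟨a, τ, rfl, h1, -⟩ := hr 0
      refine ⟨a, τ, rfl, h1, fun j => ?_⟩
      obtain ⟨a', τ', h2, -, h3⟩ := hr j
      simp only [Option.some.injEq, Prod.mk.injEq] at h2
      rw [h2.1]; exact h3
  have hmono : Monotone fun j => (Event T (G j))ᶜ := by
    refine monotone_nat_of_le_succ fun j => Set.compl_subset_compl.2 ?_
    rintro _ ⟨a, τ, rfl, h1, h2⟩
    exact ⟨a, τ, rfl, h1, hG j a h2⟩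
  rw [Ensures, hE, ← PMF.toMeasure_apply_eq_toOuterMeasure_apply _ MeasurableSpace.measurableSet_top, hmono.measure_iUnion]
  refine iSup_le fun j => ?_
  rw [PMF.toMeasure_apply_eq_toOuterMeasure_apply _ MeasurableSpace.measurableSet_top]
  exact h j

theorem Outcome.Ensures.le_toReal {p : Outcome α} {T : ℕ} {δ : ℝ} {G : α → Prop} (hδ : 0 ≤ δ)
    (h : Ensures p T (ENNReal.ofReal δ) G) :
    1 - δ ≤ (p.toOuterMeasure {r | ∃ a τ, r = some (a, τ) ∧ G a}).toReal := by
  set E := {r | ∃ a τ, r = some (a, τ) ∧ G a}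
  have h1 : (1 : ℝ≥0∞) ≤ p.toOuterMeasure E + p.toOuterMeasure (Event T G)ᶜ := by
    have hu : p.toOuterMeasure Set.univ = 1 := by
      rw [PMF.toOuterMeasure_apply_eq_one_iff]; exact Set.subset_univ _
    rw [← hu]
    refine le_trans (p.toOuterMeasure.mono ?_)
      (MeasureTheory.measure_union_le (μ := p.toOuterMeasure) E (Event T G)ᶜ)
    intro r _
    by_cases hr : r ∈ Event T G
    · obtain ⟨a, τ, h1, -, h2⟩ := hr
      exact Or.inl ⟨a, τ, h1, h2⟩
    · exact Or.inr hr
  have hfin : p.toOuterMeasure E ≠ ⊤ := ((prob_le_one p E).trans_lt ENNReal.one_lt_top).ne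
  have h2 := h1.trans (add_le_add le_rfl h)
  have h3 := ENNReal.toReal_mono (ENNReal.add_ne_top.2 ⟨hfin, ENNReal.ofReal_ne_top⟩) h2
  rw [ENNReal.toReal_add hfin ENNReal.ofReal_ne_top, ENNReal.toReal_ofReal hδ,
    ENNReal.toReal_one] at h3
  linarith

end Limit

/-! ### The whole computation -/

section Main

variable {X : Type*} [PseudoMetricSpace X] {C : Set X} {m w K t G Q D : ℕ}
  {Γ : (Fin m → X) → Finset C} {near : X → C}

/-- Time for the whole computation. -/
theorem mainTime_le {k M n W : ℕ} (hm : 0 < m) (ht : 0 < t) (hG : 0 < G) (hM : 0 < M) (hD : 0 < D)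
    (hn : 0 < n) (hk : 0 < k) (hWM : W ≤ M) (hkM : k ≤ M) :
    collTime (oracles C Γ near G Q D) m t n M +
      (timeFactor m t G M ^ (k - 1 + 1) * ((m * t * G * M) * ((Q + D) * n)) +
        400 * ((m * t * G * M) * ((Q + D) * n))) + 40 * n + ((20 * W + 60) * m + 60 * k) + 300 ≤
      timeFactor m t G M ^ (k + 1) * ((Q + D) * n) := by
  have h0 := collTime_le (C := C) (Γ := Γ) (near := near) (Q := Q) hm ht hG hM hD hn
  have hU : 0 < Q + D := by omega
  set U := Q + D with hUdef
  have hY₀ : 0 < timeFactor m t G M := by simp only [timeFactor]; positivity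
  rw [Nat.sub_add_cancel hk, pow_succ]
  set Y := timeFactor m t G M ^ k with hY
  have hY1 : 0 < Y := pow_pos hY₀ k
  simp only [timeFactor]
  set Z := m * t * G * M * (U * n) with hZ
  have h1 : n ≤ Z := by
    rw [hZ, show m * t * G * M * (U * n) = n * (m * t * G * M * U) by ring]
    exact Nat.le_mul_of_pos_right _ (by positivity)
  have h2 : M * m ≤ Z := by
    rw [hZ, show m * t * G * M * (U * n) = M * m * (t * G * U * n) by ring]
    exact Nat.le_mul_of_pos_right _ (by positivity)
  have h3 : M ≤ M * m := Nat.le_mul_of_pos_right _ hm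
  have h4 : W * m ≤ M * m := Nat.mul_le_mul_right _ hWM
  have h5 : Z ≤ Y * Z := Nat.le_mul_of_pos_left _ hY1
  have h6 : Y * (16000 * (m * t * G * M)) * (U * n) = 16000 * (Y * Z) := by rw [hZ]; ring
  have h7 : (20 * W + 60) * m = 20 * (W * m) + 60 * m := by ring
  have h8 : m ≤ M * m := Nat.le_mul_of_pos_left _ hM
  rw [h6, h7]
  omega

omit [PseudoMetricSpace X] in
theorem encard_centers_le (cs : List C) : (centers cs).encard ≤ cs.length := by
  classical
  have e : centers cs = ((cs.map Subtype.val).toFinset : Set X) := by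
    ext x; simp [centers]
  rw [e, Set.encard_coe_eq_coe_finsetCard]
  exact_mod_cast (List.toFinset_card_le _).trans (by simp)

omit [PseudoMetricSpace X] in
theorem sum_list_eq {l : List X} {P : Finset X} (hl : (l : Multiset X) = P.val) (f : X → ℝ) :
    (l.map f).sum = ∑ x ∈ P, f x := by
  rw [Finset.sum, ← hl]; simp

/-- A valid result is a feasible solution. -/
theorem Valid.isCenterSet {xs : List X} {k : ℕ} {r : ℝ × List C} (h : Valid xs [] k r) :
    IsCenterSet C k (centers r.2) := by
  refine ⟨?_, ?_, ?_⟩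
  · rintro _ ⟨c, -, rfl⟩
    exact c.2
  · obtain ⟨c, hc⟩ := List.exists_mem_of_ne_nil _ h.2.2.2
    exact ⟨c, c, hc, rfl⟩
  · have := h.2.1
    simp only [List.length_nil, zero_add] at this
    exact (encard_centers_le r.2).trans (by exact_mod_cast this)

/-- Every set of centers assigns a nearest center to each point. -/
theorem IsCenterSet.exists_assignment {k : ℕ} {s : Set X} (hs : IsCenterSet C k s) :
    ∃ (U : Finset X) (a : X → X), (∀ o ∈ U, o ∈ C) ∧ U.card ≤ k ∧ (∀ x, a x ∈ U) ∧
      ∀ x, dist x (a x) = Metric.infDist x s := by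
  classical
  obtain ⟨h1, h2, h3⟩ := hs
  have hfin : s.Finite := Set.finite_of_encard_le_coe h3
  have h : ∀ x, ∃ o ∈ s, ∀ o' ∈ s, dist x o ≤ dist x o' := fun x =>
    Set.exists_min_image s (dist x) hfin h2
  choose a ha ha' using h
  refine ⟨hfin.toFinset, a, fun o ho => h1 (hfin.mem_toFinset.1 ho), ?_,
    fun x => hfin.mem_toFinset.2 (ha x), fun x => ?_⟩
  · rw [hfin.encard_eq_coe_toFinset_card] at h3
    exact_mod_cast h3
  · exact le_antisymm ((Metric.le_infDist h2).2 fun o ho => ha' x o ho)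
      (Metric.infDist_le_dist_of_mem (ha x))

theorem keysValid_none (l : List X) :
    KeysValid (C := C) (l.map fun x => (x, none)) [] := by
  intro p hp y hy
  obtain ⟨x, -, rfl⟩ := List.mem_map.1 hp
  simp at hy

omit [PseudoMetricSpace X] in
theorem map_fst_none (l : List X) :
    (l.map fun x => ((x, none) : X × Option ℝ)).map Prod.fst = l := by
  simp [Function.comp_def]

/-- The whole computation, in terms of what is known about the search. -/
theorem main_of_branch (hm : 0 < m) (ht : 0 < t) (hG : 0 < G) (hD : 0 < D) {k M : ℕ} (hk : 0 < k)
    (hw : 0 < w) (hK : 0 < K) (hM : M = (k * (k * w)) ^ m * (k * K)) {l : List X} (hl : l ≠ [])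
    {ηc ηb : ℝ≥0∞} {Gc : List C → Prop} {Gb : Option (ℝ × List C) → Prop} {G₀ : Val X C → Prop}
    (hc : Guarantees (oracles C Γ near G Q D) m w K 5 (sampleInput M (l.map fun x => (x, none)))
      (collTime (oracles C Γ near G Q D) m t l.length M) ηc
      fun v => ∃ L, v = encCtrs L ∧ Gc L)
    (hb : ∀ L, Gc L → Guarantees (oracles C Γ near G Q D) m w K 17
      (branchInput L M (k - 1) (l.map fun x => (x, none)) [])
      (timeFactor m t G M ^ (k - 1 + 1) * ((m * t * G * M) * ((Q + D) * l.length)) +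
        400 * ((m * t * G * M) * ((Q + D) * l.length))) ηb
        fun v => ∃ o, v = encOptRes o ∧ Gb o)
    (hG₀ : Gb none → G₀ .nil) (hG₁ : ∀ r, Gb (some r) → G₀ (encCtrs r.2)) :
    Guarantees (oracles C Γ near G Q D) m w K 0 (.pair (.nat k) (.ofList (l.map .pt)))
      (timeFactor m t G M ^ (k + 1) * ((Q + D) * l.length)) (ηc + ηb) G₀ := by
  have hM₀ : 0 < M := by rw [hM]; positivity
  refine (main_step hM hc hb hG₀ hG₁).mono (mainTime_le hm ht hG hM₀ hD
    (List.length_pos_of_ne_nil hl) hk ?_ ?_) le_rfl fun _ h => h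
  · rw [hM]
    refine le_trans ?_ (Nat.le_mul_of_pos_right _ (by positivity))
    exact Nat.le_self_pow hm.ne' _
  · rw [hM, show (k * (k * w)) ^ m * (k * K) = k * (K * (k * (k * w)) ^ m) by ring]
    exact Nat.le_mul_of_pos_right _ (by positivity)

theorem main_halts (hm : 0 < m) (ht : 0 < t) (hG : 0 < G) (hD : 0 < D)
    (hΓ : ∀ S, (Γ S).card ≤ t) {k M : ℕ} (hk : 0 < k) (hw : 0 < w) (hK : 0 < K)
    (hM : M = (k * (k * w)) ^ m * (k * K)) {l : List X} (hl : l ≠ []) :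
    Guarantees (oracles C Γ near G Q D) m w K 0 (.pair (.nat k) (.ofList (l.map .pt)))
      (timeFactor m t G M ^ (k + 1) * ((Q + D) * l.length)) 0 fun _ => True := by
  have hM₀ : 0 < M := by rw [hM]; positivity
  have hR₀ : (l.map fun x => ((x, none) : X × Option ℝ)) ≠ [] := by simpa using hl
  have hc := coll_safe (O := oracles C Γ near G Q D) (m := m) (w := w) (K := K) hR₀
    (length_cand_le hΓ) M
  rw [List.length_map] at hc
  refine (main_of_branch hm ht hG hD hk hw hK hM hl hc (ηb := 0) (Gb := fun _ => True)
    (fun L hL => ?_) (fun _ => trivial) (fun _ _ => trivial)).mono le_rfl (by simp) fun _ h => h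
  have := branch_valid_search (near := near) (w := w) (K := K) (Q := Q) hm ht hG hD hΓ hM₀
    (l := k - 1) hR₀ (keysValid_none l) hL
  rw [List.length_map] at this
  refine this.mono le_rfl le_rfl ?_
  rintro _ ⟨o, rfl, -⟩
  exact ⟨o, rfl, trivial⟩

/-- Comparison of the output with a fixed solution `s`. -/
theorem main_good {ε δ : ℝ} (hΓ : WeakSampling C ε δ m t Γ) (hε : 0 ≤ ε) (hδ : δ < 1)
    (hm : 0 < m) (ht : 0 < t) (hG : 0 < G) (hD : 0 < D) {k M : ℕ} (hk : 0 < k) (hw : 96 ≤ w)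
    (hK : 0 < K) (hM : M = (k * (k * w)) ^ m * (k * K)) (hwε : 96 ≤ ε * w) {l : List X} (hl : l ≠ [])
    {P : Finset X} (hP : (l : Multiset X) = P.val) {η : ℝ≥0∞}
    (hη : ENNReal.ofReal (1 - (1 - δ) / (k * (k * w) : ℕ) ^ m) ^ M ≤ η) {s : Set X}
    (hs : IsCenterSet C k s) :
    Guarantees (oracles C Γ near G Q D) m w K 0 (.pair (.nat k) (.ofList (l.map .pt)))
      (timeFactor m t G M ^ (k + 1) * ((Q + D) * l.length)) (k * η)
      fun v => IsCenterSet C k (outputSet v) ∧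
        KMedian.cost P (outputSet v) ≤ (1 + ε) ^ 2 * KMedian.cost P s := by
  classical
  have hw₀ : 0 < w := by omega
  have hM₀ : 0 < M := by rw [hM]; positivity
  obtain ⟨U, a, hU, hUk, haU, ha⟩ := hs.exists_assignment
  set R := l.map fun x => ((x, none) : X × Option ℝ) with hR
  have hR₀ : R ≠ [] := by simpa [hR] using hl
  have hnd : (R.map Prod.fst).Nodup := by
    rw [hR, map_fst_none]
    exact Multiset.coe_nodup.1 (hP ▸ P.nodup)
  have hn : 0 < R.length := List.length_pos_of_ne_nil hR₀
  have hlen : R.length = l.length := by simp [hR]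
  have hW : k < k * (k * w) := by
    have : k * 1 < k * (k * w) := Nat.mul_lt_mul_of_pos_left (by nlinarith) hk
    omega
  -- At the start every point is bad, so without a large cluster `W ≤ k` would follow. This is why
  -- it is harmless that `main` does not prune.
  obtain ⟨o, ho, hlarge⟩ : ∃ o ∈ U, R.length ≤ (k * (k * w)) * (cluster a o R).card := by
    rcases exists_large_cluster a U hnd (k * (k * w)) with h | h
    · exact h
    · have h1 : badNum (fun x => a x ∈ U) R = R.length :=
        List.countP_eq_length.2 fun p _ => by simpa using haU p.1
      rw [h1] at h
      have h2 : U.card * R.length ≤ k * R.length := Nat.mul_le_mul_right _ hUk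
      have := Nat.le_of_mul_le_mul_right (h.trans h2) hn
      omega
  have hk' : (0 : ℝ) < k := by exact_mod_cast hk
  have hw' : (0 : ℝ) < w := by exact_mod_cast hw₀
  have hk1 : (1 : ℝ) ≤ k := by exact_mod_cast hk
  have hw1 : (96 : ℝ) ≤ w := by exact_mod_cast hw
  have hkw : (96 : ℝ) ≤ k * w := by nlinarith
  -- The choice `ρ = 1 / (k * w)` gives `ρ * W = k`, as few bad points require, and `96 * ρ * k = 96
  -- / w ≤ ε`.
  have hsg : SearchGood Γ near w K t G Q D M a ε (1 / (k * w)) η (k - 1) := by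
    refine searchGood hΓ hε hδ hm ht hG hD hM₀ hη a (by positivity) ?_ (by positivity) ?_
    · rw [div_le_div_iff₀ (by positivity) (by norm_num)]
      linarith
    · push_cast
      have e : (1 / (k * w) * (k * (k * w)) : ℝ) = k := by field_simp
      rw [e]
      exact_mod_cast Nat.sub_le k 1
  have hc := coll_cluster (near := near) (w := w) (K := K) (G := G) (Q := Q) (D := D) (M := M) hΓ
    hδ hη hR₀ (hU o ho) hlarge
  rw [hlen] at hc
  refine (main_of_branch hm ht hG hD hk hw₀ hK hM hl hc (ηb := (k - 1 : ℕ) * η)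
    (Gb := fun o => ∃ r, o = some r ∧ Valid l [] k r ∧ r.1 ≤ (1 + 96 * (1 / (k * w)) * k) *
      totalSum (fun x => a x ∈ U) (fun _ => 0) (fun x => (1 + ε) * dist x (a x)) R)
    (G₀ := fun v => IsCenterSet C k (outputSet v) ∧
        KMedian.cost P (outputSet v) ≤ (1 + ε) ^ 2 * KMedian.cost P s)
    ?_ (by simp) ?_).mono le_rfl ?_ fun _ h => h
  · rintro L ⟨hL, hLc⟩
    have := branch_good_of_searchGood (Q := Q) hm ht hG hD hΓ.1 hM₀ hε (by positivity) hsg hR₀ hnd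
      (keysValid_none l) hU (by omega) (wt := fun _ => 0) (fun p _ hp => absurd (haU _) hp) ho hL hLc
    rw [hR, List.length_map, map_fst_none, Nat.sub_add_cancel hk] at this
    have e : ((k - 1 : ℕ) : ℝ) + 1 = k := by
      rw [← Nat.cast_succ, Nat.succ_eq_add_one, Nat.sub_add_cancel hk]
    rw [e] at this
    rw [Nat.sub_add_cancel hk]
    exact this
  · rintro r ⟨r', h, hr, hb⟩
    obtain rfl := Option.some_injective _ h
    have e : outputSet (encCtrs r.2 : Val X C) = centers r.2 := by
      simp [outputSet, encCtrs, centers]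
    rw [e]
    refine ⟨hr.isCenterSet, ?_⟩
    have h1 : totalSum (fun x => a x ∈ U) (fun _ => 0) (fun x => (1 + ε) * dist x (a x)) R =
        (1 + ε) * KMedian.cost P s := by
      simp only [totalSum, haU, if_true, hR, List.map_map, Function.comp_def, KMedian.cost]
      rw [sum_list_eq hP, ← Finset.mul_sum]
      simp only [ha]
    have h2 : (1 + 96 * (1 / (k * w)) * k : ℝ) ≤ 1 + ε := by
      have : (96 * (1 / (k * w)) * k : ℝ) = 96 / w := by field_simp
      rw [this, add_le_add_iff_left, div_le_iff₀ hw']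
      exact hwε
    have h3 : 0 ≤ KMedian.cost P s := Finset.sum_nonneg fun _ _ => Metric.infDist_nonneg
    calc KMedian.cost P (centers r.2) ≤ r.1 := by
          rw [KMedian.cost, ← sum_list_eq hP]; exact hr.2.2.1
      _ ≤ _ := hb
      _ ≤ (1 + ε) * ((1 + ε) * KMedian.cost P s) := by
          rw [h1]
          exact mul_le_mul_of_nonneg_right h2 (by positivity)
      _ = _ := by ring
  · obtain ⟨k', rfl⟩ : ∃ k', k = k' + 1 := ⟨k - 1, by omega⟩
    simp [add_mul, add_comm]

/-- The output is an approximate solution: comparison with all solutions at once. -/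
theorem main_approx {ε δ : ℝ} (hΓ : WeakSampling C ε δ m t Γ) (hε : 0 ≤ ε) (hε' : ε ≤ 1) (hδ : δ < 1)
    (hm : 0 < m) (ht : 0 < t) (hG : 0 < G) (hD : 0 < D) {k M : ℕ} (hk : 0 < k) (hw : 96 ≤ w)
    (hK : 0 < K) (hM : M = (k * (k * w)) ^ m * (k * K)) (hwε : 96 ≤ ε * w) {l : List X} (hl : l ≠ [])
    {P : Finset X} (hP : (l : Multiset X) = P.val) {η : ℝ≥0∞}
    (hη : ENNReal.ofReal (1 - (1 - δ) / (k * (k * w) : ℕ) ^ m) ^ M ≤ η) :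
    Guarantees (oracles C Γ near G Q D) m w K 0 (.pair (.nat k) (.ofList (l.map .pt)))
      (timeFactor m t G M ^ (k + 1) * ((Q + D) * l.length)) (k * η)
      fun v => IsApproxMedian C P k (1 + 3 * ε) (outputSet v) := by
  intro d hd
  -- For infinite `C` there may be no optimal solution, and the failure event in `main_good` depends
  -- on the competitor. Competitors of cost below `I + 1 / (j + 1)` give decreasing success events.
  set I := sInf (KMedian.cost P '' {s | IsCenterSet C k s}) with hI
  have hbdd : BddBelow (KMedian.cost P '' {s | IsCenterSet C k s}) := by
    refine ⟨0, ?_⟩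
    rintro _ ⟨s, -, rfl⟩
    exact Finset.sum_nonneg fun _ _ => Metric.infDist_nonneg
  have hne : (KMedian.cost P '' {s | IsCenterSet C k s}).Nonempty := by
    obtain ⟨x, hx⟩ := List.exists_mem_of_ne_nil _ hl
    refine ⟨_, {(near x : X)}, ⟨by simp, by simp, ?_⟩, rfl⟩
    rw [Set.encard_singleton]
    exact_mod_cast hk
  have hI₀ : 0 ≤ I := by
    refine le_csInf hne ?_
    rintro _ ⟨s, -, rfl⟩
    exact Finset.sum_nonneg fun _ _ => Metric.infDist_nonneg
  have h : Ensures (Program.run (oracles C Γ near G Q D) (code m w K) d 0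
      (.pair (.nat k) (.ofList (l.map .pt))))
      (timeFactor m t G M ^ (k + 1) * ((Q + D) * l.length)) (k * η) fun v => ∀ j : ℕ,
        IsCenterSet C k (outputSet v) ∧
        KMedian.cost P (outputSet v) ≤ (1 + ε) ^ 2 * (I + 1 / ((j : ℝ) + 1)) := by
    refine Outcome.Ensures.forall_of_antitone ?_ fun j => ?_
    · rintro j v ⟨h1, h2⟩
      refine ⟨h1, h2.trans ?_⟩
      push_cast
      gcongr
      linarith
    · obtain ⟨_, ⟨s, hs, rfl⟩, hsI⟩ := exists_lt_of_csInf_lt hne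
        (show I < I + 1 / ((j : ℝ) + 1) by
          have : (0 : ℝ) < 1 / ((j : ℝ) + 1) := by positivity
          linarith)
      refine (main_good hΓ hε hδ hm ht hG hD hk hw hK hM hwε hl hP hη hs d hd).mono le_rfl le_rfl ?_
      rintro v ⟨h1, h2⟩
      exact ⟨h1, h2.trans (by gcongr)⟩
  refine h.mono le_rfl le_rfl fun v hv => ⟨(hv 0).1, fun s hs => ?_⟩
  have h1 : KMedian.cost P (outputSet v) ≤ (1 + ε) ^ 2 * (I + 0) := by
    exact ge_of_tendsto' ((tendsto_one_div_add_atTop_nhds_zero_nat.const_add I).const_mul _)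
      fun j => (hv j).2
  have h2 : I ≤ KMedian.cost P s := csInf_le hbdd ⟨s, hs, rfl⟩
  calc KMedian.cost P (outputSet v) ≤ (1 + ε) ^ 2 * I := by simpa using h1
    _ ≤ (1 + 3 * ε) * I := mul_le_mul_of_nonneg_right (by nlinarith) hI₀
    _ ≤ _ := mul_le_mul_of_nonneg_left h2 (by positivity)

end Main

/-! ### Arithmetic of the time bound -/

section Exponents

/-- The time bound in the form of the theorem. -/
theorem time_le {K : ℕ} (hK : 0 < K) {ε : ℝ} (hε : 0 < ε) (hε' : ε < 1) {m k t G L M n U : ℕ}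
    (hm : 0 < m) (hk : 0 < k) (ht : 0 < t) (hG : 0 < G) (hL : (L : ℝ) ≤ 2 / ε)
    (hM : M = (k * (k * (96 * L))) ^ m * (k * K)) (hM₀ : 0 < M) :
    ((timeFactor m t G M ^ (k + 1) * (U * n) : ℕ) : ℝ) ≤
      ((16000 * 192 * K) ^ 2 + 2 * (16000 * 192 * K) + 6 : ℕ) * n *
        (2 : ℝ) ^ ((((16000 * 192 * K) ^ 2 + 2 * (16000 * 192 * K) + 6 : ℕ) : ℝ) *
          (k * m * Real.logb 2 (k / ε * m))) *
        ((t : ℝ) * G) ^ (((16000 * 192 * K) ^ 2 + 2 * (16000 * 192 * K) + 6) * k) * U := by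
  set c := 16000 * 192 * K with hc
  set A := c ^ 2 + 2 * c + 6 with hA
  set y : ℝ := k / ε * m with hy
  have hk1 : (1 : ℝ) ≤ k := by exact_mod_cast hk
  have hm1 : (1 : ℝ) ≤ m := by exact_mod_cast hm
  have hkε : (k : ℝ) ≤ k / ε := by rw [le_div_iff₀ hε]; nlinarith
  have hkm : (k : ℝ) * m ≤ y := mul_le_mul_of_nonneg_right hkε (by positivity)
  have hkm1 : (1 : ℝ) ≤ k * m := one_le_mul_of_one_le_of_one_le hk1 hm1
  have hy1 : 1 ≤ y := hkm1.trans hkm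
  have hc0 : (16000 * 192 : ℝ) ≤ c := by
    rw [hc]; push_cast
    have : (1 : ℝ) ≤ K := by exact_mod_cast hK
    nlinarith
  have hc1 : (1 : ℝ) ≤ c := by linarith
  -- the time without the oracles
  have hbase : (16000 * m * M : ℝ) ≤ (c * y ^ 3) ^ m := by
    have h1 : (k * (k * (96 * L)) : ℝ) ≤ 192 * y ^ 2 := by
      have h2 : (k * (k * (96 * L)) : ℝ) ≤ k * (k * (96 * (2 / ε))) := by gcongr
      have h3 : (k : ℝ) * (k * (96 * (2 / ε))) = 192 * (k * (k / ε)) := by ring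
      have h4 : (k : ℝ) ≤ y := le_trans (by nlinarith) hkm
      have h5 : (k : ℝ) / ε ≤ y := le_mul_of_one_le_right (by positivity) hm1
      have h6 : (k : ℝ) * (k / ε) ≤ y * y := mul_le_mul h4 h5 (by positivity) (by linarith)
      nlinarith
    have h7 : y ≤ y ^ m := le_self_pow₀ hy1 hm.ne'
    have h8 : (16000 * K : ℝ) ≤ (16000 * K) ^ m := le_self_pow₀ (by
      have : (1 : ℝ) ≤ K := by exact_mod_cast hK
      linarith) hm.ne'
    rw [hM]; push_cast
    calc (16000 * m * ((k * (k * (96 * L))) ^ m * (k * K)) : ℝ)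
        = (16000 * K) * (k * (k * (96 * L))) ^ m * (k * m) := by ring
      _ ≤ (16000 * K) ^ m * (192 * y ^ 2) ^ m * y ^ m := by
          gcongr
          exact hkm.trans h7
      _ = (c * y ^ 3) ^ m := by
          rw [hc]; push_cast; rw [← mul_pow, ← mul_pow]; ring
  have h16 : (1 : ℝ) ≤ 16000 * m * M := by
    have : (1 : ℝ) ≤ M := by exact_mod_cast hM₀
    nlinarith
  have hpow : (16000 * m * M : ℝ) ^ (k + 1) ≤ A * y ^ (A * (k * m)) := by
    calc (16000 * m * M : ℝ) ^ (k + 1) ≤ (16000 * m * M : ℝ) ^ (2 * k) :=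
          pow_le_pow_right₀ h16 (by omega)
      _ ≤ ((c * y ^ 3) ^ m) ^ (2 * k) := pow_le_pow_left₀ (by linarith) hbase _
      _ = (c : ℝ) ^ (2 * (k * m)) * y ^ (6 * (k * m)) := by
          rw [← pow_mul, mul_pow, ← pow_mul]
          congr 2 <;> ring
      _ ≤ A * y ^ (A * (k * m)) := by
          -- For `k * m = 1` the base `y` may be close to `1`, so `c ^ 2` must go into the leading
          -- factor `A`. Otherwise `y ≥ 2`, and `c ≤ 2 ^ c ≤ y ^ c` moves the constant into the
          -- exponent.
          by_cases h : k * m = 1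
          · rw [h]
            refine mul_le_mul ?_ (pow_le_pow_right₀ hy1 (by omega)) (by positivity) (by positivity)
            rw [hA]; push_cast
            nlinarith
          · have h2 : 2 ≤ k * m := by
              have := Nat.mul_pos hk hm
              omega
            have hy2 : 2 ≤ y := le_trans (by exact_mod_cast h2) hkm
            have hcy : (c : ℝ) ≤ y ^ c :=
              le_trans (by exact_mod_cast (Nat.lt_two_pow_self (n := c)).le)
                (pow_le_pow_left₀ (by norm_num) hy2 c)
            calc (c : ℝ) ^ (2 * (k * m)) * y ^ (6 * (k * m))
                ≤ (y ^ c) ^ (2 * (k * m)) * y ^ (6 * (k * m)) := by gcongr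
              _ = y ^ ((2 * c + 6) * (k * m)) := by
                  rw [← pow_mul, ← pow_add]; congr 1; ring
              _ ≤ y ^ (A * (k * m)) := pow_le_pow_right₀ hy1
                  (Nat.mul_le_mul_right _ (by rw [hA]; omega))
              _ ≤ A * y ^ (A * (k * m)) := by
                  refine le_mul_of_one_le_left (by positivity) ?_
                  rw [hA]; push_cast
                  nlinarith
  have htG : (1 : ℝ) ≤ (t : ℝ) * G :=
    one_le_mul_of_one_le_of_one_le (by exact_mod_cast ht) (by exact_mod_cast hG)
  have htG' : ((t : ℝ) * G) ^ (k + 1) ≤ ((t : ℝ) * G) ^ (A * k) := by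
    refine pow_le_pow_right₀ htG ?_
    have : 2 * k ≤ A * k := Nat.mul_le_mul_right _ (by rw [hA]; omega)
    omega
  have hexp : (2 : ℝ) ^ ((A : ℝ) * (k * m * Real.logb 2 y)) = y ^ (A * (k * m)) := by
    rw [show (A : ℝ) * (k * m * Real.logb 2 y) = Real.logb 2 y * ((A * (k * m) : ℕ) : ℝ) by
      push_cast; ring, Real.rpow_mul (by norm_num), Real.rpow_logb (by norm_num) (by norm_num)
      (by linarith), Real.rpow_natCast]
  rw [hexp]
  simp only [timeFactor]
  push_cast
  calc ((16000 * (m * t * G * M)) ^ (k + 1) * (U * n) : ℝ)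
      = (16000 * m * M) ^ (k + 1) * ((t : ℝ) * G) ^ (k + 1) * (U * n) := by
        rw [← mul_pow]; congr 2; ring
    _ ≤ (A * y ^ (A * (k * m))) * ((t : ℝ) * G) ^ (A * k) * (U * n) := by gcongr
    _ = _ := by rw [hA]; push_cast; ring

end Exponents

end KMedian

theorem mainTheorem4 (δ : ℝ) (hδ : 0 < δ) (hδ' : δ < 1) :
    ∃ A : ℕ, ∀ (ε : ℝ) (_ : 0 < ε) (_ : ε < 1) (m : ℕ) (_ : 0 < m),
      ∃ prog : KMedian.Program,
        ∀ (X : Type*) [PseudoMetricSpace X] (C : Set X)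
          -- the weak sampling property, with its candidate map
          (t : ℕ) (_ : 0 < t) (Γ : (Fin m → X) → Finset C) (_ : KMedian.WeakSampling C ε δ m t Γ)
          -- a closest point of `C`, for every point of `X`
          (near : X → C) (_ : ∀ (x : X) (c : C), dist x (near x : X) ≤ dist x (c : X))
          -- the number of operations for `Γ`, the times for `near` and for `dist`
          (G Q D : ℕ) (_ : 0 < G) (_ : 0 < Q) (_ : 0 < D)
          -- the input: `k` and the points of `P`, listed in any order
          (k : ℕ) (_ : 0 < k) (P : Finset X) (_ : P.Nonempty)
          (l : List X) (_ : (l : Multiset X) = P.val),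
          prog.Achieves (KMedian.oracles C Γ near G Q D) (KMedian.input C k l)
            (A * P.card * (2 : ℝ) ^ (A * (k * m * Real.logb 2 (k / ε * m)))
              * ((t : ℝ) * G) ^ (A * k) * (Q + D))
            (1 - δ)
            (fun v => KMedian.IsApproxMedian C P k (1 + 3 * ε) (KMedian.outputSet v)) := by
  set K := ⌈(1 - Real.log δ) / (1 - δ)⌉₊ with hKdef
  have hlog := Real.log_neg hδ hδ'
  have hK : 0 < K := Nat.ceil_pos.2 (div_pos (by linarith) (by linarith))
  refine ⟨(16000 * 192 * K) ^ 2 + 2 * (16000 * 192 * K) + 6, fun ε hε hε' m hm => ?_⟩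
  -- The parameter `w = 96 * L` satisfies `96 ≤ ε * w`, while `L ≤ 2 / ε` keeps the time polynomial
  -- in `1 / ε` for fixed `k` and `m`.
  set L := ⌈1 / ε⌉₊ with hLdef
  have hL : 0 < L := Nat.ceil_pos.2 (by positivity)
  have hL₁ : 1 / ε ≤ L := Nat.le_ceil _
  have hL₂ : (L : ℝ) ≤ 2 / ε := by
    have h1 := (Nat.ceil_lt_add_one (show 0 ≤ 1 / ε by positivity)).le
    have h2 : 1 ≤ 1 / ε := by rw [le_div_iff₀ hε]; linarith
    have h3 : 2 / ε = 1 / ε + 1 / ε := by ring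
    rw [h3]
    exact h1.trans (by linarith)
  refine ⟨KMedian.code m (96 * L) K, ?_⟩
  intro X _ C t ht Γ hΓ near _ G Q D hG hQ hD k hk P hP l hl
  set M := (k * (k * (96 * L))) ^ m * (k * K) with hM
  have hM₀ : 0 < M := by positivity
  have hcard : P.card = l.length := by
    rw [Finset.card, ← hl, Multiset.coe_card]
  have hl₀ : l ≠ [] := by
    rintro rfl
    have := hP.card_pos
    rw [List.length_nil] at hcard
    omega
  have hη : ENNReal.ofReal (1 - (1 - δ) / (k * (k * (96 * L)) : ℕ) ^ m) ^ M ≤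
      ENNReal.ofReal (δ / k) := by
    have hW : 0 < k * (k * (96 * L)) := by positivity
    rw [← ENNReal.ofReal_pow]
    · exact ENNReal.ofReal_le_ofReal
        (KMedian.one_sub_pow_le hδ hδ' hk hW (Nat.le_ceil _))
    · rw [sub_nonneg, div_le_one (by positivity)]
      have : (1 : ℝ) ≤ ((k * (k * (96 * L)) : ℕ) : ℝ) ^ m := one_le_pow₀ (by exact_mod_cast hW)
      linarith
  have hT := KMedian.time_le hK hε hε' (n := P.card) (U := Q + D) hm hk ht hG hL₂ hM hM₀
  -- The allowed recursion depth is the time bound itself.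
  refine ⟨KMedian.timeFactor m t G M ^ (k + 1) * ((Q + D) * P.card), fun r hr => ?_, ?_⟩
  · have h := KMedian.main_halts (near := near) (Q := Q) (K := K) hm ht hG hD hΓ.1 hk
      (show 0 < 96 * L by omega) hK hM hl₀ _ le_rfl
    rw [← hcard] at h
    obtain ⟨v, τ, h1, h2, -⟩ := KMedian.Outcome.ensures_zero_iff.1 h r hr
    refine ⟨v, τ, h1, le_trans (by exact_mod_cast h2) (hT.trans_eq ?_)⟩
    push_cast
    ring
  · have hkη : (k : ENNReal) * ENNReal.ofReal (δ / k) = ENNReal.ofReal δ := by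
      rw [← ENNReal.ofReal_natCast, ← ENNReal.ofReal_mul (by positivity)]
      congr 1
      field_simp
    have h := KMedian.main_approx (near := near) (Q := Q) (K := K) hΓ hε.le hε'.le hδ' hm ht hG hD hk
      (show 96 ≤ 96 * L by omega) hK hM ?_ hl₀ hl hη _ le_rfl
    · rw [hkη, ← hcard] at h
      exact h.le_toReal hδ.le
    · push_cast
      rw [div_le_iff₀ hε] at hL₁
      linarith
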